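/- **Setting.** Let $d,m\in\mathbb N$ and let $(\Omega,\mathcal F,\mathbb P)$ be a probability space with a measurable action $(\tau_x)_{x\in\mathbb R^d}$ of the group $\mathbb R^d$ (that is, $(x,\omega)\mapsto\tau_x\omega$ is measurable, $\tau_0=\mathrm{id}$, $\tau_{x+y}=\tau_x\circ\tau_y$) that preserves $\mathbb P$ and is ergodic: every measurable $\varphi:\Omega\to\mathbb R$ such that, for each $x$, $\varphi\circ\tau_x=\varphi$ almost surely is almost surely constant. Let $A,B\subset\mathbb R^m$ be non-empty compact sets. Let $f:A\times B\to\mathbb R^d$ be continuous and oriented: there are $\delta>0$ and a unit vector $e\in\mathbb R^d$ with $\langle f(a,b),e\rangle\ge\delta$ for all $(a,b)\in A\times B$. Let $\ell:\mathbb R^d\times A\times B\times\Omega\to\mathbb R$ be jointly measurable and such that * ($\ell_1$) $\ell(\cdot,\cdot,\cdot,\omega)$ is bounded and uniformly continuous on $\mathbb R^d\times A\times B$ for every $\omega$; * ($\ell_2$) there is $L>0$ with $|\ell(x,a,b,\omega)-\ell(y,a,b,\omega)|\le L|x-y|$ for all $x,y,a,b,\omega$; * ($\ell_3$) $\ell(x,a,b,\omega)=\ell(0,a,b,\tau_x\omega)$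 for all $x,a,b,\omega$; * ($\ell_4$) there is $\rho>0$ such that, for all $S,\widehat S\subseteq\mathbb R^d$ with $|x-y|\ge\rho$ for all $x\in S$, $y\in\widehat S$, the $\sigma$-algebras generated by $\{\ell(x,a,b,\cdot): x\in S,\,(a,b)\in A\times B\}$ and by $\{\ell(x,a,b,\cdot): x\in\widehat S,\,(a,b)\in A\times B\}$ are independent. Put $$H(x,p,\omega)=\max_{b\in B}\min_{a\in A}\{-\ell(x,a,b,\omega)-\langle f(a,b),p\rangle\}$$ and assume that $H$ is jointly measurable and that, for some constant $\beta>0$ and all $x,y,p,q\in\mathbb R^d$, $\omega\in\Omega$, * (H1) $|H(x,p,\omega)|\le\beta(1+|p|)$; * (H2) $|H(x,p,\omega)-H(x,q,\omega)|\le\beta|p-q|$; * (H3) $|H(x,p,\omega)-H(y,p,\omega)|\le\beta|x-y|$. Solutions are continuous viscosity solutions, tested with $C^1$ functions. **Theorem.** There exist a continuous function $\overline H:\mathbb R^d\to\mathbb R$ and a set $\hat\Omega\in\mathcal F$ with $\mathbb P(\hat\Omega)=1$ such that, for every $\omega\in\hat\Omega$, every $T>0$ and every uniformly continuous $g:\mathbb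 R^d\to\mathbb R$, the following holds. For each $\varepsilon>0$ the problem $$\partial_tu^\varepsilon+H\left(\tfrac x\varepsilon,D_xu^\varepsilon,\omega\right)=0\ \text{ in }(0,T)\times\mathbb R^d,\qquad u^\varepsilon(0,\cdot)=g$$ has a unique solution $u^\varepsilon\in C([0,T)\times\mathbb R^d)$, the problem $$\partial_t\bar u+\overline H(D_x\bar u)=0\ \text{ in }(0,T)\times\mathbb R^d,\qquad \bar u(0,\cdot)=g$$ has a unique solution $\bar u\in C([0,T)\times\mathbb R^d)$, and $u^\varepsilon\to\bar u$ uniformly on compact subsets of $[0,T)\times\mathbb R^d$ as $\varepsilon\to0^+$. Furthermore, $\overline H$ satisfies (H1) and (H2) with the same constant $\beta$: $|\overline H(p)|\le\beta(1+|p|)$ and $|\overline H(p)-\overline H(q)|\le\beta|p-q|$ for all $p,q\in\mathbb R^d$. -/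

import Mathlib

open MeasureTheory ProbabilityTheory Filter Topology Set

/-- The Euclidean space of dimension `k`. -/
abbrev Euc (k : ℕ) : Type := EuclideanSpace ℝ (Fin k)

/-! ### The random environment -/

/-- A measurable, measure-preserving, ergodic action `(τ_x)` of the group `ℝᵈ` on a probability
space `(Ω, P)`. -/
structure IsErgodicAction {d : ℕ} {Ω : Type*} [MeasurableSpace Ω] (P : Measure Ω)
    (τ : Euc d → Ω → Ω) : Prop where
  measurable : Measurable fun q : Euc d × Ω => τ q.1 q.2
  zero : ∀ ω, τ 0 ω = ω
  add : ∀ x y ω, τ (x + y) ω = τ x (τ y ω)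
  preserving : ∀ x, MeasurePreserving (τ x) P P
  ergodic : ∀ φ : Ω → ℝ, Measurable φ → (∀ x, ∀ᵐ ω ∂P, φ (τ x ω) = φ ω) →
    ∃ c : ℝ, ∀ᵐ ω ∂P, φ ω = c

/-- The σ-algebra generated by the random variables `X i x`, for `i` in the index set and
`x ∈ S`. -/
abbrev generatedSigma {d : ℕ} {Ω ι : Type*} (X : ι → Euc d → Ω → ℝ) (S : Set (Euc d)) :
    MeasurableSpace Ω :=
  ⨆ (i : ι) (x : Euc d) (_ : x ∈ S), MeasurableSpace.comap (X i x) inferInstance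

/-- Finite range of dependence: for some `ρ > 0`, the values of the fields `X i` on two sets of
points whose mutual distance `inf |x - y|` is at least `ρ` are independent. -/
def LongRangeIndependent {d : ℕ} {Ω ι : Type*} [MeasurableSpace Ω] (P : Measure Ω)
    (X : ι → Euc d → Ω → ℝ) : Prop :=
  ∃ ρ : ℝ, 0 < ρ ∧ ∀ S S' : Set (Euc d), (∀ x ∈ S, ∀ y ∈ S', ρ ≤ dist x y) →
    Indep (generatedSigma X S) (generatedSigma X S') P

/-! ### Hamiltonians -/

/-- Linear growth: condition (H1), for a function of the momentum. -/
def LinearGrowth {d : ℕ} (β : ℝ) (h : Euc d → ℝ) : Prop :=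
  ∀ p, |h p| ≤ β * (1 + ‖p‖)

/-- Lipschitz continuity in the momentum: condition (H2), for a function of the momentum. -/
def MomentumLipschitz {d : ℕ} (β : ℝ) (h : Euc d → ℝ) : Prop :=
  ∀ p q, |h p - h q| ≤ β * ‖p - q‖

/-- The class of jointly measurable random Hamiltonians `H x p ω` that satisfy (H1), (H2), (H3)
with the constant `β`. -/
structure IsHamiltonian {d : ℕ} {Ω : Type*} [MeasurableSpace Ω] (β : ℝ)
    (H : Euc d → Euc d → Ω → ℝ) : Prop where
  pos : 0 < β
  measurable : Measurable fun q : Euc d × Euc d × Ω => H q.1 q.2.1 q.2.2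
  growth : ∀ x ω, LinearGrowth β fun p => H x p ω
  lip_momentum : ∀ x ω, MomentumLipschitz β fun p => H x p ω
  lip_space : ∀ x y p ω, |H x p ω - H y p ω| ≤ β * ‖x - y‖

/-- The max-min Hamiltonian `max_b min_a { -ℓ(x,a,b,ω) - ⟨f(a,b), p⟩ }`. The action sets are
compact and non-empty and `ℓ`, `f` are continuous in the actions wherever it is used, so that
supremum and infimum are a maximum and a minimum. -/
noncomputable def gameHamiltonian {d m : ℕ} {Ω : Type*} {A B : Set (Euc m)}
    (f : A → B → Euc d) (ℓ : Euc d → A → B → Ω → ℝ) (x p : Euc d) (ω : Ω) : ℝ :=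
  ⨆ b : B, ⨅ a : A, (-ℓ x a b ω - inner ℝ (f a b) p)

/-- The dynamics `f` is continuous and oriented: `⟨f(a,b), e⟩ ≥ δ` for some `δ > 0` and some unit
vector `e`. -/
structure IsOrientedDynamics {d m : ℕ} {A B : Set (Euc m)} (f : A → B → Euc d) : Prop where
  continuous : Continuous fun q : A × B => f q.1 q.2
  oriented : ∃ δ : ℝ, 0 < δ ∧ ∃ e : Euc d, ‖e‖ = 1 ∧ ∀ a b, δ ≤ inner ℝ (f a b) e

/-- Jointly measurable, stationary running costs: bounded and uniformly continuous for each `ω`,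
Lipschitz in space uniformly in all the other variables. -/
structure IsRunningCost {d m : ℕ} {Ω : Type*} [MeasurableSpace Ω] {A B : Set (Euc m)}
    (τ : Euc d → Ω → Ω) (ℓ : Euc d → A → B → Ω → ℝ) : Prop where
  measurable : Measurable fun q : Euc d × A × B × Ω => ℓ q.1 q.2.1 q.2.2.1 q.2.2.2
  bounded : ∀ ω, ∃ C : ℝ, ∀ x a b, |ℓ x a b ω| ≤ C
  uniformContinuous : ∀ ω, UniformContinuous fun q : Euc d × A × B => ℓ q.1 q.2.1 q.2.2 ω
  lipschitz : ∃ L : ℝ, 0 < L ∧ ∀ x y a b ω, |ℓ x a b ω - ℓ y a b ω| ≤ L * ‖x - y‖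
  stationary : ∀ x a b ω, ℓ x a b ω = ℓ 0 a b (τ x ω)

/-! ### Viscosity solutions of `∂ₜ u + H(x, Du) = 0` in `(0,T) × ℝᵈ` -/

/-- Viscosity subsolutions, tested with `C¹` functions. -/
def IsViscositySubsolution {d : ℕ} (T : ℝ) (H : Euc d → Euc d → ℝ) (u : ℝ × Euc d → ℝ) : Prop :=
  UpperSemicontinuousOn u (Ioo 0 T ×ˢ univ) ∧
  ∀ φ : ℝ × Euc d → ℝ, ContDiffOn ℝ 1 φ (Ioo 0 T ×ˢ univ) →
    ∀ t ∈ Ioo 0 T, ∀ x : Euc d, IsLocalMax (fun z => u z - φ z) (t, x) →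
      deriv (fun s => φ (s, x)) t + H x (gradient (fun y => φ (t, y)) x) ≤ 0

/-- Viscosity supersolutions, tested with `C¹` functions. -/
def IsViscositySupersolution {d : ℕ} (T : ℝ) (H : Euc d → Euc d → ℝ) (u : ℝ × Euc d → ℝ) : Prop :=
  LowerSemicontinuousOn u (Ioo 0 T ×ˢ univ) ∧
  ∀ φ : ℝ × Euc d → ℝ, ContDiffOn ℝ 1 φ (Ioo 0 T ×ˢ univ) →
    ∀ t ∈ Ioo 0 T, ∀ x : Euc d, IsLocalMin (fun z => u z - φ z) (t, x) →
      0 ≤ deriv (fun s => φ (s, x)) t + H x (gradient (fun y => φ (t, y)) x)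

/-- `u ∈ C([0,T) × ℝᵈ)` is a viscosity solution of the Cauchy problem with initial datum `g`. Only
the values of `u` on `[0,T) × ℝᵈ` matter. -/
structure IsCauchySolution {d : ℕ} (T : ℝ) (H : Euc d → Euc d → ℝ) (g : Euc d → ℝ)
    (u : ℝ × Euc d → ℝ) : Prop where
  continuousOn : ContinuousOn u (Ico 0 T ×ˢ univ)
  initial : ∀ x, u (0, x) = g x
  subsolution : IsViscositySubsolution T H u
  supersolution : IsViscositySupersolution T H u

/-- The Cauchy problem has one and, on `[0,T) × ℝᵈ`, only one continuous viscosity solution. -/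
def CauchyWellPosed {d : ℕ} (T : ℝ) (H : Euc d → Euc d → ℝ) (g : Euc d → ℝ) : Prop :=
  (∃ u, IsCauchySolution T H g u) ∧
  ∀ u v, IsCauchySolution T H g u → IsCauchySolution T H g v → EqOn u v (Ico 0 T ×ˢ univ)

/-! ### Test functions -/

/-! Everything reduces to plane waves. For a momentum `p` let `W p` solve ∂ₜw + H(x, p + Dw) = 0
with w(0, ·) = 0; it is the value of a differential game with dynamics `f`, running cost ℓ + ⟨f, p⟩
and zero terminal payoff. The core is a law of large numbers: almost surely W p (N, x) = c(p) N +
o(N), uniformly for |x| ≤ R N. The effective Hamiltonian is then -c.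

The law of large numbers comes from concentration (`exists_mgf_bound`). Since ⟨f, e⟩ ≥ δ, a
trajectory crosses a slab orthogonal to `e` only once and spends in it at most its width divided by
δ. Changing the cost inside a slab of width of order ρ therefore changes the value by a bounded
amount (`IsGame.iterate_le_of_eq_off_slab`). Reveal the environment slab by slab in the direction
`e`. Once the cost is erased in one slab, what lies beyond is independent of what has been revealed,
so each revelation moves the conditional expectation of the value by O(1)
(`condExp_eq_of_indep_sup`). As the speed is finite, O(t) slabs matter up to time t, and the
Azuma–Hoeffding argument gives sub-Gaussian fluctuations of variance O(t). At time N, deviations of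
size N^(3/4) are so rare that a union bound over a polynomial grid controls all |x| ≤ R N
(`IsConcentratedField.exists_uniform_bound`). With dynamic programming this makes the mean additive
up to O(N^(3/4)), hence close to a linear function (`exists_linear_approx`), and Borel–Cantelli
gives almost sure convergence (`IsConcentratedField.exists_limit`).

The passage to a general datum is deterministic. If u^ε lies below an affine function of slope `p`
at some time, then comparison with the rescaled plane wave keeps it below the same function lowered
by h H̄(p) after a time h, up to o(1) (`IsPlaneWaveFamily.upperConsistent`). This consistency makes
the upper half-relaxed limit a subsolution of the effective equation. The lower one is handled by
the symmetry u ↦ -u, H ↦ -H(x, -p). Comparison with finite speed of propagation (`local_comparison`)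
forces the two to coincide, which also produces the solution of the limit problem.

The same scheme of half-relaxed limits, applied to a time discretization of the game, constructs the
solutions for fixed ε. The discrete values have a second role: they are iterates of an explicit
min-max operator, so their measurability with respect to the cost on a given region is elementary,
and the concentration bound, uniform in the time step, passes to the limit. -/

theorem mem_nhds_cylinder {d : ℕ} {T t : ℝ} (ht : t ∈ Ioo 0 T) (x : Euc d) :
    Ioo 0 T ×ˢ (univ : Set (Euc d)) ∈ 𝓝 (t, x) :=
  prod_mem_nhds (Ioo_mem_nhds ht.1 ht.2) univ_mem

/-- A function that is `C¹` near a point agrees near it with a globally `C¹` function. -/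
theorem exists_contDiff_eventuallyEq {d : ℕ} {φ : ℝ × Euc d → ℝ} {z : ℝ × Euc d}
    (hφ : ContDiffAt ℝ 1 φ z) : ∃ ψ : ℝ × Euc d → ℝ, ContDiff ℝ 1 ψ ∧ ψ =ᶠ[𝓝 z] φ := by
  obtain ⟨r, hr, hball⟩ := Metric.mem_nhds_iff.1
    ((hφ.eventually (by simp)).exists_mem.choose_spec.1)
  have hC : ∀ w ∈ Metric.ball z r, ContDiffAt ℝ 1 φ w := fun w hw =>
    (hφ.eventually (by simp)).exists_mem.choose_spec.2 w (hball hw)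
  let b : ContDiffBump z := ⟨r / 4, r / 2, by positivity, by linarith⟩
  refine ⟨fun w => b w * φ w, ?_, ?_⟩
  · rw [contDiff_iff_contDiffAt]
    intro w
    by_cases hw : w ∈ Metric.ball z r
    · exact b.contDiff.contDiffAt.mul (hC w hw)
    · have h0 : (fun w => b w * φ w) =ᶠ[𝓝 w] fun _ => 0 := by
        have : w ∉ tsupport b := by
          rw [b.tsupport_eq]
          intro h
          exact hw (Metric.closedBall_subset_ball (by change r / 2 < r; linarith) h)
        filter_upwards [(isClosed_tsupport b).isOpen_compl.mem_nhds this] with y hy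
        rw [image_eq_zero_of_notMem_tsupport hy, zero_mul]
      exact contDiffAt_const.congr_of_eventuallyEq h0
  · filter_upwards [b.eventuallyEq_one] with y hy
    simp [hy]

theorem hasGradientAt_congr_snd {d : ℕ} {φ ψ : ℝ × Euc d → ℝ} {t : ℝ} {x p : Euc d}
    (h : ψ =ᶠ[𝓝 (t, x)] φ) (hp : HasGradientAt (fun y => φ (t, y)) p x) :
    HasGradientAt (fun y => ψ (t, y)) p x := by
  refine hp.congr_of_eventuallyEq ?_
  have hc : ContinuousAt (fun y : Euc d => (t, y)) x := by fun_prop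
  exact hc.eventually h

theorem hasDerivAt_congr_fst {d : ℕ} {φ ψ : ℝ × Euc d → ℝ} {t : ℝ} {x : Euc d} {a : ℝ}
    (h : ψ =ᶠ[𝓝 (t, x)] φ) (ha : HasDerivAt (fun s => φ (s, x)) a t) :
    HasDerivAt (fun s => ψ (s, x)) a t := by
  refine ha.congr_of_eventuallyEq ?_
  have hc : ContinuousAt (fun s : ℝ => (s, x)) t := by fun_prop
  exact hc.eventually h

/-- Viscosity subsolutions may be tested with functions that are `C¹` near the contact point. -/
theorem IsViscositySubsolution.test {d : ℕ} {T : ℝ} {H : Euc d → Euc d → ℝ} {u : ℝ × Euc d → ℝ}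
    (hu : IsViscositySubsolution T H u) {φ : ℝ × Euc d → ℝ} {t : ℝ} {x : Euc d}
    (ht : t ∈ Ioo 0 T) (hφ : ContDiffAt ℝ 1 φ (t, x))
    (hmax : IsLocalMax (fun z => u z - φ z) (t, x)) {a : ℝ} {p : Euc d}
    (ha : HasDerivAt (fun s => φ (s, x)) a t) (hp : HasGradientAt (fun y => φ (t, y)) p x) :
    a + H x p ≤ 0 := by
  obtain ⟨ψ, hψ, hψφ⟩ := exists_contDiff_eventuallyEq hφ
  have h := hu.2 ψ hψ.contDiffOn t ht x ?_
  · rwa [(hasDerivAt_congr_fst hψφ ha).deriv, (hasGradientAt_congr_snd hψφ hp).gradient] at h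
  · have h0 := hψφ.self_of_nhds
    filter_upwards [hmax, hψφ] with z hz hz'
    simpa [hz', h0] using hz

/-- Together with `IsViscositySubsolution.test` this lets a test function be transported through a
change of unknown without extending it to the whole cylinder. -/
theorem IsViscositySubsolution.of_test {d : ℕ} {T : ℝ} {H : Euc d → Euc d → ℝ}
    {u : ℝ × Euc d → ℝ} (husc : UpperSemicontinuousOn u (Ioo 0 T ×ˢ univ))
    (h : ∀ (φ : ℝ × Euc d → ℝ) (t : ℝ) (x : Euc d) (a : ℝ) (p : Euc d), t ∈ Ioo 0 T →
      ContDiffAt ℝ 1 φ (t, x) → IsLocalMax (fun z => u z - φ z) (t, x) →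
      HasDerivAt (fun s => φ (s, x)) a t → HasGradientAt (fun y => φ (t, y)) p x →
      a + H x p ≤ 0) : IsViscositySubsolution T H u := by
  refine ⟨husc, fun φ hφ t ht x hmax => ?_⟩
  have hc : ContDiffAt ℝ 1 φ (t, x) := hφ.contDiffAt (mem_nhds_cylinder ht x)
  have hd : DifferentiableAt ℝ φ (t, x) := hc.differentiableAt (by simp)
  refine h φ t x _ _ ht hc hmax ?_ ?_
  · exact (hd.comp t (f := fun s : ℝ => (s, x)) (by fun_prop)).hasDerivAt
  · exact (hd.comp x (f := fun y : Euc d => (t, y)) (by fun_prop)).hasGradientAt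

/-! ### Duality between sub- and supersolutions -/

theorem HasGradientAt.neg' {d : ℕ} {φ : Euc d → ℝ} {p x : Euc d} (h : HasGradientAt φ p x) :
    HasGradientAt (fun y => -φ y) (-p) x := by
  rw [hasGradientAt_iff_hasFDerivAt] at h ⊢
  rw [map_neg]
  exact h.neg

/-- The symmetry u ↦ -u, H(x, p) ↦ -H(x, -p) exchanges maxima and minima of u - φ. All lower bounds
below are obtained from upper bounds through it. -/
theorem IsViscositySupersolution.neg {d : ℕ} {T : ℝ} {H : Euc d → Euc d → ℝ} {u : ℝ × Euc d → ℝ}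
    (hu : IsViscositySupersolution T H u) :
    IsViscositySubsolution T (fun x p => -H x (-p)) (fun z => -u z) := by
  refine IsViscositySubsolution.of_test ?_ fun φ t x a p ht hφ hmax ha hp => ?_
  · exact fun z hz c hc => (hu.1 z hz (-c) (by linarith)).mono fun w hw => by
      change -u w < c; linarith
  · obtain ⟨ψ, hψ, hψφ⟩ := exists_contDiff_eventuallyEq hφ
    have h := hu.2 (fun z => -ψ z) hψ.neg.contDiffOn t ht x ?_
    · have hd : deriv (fun s => -ψ (s, x)) t = -a := (hasDerivAt_congr_fst hψφ ha).neg.deriv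
      rw [hd, (hasGradientAt_congr_snd hψφ hp).neg'.gradient] at h
      linarith
    · have h0 := hψφ.self_of_nhds
      filter_upwards [hmax, hψφ] with z hz hz'
      simp only [hz', h0]
      linarith

theorem IsViscositySubsolution.neg {d : ℕ} {T : ℝ} {H : Euc d → Euc d → ℝ} {u : ℝ × Euc d → ℝ}
    (hu : IsViscositySubsolution T (fun x p => -H x (-p)) (fun z => -u z)) :
    IsViscositySupersolution T H u := by
  refine ⟨fun z hz c hc => (hu.1 z hz (-c) (by simpa using hc)).mono fun w hw => by
      simpa using hw, fun φ hφ t ht x hmin => ?_⟩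
  have hc : ContDiffAt ℝ 1 φ (t, x) := hφ.contDiffAt (mem_nhds_cylinder ht x)
  have hd : DifferentiableAt ℝ φ (t, x) := hc.differentiableAt (by simp)
  have h := hu.test (φ := fun z => -φ z) ht hc.neg ?_
    (hd.comp t (f := fun s : ℝ => (s, x)) (by fun_prop)).hasDerivAt.neg
    (hd.comp x (f := fun y : Euc d => (t, y)) (by fun_prop)).hasGradientAt.neg'
  · simp only [neg_neg] at h
    have h' : 0 ≤ deriv (φ ∘ fun s => (s, x)) t + H x (gradient (φ ∘ fun y => (t, y)) x) := by
      linarith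
    exact h'
  · filter_upwards [hmin] with z hz
    linarith

/-! ### Changes of variables -/

theorem HasGradientAt.comp_smul {d : ℕ} {φ : Euc d → ℝ} {p x : Euc d} {c : ℝ}
    (h : HasGradientAt φ p (c • x)) : HasGradientAt (fun y => φ (c • y)) (c • p) x := by
  rw [hasGradientAt_iff_hasFDerivAt] at h ⊢
  have hc : HasFDerivAt (fun y : Euc d => c • y) (c • ContinuousLinearMap.id ℝ (Euc d)) x :=
    (hasFDerivAt_id x).const_smul c
  refine (h.comp x hc).congr_fderiv ?_
  ext y
  simp

theorem hasGradientAt_inner {d : ℕ} (q x : Euc d) : HasGradientAt (fun y => inner ℝ q y) q x := by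
  rw [hasGradientAt_iff_hasFDerivAt]
  exact ((InnerProductSpace.toDual ℝ (Euc d)) q).hasFDerivAt

theorem HasGradientAt.sub' {d : ℕ} {φ ψ : Euc d → ℝ} {p q x : Euc d} (h : HasGradientAt φ p x)
    (h' : HasGradientAt ψ q x) : HasGradientAt (fun y => φ y - ψ y) (p - q) x := by
  rw [hasGradientAt_iff_hasFDerivAt] at h h' ⊢
  rw [map_sub]
  exact h.sub h'

theorem HasGradientAt.add' {d : ℕ} {φ ψ : Euc d → ℝ} {p q x : Euc d} (h : HasGradientAt φ p x)
    (h' : HasGradientAt ψ q x) : HasGradientAt (fun y => φ y + ψ y) (p + q) x := by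
  rw [hasGradientAt_iff_hasFDerivAt] at h h' ⊢
  rw [map_add]
  exact h.add h'

theorem HasGradientAt.const_mul' {d : ℕ} {φ : Euc d → ℝ} {p x : Euc d} (h : HasGradientAt φ p x)
    (c : ℝ) : HasGradientAt (fun y => c * φ y) (c • p) x := by
  rw [hasGradientAt_iff_hasFDerivAt] at h ⊢
  rw [map_smul]
  exact h.const_mul c

theorem hasGradientAt_const' {d : ℕ} (c : ℝ) (x : Euc d) : HasGradientAt (fun _ => c) 0 x := by
  rw [hasGradientAt_iff_hasFDerivAt, map_zero]
  exact hasFDerivAt_const c x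

/-- The change of unknown `v(s,x) = r u(a + s/r, x/r) + ⟨q,x⟩ + b s + c`. -/
noncomputable def rescale {d : ℕ} (r a : ℝ) (q : Euc d) (b c : ℝ) (u : ℝ × Euc d → ℝ)
    (z : ℝ × Euc d) : ℝ :=
  r * u (a + r⁻¹ * z.1, r⁻¹ • z.2) + (inner ℝ q z.2 + b * z.1 + c)

theorem rescale_mem {r a T T' : ℝ} (hr : 0 < r) (ha : 0 ≤ a) (hT : a + r⁻¹ * T' ≤ T)
    {s : ℝ} (hs : s ∈ Ioo 0 T') : a + r⁻¹ * s ∈ Ioo 0 T := by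
  have hr' : 0 < r⁻¹ := inv_pos.2 hr
  constructor
  · have := mul_pos hr' hs.1; linarith
  · have := mul_lt_mul_of_pos_left hs.2 hr'; linarith

/-- A test function for the new unknown is carried back by the inverse `Ψ` of the change of
variables. This one transformation covers time shifts (`a`), addition of constants (`c`), hyperbolic
scaling (`r = ε`), tilting by an affine function (`q`) and addition of a drift in time (`b`). -/
theorem IsViscositySubsolution.rescale {d : ℕ} {T T' : ℝ} {H : Euc d → Euc d → ℝ}
    {u : ℝ × Euc d → ℝ} (hu : IsViscositySubsolution T H u) {r a : ℝ} (hr : 0 < r) (ha : 0 ≤ a)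
    (hT : a + r⁻¹ * T' ≤ T) (q : Euc d) (b c : ℝ) :
    IsViscositySubsolution T' (fun x p => H (r⁻¹ • x) (p - q) - b) (rescale r a q b c u) := by
  have hr' : 0 < r⁻¹ := inv_pos.2 hr
  refine IsViscositySubsolution.of_test ?_ fun φ t x α p ht hφ hmax hα hp => ?_
  · have h1 : UpperSemicontinuousOn (fun z : ℝ × Euc d => u (a + r⁻¹ * z.1, r⁻¹ • z.2))
        (Ioo 0 T' ×ˢ univ) := by
      refine hu.1.comp (Continuous.continuousOn (by fun_prop)) ?_
      rintro ⟨s, x⟩ ⟨hs, -⟩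
      exact ⟨rescale_mem hr ha hT hs, trivial⟩
    have h2 : UpperSemicontinuousOn (fun z : ℝ × Euc d => r * u (a + r⁻¹ * z.1, r⁻¹ • z.2))
        (Ioo 0 T' ×ˢ univ) := by
      intro z hz y hy
      have := h1 z hz (r⁻¹ * y) (by change _ < r⁻¹ * y; rw [lt_inv_mul_iff₀ hr]; exact hy)
      filter_upwards [this] with w hw
      change _ < r⁻¹ * y at hw
      rwa [lt_inv_mul_iff₀ hr] at hw
    exact h2.add (ContinuousOn.upperSemicontinuousOn (by fun_prop))
  · have htt := rescale_mem hr ha hT ht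
    set Ψ : ℝ × Euc d → ℝ × Euc d := fun z => (r * (z.1 - a), r • z.2) with hΨ
    have hΨz : Ψ (a + r⁻¹ * t, r⁻¹ • x) = (t, x) := by
      simp [hΨ, hr.ne']
    let ψ : ℝ × Euc d → ℝ := fun z => r⁻¹ * (φ (Ψ z) -
      (inner ℝ q (r • z.2) + b * (r * (z.1 - a)) + c))
    have hψc : ContDiffAt ℝ 1 ψ (a + r⁻¹ * t, r⁻¹ • x) := by
      have hφ' : ContDiffAt ℝ 1 (fun z => φ (Ψ z)) (a + r⁻¹ * t, r⁻¹ • x) := by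
        refine ContDiffAt.comp (g := φ) (f := Ψ) _ (by rw [hΨz]; exact hφ) ?_
        exact ContDiff.contDiffAt (by fun_prop)
      refine contDiffAt_const.mul (hφ'.sub (ContDiff.contDiffAt ?_))
      have i1 : ContDiff ℝ 1 fun z : ℝ × Euc d => inner ℝ q (r • z.2) :=
        contDiff_const.inner ℝ (by fun_prop)
      have i2 : ContDiff ℝ 1 fun z : ℝ × Euc d => b * (r * (z.1 - a)) := by fun_prop
      exact (i1.add i2).add contDiff_const
    have h1 : r * (a + r⁻¹ * t - a) = t := by field_simp; ring
    have h2 : r • r⁻¹ • x = x := by rw [smul_smul, mul_inv_cancel₀ hr.ne', one_smul]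
    have key := hu.test (a := α - b) (p := p - q) htt hψc ?_ ?_ ?_
    · linarith
    · have hcont : ContinuousAt Ψ (a + r⁻¹ * t, r⁻¹ • x) := by fun_prop
      have := hcont.eventually (by rw [hΨz]; exact hmax)
      filter_upwards [this] with z hz
      obtain ⟨s, y⟩ := z
      have e1 : a + r⁻¹ * (r * (s - a)) = s := by field_simp; ring
      have e2 : r⁻¹ • r • y = y := by rw [smul_smul, inv_mul_cancel₀ hr.ne', one_smul]
      simp only [_root_.rescale, hΨ, e1, e2] at hz
      simp only [ψ, hΨ, h1, h2]
      have h3 := mul_le_mul_of_nonneg_left hz hr'.le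
      have e3 : ∀ A B C : ℝ, A - r⁻¹ * (B - C) = r⁻¹ * (r * A + C - B) := by
        intro A B C; field_simp; ring
      rw [e3, e3]
      exact h3
    · have g1 : HasDerivAt (fun s : ℝ => r * (s - a)) r (a + r⁻¹ * t) := by
        simpa using ((hasDerivAt_id (a + r⁻¹ * t)).sub_const a).const_mul r
      have g2 : HasDerivAt (fun s : ℝ => φ (r * (s - a), x)) (α * r) (a + r⁻¹ * t) := by
        refine HasDerivAt.comp (h₂ := fun s => φ (s, x)) (h := fun s => r * (s - a)) _ ?_ g1
        rw [h1]; exact hα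
      have g3 := (g2.sub (((hasDerivAt_const (a + r⁻¹ * t) (inner ℝ q x)).add
        (g1.const_mul b)).add (hasDerivAt_const _ c))).const_mul r⁻¹
      simp only [ψ, hΨ, h2]
      refine g3.congr_deriv ?_
      field_simp; ring
    · have g2 : HasGradientAt (fun y : Euc d => φ (t, r • y)) (r • p) (r⁻¹ • x) := by
        refine HasGradientAt.comp_smul (φ := fun y => φ (t, y)) ?_
        rw [h2]; exact hp
      have g3 : HasGradientAt (fun y : Euc d => inner ℝ q (r • y)) (r • q) (r⁻¹ • x) :=
        HasGradientAt.comp_smul (hasGradientAt_inner q _)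
      have g4 := (g2.sub' ((g3.add' (hasGradientAt_const' (b * t) _)).add'
        (hasGradientAt_const' c _))).const_mul' r⁻¹
      simp only [ψ, hΨ, h1]
      convert g4 using 1
      rw [add_zero, add_zero, ← smul_sub, smul_smul, inv_mul_cancel₀ hr.ne', one_smul]

theorem IsViscositySupersolution.rescale {d : ℕ} {T T' : ℝ} {H : Euc d → Euc d → ℝ}
    {u : ℝ × Euc d → ℝ} (hu : IsViscositySupersolution T H u) {r a : ℝ} (hr : 0 < r) (ha : 0 ≤ a)
    (hT : a + r⁻¹ * T' ≤ T) (q : Euc d) (b c : ℝ) :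
    IsViscositySupersolution T' (fun x p => H (r⁻¹ • x) (p - q) - b) (rescale r a q b c u) := by
  apply IsViscositySubsolution.neg
  have h := hu.neg.rescale hr ha hT (-q) (-b) (-c)
  convert h using 1
  · ext x p
    rw [show -(p - -q) = -p - q by abel]
    ring
  · ext z
    simp only [_root_.rescale, inner_neg_left]
    ring

/-! ### Comparison with finite speed of propagation -/

theorem hasGradientAt_norm_sub_sq {d : ℕ} (x₀ x : Euc d) :
    HasGradientAt (fun y => ‖y - x₀‖ ^ 2) ((2 : ℝ) • (x - x₀)) x := by
  rw [hasGradientAt_iff_hasFDerivAt]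
  have h := ((hasFDerivAt_id x).sub_const x₀).norm_sq
  refine h.congr_fderiv ?_
  ext y
  simp [mul_sub]

theorem HasGradientAt.comp_hasDerivAt {d : ℕ} {φ : Euc d → ℝ} {p x : Euc d} {k : ℝ → ℝ} {k' : ℝ}
    (hk : HasDerivAt k k' (φ x)) (h : HasGradientAt φ p x) :
    HasGradientAt (fun y => k (φ y)) (k' • p) x := by
  rw [hasGradientAt_iff_hasFDerivAt] at h ⊢
  rw [map_smul]
  exact hk.comp_hasFDerivAt x h

/-- A smoothed distance to `x₀`. -/
noncomputable def smoothDist {d : ℕ} (κ : ℝ) (x₀ x : Euc d) : ℝ := √(‖x - x₀‖ ^ 2 + κ ^ 2)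

theorem smoothDist_pos {d : ℕ} {κ : ℝ} (hκ : 0 < κ) (x₀ x : Euc d) : 0 < smoothDist κ x₀ x :=
  Real.sqrt_pos.2 (by positivity)

theorem norm_sub_le_smoothDist {d : ℕ} (κ : ℝ) (x₀ x : Euc d) : ‖x - x₀‖ ≤ smoothDist κ x₀ x :=
  Real.le_sqrt_of_sq_le (by nlinarith [sq_nonneg κ])

theorem smoothDist_self {d : ℕ} {κ : ℝ} (hκ : 0 < κ) (x₀ : Euc d) : smoothDist κ x₀ x₀ = κ := by
  simp [smoothDist, Real.sqrt_sq hκ.le]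

theorem contDiff_smoothDist {d : ℕ} {κ : ℝ} (hκ : 0 < κ) (x₀ : Euc d) :
    ContDiff ℝ 1 (smoothDist κ x₀) := by
  refine ContDiff.sqrt ?_ fun x => by positivity
  exact ((contDiff_id.sub contDiff_const).norm_sq ℝ).add contDiff_const

theorem hasGradientAt_smoothDist {d : ℕ} {κ : ℝ} (hκ : 0 < κ) (x₀ x : Euc d) :
    HasGradientAt (smoothDist κ x₀) ((smoothDist κ x₀ x)⁻¹ • (x - x₀)) x := by
  have h0 : ‖x - x₀‖ ^ 2 + κ ^ 2 ≠ 0 := by positivity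
  have h := HasGradientAt.comp_hasDerivAt (Real.hasDerivAt_sqrt h0)
    ((hasGradientAt_norm_sub_sq x₀ x).add' (hasGradientAt_const' (κ ^ 2) x))
  rw [add_zero, smul_smul] at h
  have e : (smoothDist κ x₀ x)⁻¹ = 1 / (2 * √(‖x - x₀‖ ^ 2 + κ ^ 2)) * 2 := by
    simp only [smoothDist]
    field_simp
  rw [e]
  exact h

theorem norm_gradient_smoothDist_le {d : ℕ} {κ : ℝ} (hκ : 0 < κ) (x₀ x : Euc d) :
    ‖(smoothDist κ x₀ x)⁻¹ • (x - x₀)‖ ≤ 1 := by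
  have h := smoothDist_pos hκ x₀ x
  rw [norm_smul, norm_inv, Real.norm_eq_abs, abs_of_pos h, inv_mul_le_iff₀ h, mul_one]
  exact norm_sub_le_smoothDist κ x₀ x

theorem IsViscositySupersolution.test {d : ℕ} {T : ℝ} {H : Euc d → Euc d → ℝ}
    {u : ℝ × Euc d → ℝ} (hu : IsViscositySupersolution T H u) {φ : ℝ × Euc d → ℝ} {t : ℝ}
    {x : Euc d} (ht : t ∈ Ioo 0 T) (hφ : ContDiffAt ℝ 1 φ (t, x))
    (hmin : IsLocalMin (fun z => u z - φ z) (t, x)) {a : ℝ} {p : Euc d}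
    (ha : HasDerivAt (fun s => φ (s, x)) a t) (hp : HasGradientAt (fun y => φ (t, y)) p x) :
    0 ≤ a + H x p := by
  have h := hu.neg.test (φ := fun z => -φ z) ht hφ.neg ?_ ha.neg hp.neg'
  · simp only [neg_neg] at h
    linarith
  · filter_upwards [hmin] with z hz
    linarith

/-- Doubling of variables with the penalty exp(M θ), where θ(t, x) is a smoothed |x - x₀| + β t -
R₁. Since ∂ₜθ = β and |Dθ| ≤ 1, the time derivative of the penalty pays exactly for the change of
`H` that its gradient causes. Only values in the backward cone enter, so no growth condition at
infinity is needed. -/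
theorem local_comparison {d : ℕ} {T β K R : ℝ} {H : Euc d → Euc d → ℝ} (hβ : 0 < β)
    (hp : ∀ x, MomentumLipschitz β (H x)) (hx : ∀ x y p, |H x p - H y p| ≤ K * ‖x - y‖)
    {u v : ℝ × Euc d → ℝ} (hu : UpperSemicontinuousOn u (Ico 0 T ×ˢ univ))
    (hv : LowerSemicontinuousOn v (Ico 0 T ×ˢ univ)) (hsub : IsViscositySubsolution T H u)
    (hsup : IsViscositySupersolution T H v) {x₀ : Euc d}
    (h0 : ∀ y, ‖y - x₀‖ ≤ R → u (0, y) ≤ v (0, y)) {t : ℝ} (ht : t ∈ Ico 0 T) (htR : β * t < R) :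
    u (t, x₀) ≤ v (t, x₀) := by
  by_contra! hlt
  obtain ⟨ht0, htT⟩ := ht
  -- The level `R₁` separates the vertex, where θ = -κ < 0, from the sphere |x - x₀| = R and the
  -- time `T'`, where θ ≥ m₀ > 0. For large `M` the penalty is negligible at the vertex and exceeds
  -- the bound `C` for u - v on the lateral and final boundary.
  obtain ⟨R₁, hR₁, hR₁'⟩ := exists_between
    (lt_min htR (mul_lt_mul_of_pos_left htT hβ) : β * t < min R (β * T))
  obtain ⟨hR₁R, hR₁T⟩ := lt_min_iff.1 hR₁'
  obtain ⟨T', hT', hT'T⟩ := exists_between (show R₁ / β < T by rwa [div_lt_iff₀' hβ])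
  rw [div_lt_iff₀' hβ] at hT'
  set κ := (R₁ - β * t) / 2 with hκdef
  have hκ : 0 < κ := by rw [hκdef]; linarith
  set σ := u (t, x₀) - v (t, x₀) with hσdef
  have hσ : 0 < σ := by rw [hσdef]; linarith
  set θ : ℝ × Euc d → ℝ := fun z => smoothDist κ x₀ z.2 + β * z.1 - R₁ with hθdef
  have hθc : Continuous θ := by
    have := (contDiff_smoothDist hκ x₀).continuous
    fun_prop
  set m₀ := min (R - R₁) (β * T' - R₁) with hm₀
  have hm₀pos : 0 < m₀ := lt_min (by linarith) (by linarith)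
  have htT' : t < T' := lt_of_mul_lt_mul_left (hR₁.trans hT') hβ.le
  have hR0 : 0 ≤ R := by nlinarith
  set Q : Set (ℝ × Euc d) := Icc 0 T' ×ˢ Metric.closedBall x₀ R with hQdef
  have hQc : IsCompact Q := isCompact_Icc.prod (isCompact_closedBall x₀ R)
  have hQD : Q ⊆ Ico 0 T ×ˢ univ := by
    rintro z ⟨hz, -⟩
    exact ⟨⟨hz.1, hz.2.trans_lt hT'T⟩, trivial⟩
  have hmemQ : (t, x₀) ∈ Q := ⟨⟨ht0, htT'.le⟩, Metric.mem_closedBall_self hR0⟩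
  obtain ⟨Cu, hCu⟩ := (hu.mono hQD).bddAbove_of_isCompact hQc
  obtain ⟨Cv, hCv⟩ := (hv.mono hQD).bddBelow_of_isCompact hQc
  set C := Cu - Cv with hC
  have hCb : ∀ z ∈ Q, ∀ z' ∈ Q, u z - v z' ≤ C := fun z hz z' hz' => by
    have h1 := hCu (mem_image_of_mem u hz)
    have h2 := hCv (mem_image_of_mem v hz')
    rw [hC]; linarith
  -- The term γ t makes the inequality strict; it costs at most a quarter of the gap σ, and exp(-M
  -- κ) another quarter, so the doubled maximum is at least σ / 2.
  set γ := σ / (4 * (t + 1)) with hγdef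
  have hγ : 0 < γ := by positivity
  have hγt : γ * t ≤ σ / 4 := by
    rw [hγdef, div_mul_eq_mul_div, div_le_div_iff₀ (by positivity) (by norm_num)]
    nlinarith
  obtain ⟨M, hM, hM1, hM2⟩ : ∃ M : ℝ, 0 < M ∧ Real.exp (M * (-κ)) < σ / 4 ∧
      C < Real.exp (M * m₀) := by
    have e1 : Tendsto (fun M : ℝ => Real.exp (M * (-κ))) atTop (𝓝 0) :=
      Real.tendsto_exp_atBot.comp (tendsto_id.atTop_mul_const_of_neg (by linarith))
    have e2 : Tendsto (fun M : ℝ => Real.exp (M * m₀)) atTop atTop :=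
      Real.tendsto_exp_atTop.comp (tendsto_id.atTop_mul_const hm₀pos)
    obtain ⟨M, h1, h2, h3⟩ := ((eventually_gt_atTop (0 : ℝ)).and
      ((e1.eventually_lt_const (show (0 : ℝ) < σ / 4 by linarith)).and
        (e2.eventually_gt_atTop C))).exists
    exact ⟨M, h1, h2, h3⟩
  have hθt : θ (t, x₀) = -κ := by
    simp only [hθdef, smoothDist_self hκ]
    rw [hκdef]; ring
  let pen : ℝ × Euc d → ℝ := fun z => Real.exp (M * θ z) + γ * z.1
  have hpenc : Continuous pen := by fun_prop
  let dbl : ℕ → (ℝ × Euc d) × (ℝ × Euc d) → ℝ := fun n w =>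
    (n : ℝ) / 2 * (‖w.1.2 - w.2.2‖ ^ 2 + (w.1.1 - w.2.1) ^ 2)
  have hdblc : ∀ n, Continuous (dbl n) := fun n => by fun_prop
  have hdbl0 : ∀ n w, 0 ≤ dbl n w := fun n w => by positivity
  have husc : UpperSemicontinuousOn (fun w : (ℝ × Euc d) × (ℝ × Euc d) => u w.1 - v w.2)
      (Q ×ˢ Q) := by
    have h1 : UpperSemicontinuousOn (fun w : (ℝ × Euc d) × (ℝ × Euc d) => u w.1) (Q ×ˢ Q) :=
      (hu.mono hQD).comp continuousOn_fst fun w hw => hw.1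
    have h2 : UpperSemicontinuousOn (fun w : (ℝ × Euc d) × (ℝ × Euc d) => -v w.2) (Q ×ˢ Q) := by
      have h3 : LowerSemicontinuousOn (fun w : (ℝ × Euc d) × (ℝ × Euc d) => v w.2) (Q ×ˢ Q) :=
        (hv.mono hQD).comp continuousOn_snd fun w hw => hw.2
      intro w hw c hc
      filter_upwards [h3 w hw (-c) (by change -c < v w.2; change -v w.2 < c at hc; linarith)]
        with y hy
      change -v y.2 < c
      change -c < v y.2 at hy
      linarith
    simpa only [sub_eq_add_neg] using h1.add h2
  have hmax : ∀ n : ℕ, ∃ w ∈ Q ×ˢ Q,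
      IsMaxOn (fun w => u w.1 - v w.2 + -(dbl n w + pen w.1)) (Q ×ˢ Q) w := fun n =>
    UpperSemicontinuousOn.exists_isMaxOn ⟨((t, x₀), (t, x₀)), hmemQ, hmemQ⟩ (hQc.prod hQc)
      (husc.add (ContinuousOn.upperSemicontinuousOn (by fun_prop)))
  choose w hwQ hwmax using hmax
  have hval : ∀ n, σ / 2 ≤ u (w n).1 - v (w n).2 + -(dbl n (w n) + pen (w n).1) := by
    intro n
    have := hwmax n (a := ((t, x₀), (t, x₀))) ⟨hmemQ, hmemQ⟩
    refine le_trans ?_ this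
    simp only [dbl, pen, sub_self, hθt]
    have e : (n : ℝ) / 2 * (‖(0 : Euc d)‖ ^ 2 + 0 ^ 2) = 0 := by simp
    rw [e]
    linarith
  have hpen0 : ∀ n, 0 ≤ γ * (w n).1.1 := fun n => mul_nonneg hγ.le (hwQ n).1.1.1
  have F1 : ∀ n, σ / 2 ≤ u (w n).1 - v (w n).2 := fun n => by
    have h1 := hval n
    have h2 := hdbl0 n (w n)
    have h3 := Real.exp_pos (M * θ (w n).1)
    have h4 := hpen0 n
    simp only [pen] at h1
    linarith
  have F2 : ∀ n, dbl n (w n) ≤ C := fun n => by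
    have h1 := hval n
    have h2 := hCb _ (hwQ n).1 _ (hwQ n).2
    have h3 := Real.exp_pos (M * θ (w n).1)
    have h4 := hpen0 n
    simp only [pen] at h1
    linarith
  have F3 : ∀ n, Real.exp (M * θ (w n).1) ≤ C := fun n => by
    have h1 := hval n
    have h2 := hCb _ (hwQ n).1 _ (hwQ n).2
    have h3 := hdbl0 n (w n)
    have h4 := hpen0 n
    simp only [pen] at h1
    linarith
  obtain ⟨ŵ, hŵQ, ns, hns, hlim⟩ := (hQc.prod hQc).tendsto_subseq hwQ
  have hC0 : 0 ≤ C := (hdbl0 0 (w 0)).trans (F2 0)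
  have hdist : Tendsto (fun k => ‖(w (ns k)).1.2 - (w (ns k)).2.2‖ ^ 2 +
      ((w (ns k)).1.1 - (w (ns k)).2.1) ^ 2) atTop (𝓝 0) := by
    have hb : Tendsto (fun k => 2 * C / (ns k : ℝ)) atTop (𝓝 0) :=
      (tendsto_const_nhds.div_atTop tendsto_natCast_atTop_atTop).comp hns.tendsto_atTop
    refine squeeze_zero' (Eventually.of_forall fun k => by positivity) ?_ hb
    filter_upwards [hns.tendsto_atTop.eventually_gt_atTop 0] with k hk
    have hk' : (0 : ℝ) < ns k := by exact_mod_cast hk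
    have := F2 (ns k)
    simp only [dbl] at this
    rw [le_div_iff₀ hk']
    linarith
  have hŵ0 : ‖ŵ.1.2 - ŵ.2.2‖ ^ 2 + (ŵ.1.1 - ŵ.2.1) ^ 2 = 0 := by
    refine tendsto_nhds_unique ?_ hdist
    have hcont : Continuous fun w : (ℝ × Euc d) × (ℝ × Euc d) =>
      ‖w.1.2 - w.2.2‖ ^ 2 + (w.1.1 - w.2.1) ^ 2 := by fun_prop
    exact (hcont.tendsto ŵ).comp hlim
  have hŵeq : ŵ.1 = ŵ.2 := by
    obtain ⟨h1, h2⟩ := (add_eq_zero_iff_of_nonneg (by positivity) (by positivity)).1 hŵ0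
    refine Prod.ext ?_ ?_
    · exact sub_eq_zero.1 ((pow_eq_zero_iff two_ne_zero).1 h2)
    · exact sub_eq_zero.1 (norm_eq_zero.1 ((pow_eq_zero_iff two_ne_zero).1 h1))
  -- The maximizers accumulate at a diagonal point where, by semicontinuity, the gap survives. This
  -- excludes the initial time, and the size of the penalty excludes the rest of the boundary of
  -- `Q`.
  have hpos : σ / 2 ≤ u ŵ.1 - v ŵ.2 := by
    by_contra! hcon
    have h1 := husc ŵ hŵQ _ hcon
    have h2 : Tendsto (w ∘ ns) atTop (𝓝[Q ×ˢ Q] ŵ) :=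
      tendsto_nhdsWithin_iff.2 ⟨hlim, Eventually.of_forall fun k => hwQ _⟩
    obtain ⟨k, hk⟩ := (h2.eventually h1).exists
    exact absurd (F1 (ns k)) (not_le.2 hk)
  have hθŵ : θ ŵ.1 < m₀ := by
    have h1 : Real.exp (M * θ ŵ.1) ≤ C := by
      have hcont : Continuous fun w : (ℝ × Euc d) × (ℝ × Euc d) => Real.exp (M * θ w.1) := by
        fun_prop
      exact le_of_tendsto' ((hcont.tendsto ŵ).comp hlim) fun k => F3 _
    have h2 := Real.exp_lt_exp.1 (h1.trans_lt hM2)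
    exact lt_of_mul_lt_mul_left h2 hM.le
  have hd0 := norm_sub_le_smoothDist κ x₀ ŵ.1.2
  have hŵpos : 0 < ŵ.1.1 := by
    rcases hŵQ.1.1.1.lt_or_eq with h | h
    · exact h
    · exfalso
      have h1 : ŵ.1 = (0, ŵ.1.2) := Prod.ext h.symm rfl
      have h2 := h0 ŵ.1.2 (by simpa [dist_eq_norm] using hŵQ.1.2)
      rw [← hŵeq, h1] at hpos
      linarith
  have hŵT : ŵ.1.1 < T' := by
    have h1 : θ ŵ.1 < β * T' - R₁ := hθŵ.trans_le (min_le_right _ _)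
    simp only [hθdef] at h1
    have h2 := norm_nonneg (ŵ.1.2 - x₀)
    exact lt_of_mul_lt_mul_left (by linarith) hβ.le
  have hŵR : ‖ŵ.1.2 - x₀‖ < R := by
    have h1 : θ ŵ.1 < R - R₁ := hθŵ.trans_le (min_le_left _ _)
    simp only [hθdef] at h1
    have := mul_pos hβ hŵpos
    linarith
  set U : Set (ℝ × Euc d) := Ioo 0 T' ×ˢ Metric.ball x₀ R with hU
  have hUo : IsOpen U := isOpen_Ioo.prod Metric.isOpen_ball
  have hUQ : U ⊆ Q := prod_mono Ioo_subset_Icc_self Metric.ball_subset_closedBall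
  have hŵU : ŵ.1 ∈ U := ⟨⟨hŵpos, hŵT⟩, by simpa [dist_eq_norm] using hŵR⟩
  have ev1 : ∀ᶠ k in atTop, (w (ns k)).1 ∈ U :=
    ((continuous_fst.tendsto ŵ).comp hlim).eventually (hUo.mem_nhds hŵU)
  have ev2 : ∀ᶠ k in atTop, (w (ns k)).2 ∈ U :=
    ((continuous_snd.tendsto ŵ).comp hlim).eventually (hUo.mem_nhds (hŵeq ▸ hŵU))
  have ev3 : ∀ᶠ k in atTop, K * ‖(w (ns k)).1.2 - (w (ns k)).2.2‖ < γ := by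
    have hcont : Continuous fun w : (ℝ × Euc d) × (ℝ × Euc d) => K * ‖w.1.2 - w.2.2‖ := by
      fun_prop
    have h1 := (hcont.tendsto ŵ).comp hlim
    rw [hŵeq, sub_self, norm_zero, mul_zero] at h1
    exact h1.eventually_lt_const hγ
  obtain ⟨k, hk1, hk2, hk3⟩ := (ev1.and (ev2.and ev3)).exists
  obtain ⟨n, hn⟩ : ∃ n, n = ns k := ⟨_, rfl⟩
  rw [← hn] at hk1 hk2 hk3
  obtain ⟨⟨⟨t₁, x₁⟩, ⟨s₁, y₁⟩⟩, hw⟩ : ∃ ww, ww = w n := ⟨_, rfl⟩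
  have hmaxn := hwmax n
  rw [← hw] at hk1 hk2 hk3 hmaxn
  simp only at hk1 hk2 hk3
  set E := Real.exp (M * θ (t₁, x₁)) with hE
  set q := (smoothDist κ x₀ x₁)⁻¹ • (x₁ - x₀) with hq
  have i1 := hsub.test (T := T) (φ := fun z => dbl n (z, (s₁, y₁)) + pen z) (t := t₁) (x := x₁)
    (a := (n : ℝ) * (t₁ - s₁) + (E * (M * β) + γ)) (p := (n : ℝ) • (x₁ - y₁) + (E * M) • q)
    ⟨hk1.1.1, hk1.1.2.trans hT'T⟩ ?_ ?_ ?_ ?_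
  rotate_left
  · have c1 : ContDiff ℝ 1 fun z : ℝ × Euc d => smoothDist κ x₀ z.2 :=
      (contDiff_smoothDist hκ x₀).comp contDiff_snd
    have c2 : ContDiff ℝ 1 fun z : ℝ × Euc d => ‖z.2 - y₁‖ ^ 2 :=
      (contDiff_snd.sub contDiff_const).norm_sq ℝ
    simp only [dbl, pen, hθdef]
    exact ContDiff.contDiffAt (by fun_prop)
  · filter_upwards [hUo.mem_nhds hk1] with z hz
    have := hmaxn (a := (z, (s₁, y₁))) ⟨hUQ hz, hUQ hk2⟩
    simp only [mem_ofPred_eq] at this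
    linarith
  · simp only [dbl, pen, hθdef]
    have d1 : HasDerivAt (fun s : ℝ => (s - s₁) ^ 2) (2 * (t₁ - s₁)) t₁ := by
      exact (((hasDerivAt_id t₁).sub_const s₁).pow 2).congr_deriv (by simp)
    have d2 : HasDerivAt (fun s : ℝ => M * (smoothDist κ x₀ x₁ + β * s - R₁)) (M * β) t₁ := by
      simpa using ((((hasDerivAt_id t₁).const_mul β).const_add
        (smoothDist κ x₀ x₁)).sub_const R₁).const_mul M
    have d3 := ((d1.const_add (‖x₁ - y₁‖ ^ 2)).const_mul ((n : ℝ) / 2)).add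
      (d2.exp.add ((hasDerivAt_id t₁).const_mul γ))
    refine d3.congr_deriv ?_
    simp only [hE, hθdef]
    ring
  · simp only [dbl, pen, hθdef]
    have d1 := ((hasGradientAt_norm_sub_sq y₁ x₁).add'
      (hasGradientAt_const' ((t₁ - s₁) ^ 2) x₁)).const_mul' ((n : ℝ) / 2)
    have d2 := ((((hasGradientAt_smoothDist hκ x₀ x₁).add'
      (hasGradientAt_const' (β * t₁) x₁)).sub' (hasGradientAt_const' R₁ x₁))).const_mul' M
    have d3 := d1.add' (((HasGradientAt.comp_hasDerivAt (Real.hasDerivAt_exp _) d2)).add'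
      (hasGradientAt_const' (γ * t₁) x₁))
    convert d3 using 1
    have e : (n : ℝ) / 2 * 2 = n := by ring
    rw [add_zero, add_zero, add_zero, sub_zero, smul_smul ((n : ℝ) / 2), e]
    simp only [smul_smul, hE, hθdef, hq, mul_assoc]
  have i2 := hsup.test (T := T) (φ := fun z => -dbl n ((t₁, x₁), z)) (t := s₁) (x := y₁)
    (a := (n : ℝ) * (t₁ - s₁)) (p := (n : ℝ) • (x₁ - y₁))
    ⟨hk2.1.1, hk2.1.2.trans hT'T⟩ ?_ ?_ ?_ ?_
  rotate_left
  · have c2 : ContDiff ℝ 1 fun z : ℝ × Euc d => ‖x₁ - z.2‖ ^ 2 :=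
      (contDiff_const.sub contDiff_snd).norm_sq ℝ
    simp only [dbl]
    exact ContDiff.contDiffAt (by fun_prop)
  · filter_upwards [hUo.mem_nhds hk2] with z hz
    have := hmaxn (a := ((t₁, x₁), z)) ⟨hUQ hk1, hUQ hz⟩
    simp only [mem_ofPred_eq] at this
    linarith
  · simp only [dbl]
    have d1 : HasDerivAt (fun s : ℝ => (t₁ - s) ^ 2) (-(2 * (t₁ - s₁))) s₁ := by
      exact (((hasDerivAt_id s₁).const_sub t₁).pow 2).congr_deriv (by simp)
    refine ((d1.const_add (‖x₁ - y₁‖ ^ 2)).const_mul ((n : ℝ) / 2)).neg.congr_deriv ?_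
    ring
  · simp only [dbl]
    have d1 := (((hasGradientAt_norm_sub_sq x₁ y₁).add'
      (hasGradientAt_const' ((t₁ - s₁) ^ 2) y₁)).const_mul' ((n : ℝ) / 2)).neg'
    simp only [norm_sub_rev x₁]
    convert d1 using 1
    rw [add_zero, smul_smul, ← smul_neg, neg_sub]
    congr 1
    ring
  have hqn : ‖q‖ ≤ 1 := norm_gradient_smoothDist_le hκ x₀ x₁
  have hEp : 0 < E := Real.exp_pos _
  have j1 := hp x₁ ((n : ℝ) • (x₁ - y₁) + (E * M) • q) ((n : ℝ) • (x₁ - y₁))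
  have j2 := hx x₁ y₁ ((n : ℝ) • (x₁ - y₁))
  rw [add_sub_cancel_left, norm_smul, Real.norm_eq_abs, abs_of_pos (show 0 < E * M by positivity)] at j1
  have j3 : β * (E * M * ‖q‖) ≤ β * (E * M * 1) := by gcongr
  have j1' := (abs_le.1 j1).1
  have j2' := (abs_le.1 j2).1
  -- Subtracting the two viscosity inequalities gives E M β + γ ≤ β E M ‖q‖ + K |x₁ - y₁|, whose
  -- right side is smaller than β E M + γ.
  nlinarith

/-! ### Half-relaxed limits -/

/-- Consistency from above of a family of functions with `∂ₜ u + H(x, Du) = 0`: an affine upper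
bound at time `t - h` in a ball of radius `R h` propagates to time `t`. -/
def UpperConsistent {d : ℕ} {ι : Type*} (T : ℝ) (H : Euc d → Euc d → ℝ) (R : ℝ) (l : Filter ι)
    (u : ι → ℝ × Euc d → ℝ) : Prop :=
  ∀ t ∈ Ioo 0 T, ∀ x p : Euc d, ∀ η > 0, ∀ᶠ h in 𝓝[>] (0 : ℝ), ∀ᶠ q in l ×ˢ 𝓝 (t, x),
    ∀ a : ℝ, (∀ y, ‖y - q.2.2‖ ≤ R * h → u q.1 (q.2.1 - h, y) ≤ a + inner ℝ p (y - q.2.2)) →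
      u q.1 q.2 ≤ a - h * H x p + η * h

/-- Local boundedness of a family of functions on `[0,T) × ℝᵈ`, along a filter. -/
def LocallyBoundedAlong {d : ℕ} {ι : Type*} (T : ℝ) (l : Filter ι)
    (u : ι → ℝ × Euc d → ℝ) : Prop :=
  ∀ z ∈ Ico 0 T ×ˢ (univ : Set (Euc d)), ∃ C : ℝ,
    ∀ᶠ q in l ×ˢ 𝓝[Ico 0 T ×ˢ univ] z, |u q.1 q.2| ≤ C

/-- The upper half-relaxed limit. -/
noncomputable def upperLimit {d : ℕ} {ι : Type*} (T : ℝ) (l : Filter ι)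
    (u : ι → ℝ × Euc d → ℝ) (z : ℝ × Euc d) : ℝ :=
  limsup (fun q : ι × (ℝ × Euc d) => u q.1 q.2) (l ×ˢ 𝓝[Ico 0 T ×ˢ univ] z)

theorem nhdsWithin_cylinder_neBot {d : ℕ} {T : ℝ} {z : ℝ × Euc d}
    (hz : z ∈ Ico 0 T ×ˢ (univ : Set (Euc d))) : (𝓝[Ico 0 T ×ˢ univ] z).NeBot :=
  mem_closure_iff_nhdsWithin_neBot.1 (subset_closure hz)

section

variable {d : ℕ} {ι : Type*} {T : ℝ} {l : Filter ι} {u : ι → ℝ × Euc d → ℝ}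

theorem eventually_lt_of_upperLimit_lt (hb : LocallyBoundedAlong T l u) {z : ℝ × Euc d}
    (hz : z ∈ Ico 0 T ×ˢ (univ : Set (Euc d))) {c : ℝ} (h : upperLimit T l u z < c) :
    ∀ᶠ q in l ×ˢ 𝓝[Ico 0 T ×ˢ univ] z, u q.1 q.2 < c := by
  obtain ⟨C, hC⟩ := hb z hz
  exact eventually_lt_of_limsup_lt h ⟨C, hC.mono fun q hq => (abs_le.1 hq).2⟩

theorem upperLimit_le [l.NeBot] (hb : LocallyBoundedAlong T l u) {z : ℝ × Euc d}
    (hz : z ∈ Ico 0 T ×ˢ (univ : Set (Euc d))) {c : ℝ}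
    (h : ∀ᶠ q in l ×ˢ 𝓝[Ico 0 T ×ˢ univ] z, u q.1 q.2 ≤ c) : upperLimit T l u z ≤ c := by
  have := nhdsWithin_cylinder_neBot hz
  obtain ⟨C, hC⟩ := hb z hz
  refine limsup_le_of_le (IsBoundedUnder.isCoboundedUnder_le ⟨-C, ?_⟩) h
  exact hC.mono fun q hq => (abs_le.1 hq).1

theorem upperLimit_upperSemicontinuousOn [l.NeBot] (hb : LocallyBoundedAlong T l u) :
    UpperSemicontinuousOn (upperLimit T l u) (Ico 0 T ×ˢ univ) := by
  intro z hz c hc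
  obtain ⟨c', hc1, hc2⟩ := exists_between (show upperLimit T l u z < c from hc)
  have h := eventually_lt_of_upperLimit_lt hb hz hc1
  obtain ⟨pa, ha, pb, hpb, hab⟩ := eventually_prod_iff.1 h
  have h2 := eventually_eventually_nhdsWithin.2 hpb
  filter_upwards [h2, self_mem_nhdsWithin] with w hw hwD
  refine (upperLimit_le hb hwD ?_).trans_lt hc2
  exact eventually_prod_iff.2 ⟨pa, ha, pb, hw, fun hx _ hy => (hab hx hy).le⟩

/-- Contact with φ bounds the limit at time t - h by an affine function, up to an error small
compared with h. The definition of the limit and compactness of a ball transfer this bound to the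
approximations, consistency carries it to time t, and the limit there yields U ≤ U - h (∂ₜφ + H) + 4
η h at the contact point; it remains to divide by h. -/
theorem UpperConsistent.isViscositySubsolution [l.NeBot] {H : Euc d → Euc d → ℝ} {R : ℝ}
    (hR : 0 < R) (hb : LocallyBoundedAlong T l u) (hc : UpperConsistent T H R l u) :
    IsViscositySubsolution T H (upperLimit T l u) := by
  have hIcoIoo : Ioo 0 T ×ˢ (univ : Set (Euc d)) ⊆ Ico 0 T ×ˢ univ :=
    prod_mono Ioo_subset_Ico_self le_rfl
  refine ⟨(upperLimit_upperSemicontinuousOn hb).mono hIcoIoo, fun φ hφ t ht x hmax => ?_⟩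
  have hd : DifferentiableAt ℝ φ (t, x) :=
    (hφ.contDiffAt (mem_nhds_cylinder ht x)).differentiableAt (by simp)
  set b := deriv (fun s => φ (s, x)) t with hbdef
  set p := gradient (fun y => φ (t, y)) x with hpdef
  set U := upperLimit T l u with hU
  have hb' : fderiv ℝ φ (t, x) (1, 0) = b := by
    have h1 : HasDerivAt (fun s : ℝ => (s, x)) ((1 : ℝ), (0 : Euc d)) t :=
      (hasDerivAt_id t).prodMk (hasDerivAt_const t x)
    exact (hd.hasFDerivAt.comp_hasDerivAt t h1).deriv.symm
  have hp' : ∀ v : Euc d, fderiv ℝ φ (t, x) (0, v) = inner ℝ p v := by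
    intro v
    have h1 : HasFDerivAt (fun y : Euc d => (t, y)) (ContinuousLinearMap.inr ℝ ℝ (Euc d)) x :=
      hasFDerivAt_prodMk_right t x
    have h2 : HasFDerivAt (fun y : Euc d => φ (t, y))
        ((fderiv ℝ φ (t, x)).comp (ContinuousLinearMap.inr ℝ ℝ (Euc d))) x :=
      HasFDerivAt.comp (g := φ) x hd.hasFDerivAt h1
    have h3 := h2.hasGradientAt.gradient
    rw [← hpdef] at h3
    rw [h3, InnerProductSpace.toDual_symm_apply]
    simp
  have hfd : ∀ (s : ℝ) (v : Euc d), fderiv ℝ φ (t, x) (s, v) = s * b + inner ℝ p v := by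
    intro s v
    rw [← hp' v, ← hb', show ((s, v) : ℝ × Euc d) = s • ((1 : ℝ), (0 : Euc d)) + (0, v) by simp,
      map_add, map_smul, smul_eq_mul]
  refine le_of_forall_pos_le_add fun η₀ hη₀ => ?_
  set η := η₀ / 4 with hη
  have hηpos : 0 < η := by positivity
  -- first order expansion, with the contact condition
  set N := 1 + 2 * R with hN
  have hNpos : 0 < N := by positivity
  have hexp : ∀ᶠ z in 𝓝 (t, x), U z ≤ U (t, x) + (z.1 - t) * b + inner ℝ p (z.2 - x) +
      η / N * ‖z - (t, x)‖ := by
    have h1 := hd.hasFDerivAt.isLittleO.def (show 0 < η / N by positivity)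
    filter_upwards [h1, hmax] with z hz1 hz2
    have h2 := (abs_le.1 hz1).2
    rw [show z - (t, x) = (z.1 - t, z.2 - x) from rfl, hfd] at h2
    rw [show z - (t, x) = (z.1 - t, z.2 - x) from rfl]
    linarith
  obtain ⟨r, hr, hball⟩ := Metric.mem_nhds_iff.1 hexp
  have hcons := hc t ht x p η hηpos
  have hsmall : ∀ᶠ h in 𝓝[>] (0 : ℝ), h < t ∧ N * h < r := by
    have h1 : Tendsto (fun h : ℝ => N * h) (𝓝[>] 0) (𝓝 (N * 0)) :=
      ((continuous_const.mul continuous_id).tendsto 0).mono_left nhdsWithin_le_nhds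
    rw [mul_zero] at h1
    exact ((eventually_nhdsWithin_of_eventually_nhds (eventually_lt_nhds ht.1))).and
      (h1.eventually_lt_const hr)
  obtain ⟨h, ⟨hcons, hht, hhr⟩, hh0⟩ := ((hcons.and hsmall).and self_mem_nhdsWithin).exists
  have hh0 : 0 < h := hh0
  set c : Euc d → ℝ := fun y => U (t, x) - h * b + inner ℝ p (y - x) + 2 * η * h with hcdef
  -- The radius is doubled because consistency uses balls of radius R h whose centres range over the
  -- R h-neighbourhood of `x`.
  set Kc : Set (ℝ × Euc d) := {t - h} ×ˢ Metric.closedBall x (2 * R * h) with hKc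
  have hKcomp : IsCompact Kc := isCompact_singleton.prod (isCompact_closedBall _ _)
  have hbelow : ∀ z ∈ Kc, ∀ᶠ q in l ×ˢ 𝓝 z, u q.1 q.2 ≤ c q.2.2 := by
    rintro ⟨s, y⟩ ⟨hs, hy⟩
    obtain rfl : s = t - h := hs
    have hyx : ‖y - x‖ ≤ 2 * R * h := by simpa [dist_eq_norm] using hy
    have hIoo : t - h ∈ Ioo 0 T := ⟨by linarith, by linarith [ht.2]⟩
    have hnorm : ‖((t - h, y) : ℝ × Euc d) - (t, x)‖ ≤ N * h := by
      rw [show ((t - h, y) : ℝ × Euc d) - (t, x) = (t - h - t, y - x) from rfl, Prod.norm_def]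
      refine max_le ?_ ?_
      · rw [show t - h - t = -h by ring, norm_neg, Real.norm_eq_abs, abs_of_pos hh0, hN]
        nlinarith
      · rw [hN]; refine hyx.trans ?_; nlinarith
    have h1 := hball (show (t - h, y) ∈ Metric.ball (t, x) r by
      rw [Metric.mem_ball, dist_eq_norm]; exact hnorm.trans_lt hhr)
    simp only [mem_ofPred_eq] at h1
    have h2 : η / N * ‖((t - h, y) : ℝ × Euc d) - (t, x)‖ ≤ η * h := by
      calc _ ≤ η / N * (N * h) := by gcongr
        _ = η * h := by field_simp
    have h3 : U (t - h, y) < c y - η * h / 2 := by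
      have : 0 < η * h := by positivity
      simp only [hcdef]
      nlinarith
    have h4 := eventually_lt_of_upperLimit_lt hb
      (hIcoIoo (show (t - h, y) ∈ Ioo 0 T ×ˢ (univ : Set (Euc d)) from ⟨hIoo, trivial⟩)) h3
    have h5 : 𝓝[Ico 0 T ×ˢ univ] ((t - h, y) : ℝ × Euc d) = 𝓝 (t - h, y) :=
      nhdsWithin_eq_nhds.2 (mem_of_superset (mem_nhds_cylinder hIoo y) hIcoIoo)
    rw [h5] at h4
    have h6 : ∀ᶠ z in 𝓝 ((t - h, y) : ℝ × Euc d), c y - η * h / 2 < c z.2 := by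
      have hcc : Continuous fun z : ℝ × Euc d => c z.2 := by fun_prop
      exact (hcc.tendsto (t - h, y)).eventually_const_lt
        (by change c y - η * h / 2 < c y; linarith [mul_pos hηpos hh0])
    filter_upwards [h4, h6.prod_inr l] with q hq1 hq2
    exact (hq1.trans hq2).le
  have hunif : ∀ᶠ q in l ×ˢ 𝓝 t, ∀ y ∈ Metric.closedBall x (2 * R * h),
      u q.1 (q.2 - h, y) ≤ c y := by
    have h1 : ∀ᶠ q in l ×ˢ 𝓝 (t - h), ∀ y ∈ Metric.closedBall x (2 * R * h),
        u q.1 (q.2, y) ≤ c y := by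
      have h2 : ∀ y ∈ Metric.closedBall x (2 * R * h),
          ∀ᶠ q in 𝓝 y ×ˢ (l ×ˢ 𝓝 (t - h)), u q.2.1 (q.2.2, q.1) ≤ c q.1 := by
        intro y hy
        have h3 := hbelow (t - h, y) ⟨rfl, hy⟩
        rw [nhds_prod_eq] at h3
        have h4 : Tendsto (fun q : Euc d × (ι × ℝ) => (q.2.1, (q.2.2, q.1)))
            (𝓝 y ×ˢ (l ×ˢ 𝓝 (t - h))) (l ×ˢ (𝓝 (t - h) ×ˢ 𝓝 y)) :=
          (tendsto_fst.comp tendsto_snd).prodMk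
            ((tendsto_snd.comp tendsto_snd).prodMk tendsto_fst)
        exact h4.eventually h3
      have h3 := (isCompact_closedBall x (2 * R * h)).mem_prod_nhdsSet_of_forall
        (l := l ×ˢ 𝓝 (t - h)) (s := {q : (ι × ℝ) × Euc d | u q.1.1 (q.1.2, q.2) ≤ c q.2}) (fun y hy => by
          have h4 := h2 y hy
          have h5 : Tendsto (fun q : (ι × ℝ) × Euc d => (q.2, q.1))
            ((l ×ˢ 𝓝 (t - h)) ×ˢ 𝓝 y) (𝓝 y ×ˢ (l ×ˢ 𝓝 (t - h))) := tendsto_snd.prodMk tendsto_fst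
          exact h5.eventually h4)
      have h4 : ∀ᶠ q in (l ×ˢ 𝓝 (t - h)) ×ˢ 𝓝ˢ (Metric.closedBall x (2 * R * h)),
        u q.1.1 (q.1.2, q.2) ≤ c q.2 := h3
      obtain ⟨pa, ha, pb, hpb, hab⟩ := eventually_prod_iff.1 h4
      filter_upwards [ha] with q hq y hy
      exact hab hq (subset_of_mem_nhdsSet hpb hy)
    have h2 : Tendsto (fun q : ι × ℝ => (q.1, q.2 - h)) (l ×ˢ 𝓝 t) (l ×ˢ 𝓝 (t - h)) :=
      tendsto_fst.prodMk (((continuous_id.sub continuous_const).tendsto t).comp tendsto_snd)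
    exact h2.eventually h1
  have hfinal : ∀ᶠ q in l ×ˢ 𝓝 (t, x), u q.1 q.2 ≤ U (t, x) - h * b + 4 * η * h - h * H x p := by
    have h1 : Tendsto (fun q : ι × (ℝ × Euc d) => (q.1, q.2.1)) (l ×ˢ 𝓝 (t, x)) (l ×ˢ 𝓝 t) :=
      tendsto_fst.prodMk ((continuous_fst.tendsto (t, x)).comp tendsto_snd)
    have h2 : ∀ᶠ z in 𝓝 (t, x), z.2 ∈ Metric.ball x (R * h) :=
      (continuous_snd.tendsto (t, x)).eventually (Metric.ball_mem_nhds _ (by positivity))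
    have h3 : ∀ᶠ z in 𝓝 (t, x), inner ℝ p (z.2 - x) < η * h := by
      have hcc : Continuous fun z : ℝ × Euc d => inner ℝ p (z.2 - x) := by fun_prop
      refine (hcc.tendsto (t, x)).eventually_lt_const ?_
      simp only [sub_self, inner_zero_right]
      positivity
    filter_upwards [hcons, h1.eventually hunif, h2.prod_inr l, h3.prod_inr l]
      with q hq1 hq2 hq3 hq4
    have h4 := hq1 (U (t, x) - h * b + inner ℝ p (q.2.2 - x) + 2 * η * h) ?_
    · nlinarith
    · intro y hy
      have hy' : y ∈ Metric.closedBall x (2 * R * h) := by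
        rw [mem_closedBall_iff_norm]
        rw [mem_ball_iff_norm] at hq3
        calc ‖y - x‖ = ‖(y - q.2.2) + (q.2.2 - x)‖ := by congr 1; abel
          _ ≤ ‖y - q.2.2‖ + ‖q.2.2 - x‖ := norm_add_le _ _
          _ ≤ 2 * R * h := by linarith
      refine (hq2 y hy').trans (le_of_eq ?_)
      simp only [hcdef]
      rw [show y - x = (q.2.2 - x) + (y - q.2.2) by abel, inner_add_right]
      ring
  have hle : U (t, x) ≤ U (t, x) - h * b + 4 * η * h - h * H x p := by
    refine upperLimit_le hb (hIcoIoo ⟨ht, trivial⟩) ?_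
    exact hfinal.filter_mono (Filter.prod_mono le_rfl nhdsWithin_le_nhds)
  have : h * (b + H x p) ≤ h * (4 * η) := by nlinarith
  have := le_of_mul_le_mul_left this hh0
  rw [hη] at this
  linarith

theorem upperLimit_eq_of_tendsto [l.NeBot] {z : ℝ × Euc d}
    (hz : z ∈ Ico 0 T ×ˢ (univ : Set (Euc d))) {c : ℝ}
    (h : Tendsto (fun q : ι × (ℝ × Euc d) => u q.1 q.2) (l ×ˢ 𝓝[Ico 0 T ×ˢ univ] z) (𝓝 c)) :
    upperLimit T l u z = c := by
  have := nhdsWithin_cylinder_neBot hz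
  exact h.limsup_eq

theorem LocallyBoundedAlong.neg (hb : LocallyBoundedAlong T l u) :
    LocallyBoundedAlong T l fun i z => -u i z := by
  intro z hz
  obtain ⟨C, hC⟩ := hb z hz
  exact ⟨C, by simpa using hC⟩

theorem neg_upperLimit_neg_le [l.NeBot] (hb : LocallyBoundedAlong T l u) {z : ℝ × Euc d}
    (hz : z ∈ Ico 0 T ×ˢ (univ : Set (Euc d))) :
    -upperLimit T l (fun i z => -u i z) z ≤ upperLimit T l u z := by
  have := nhdsWithin_cylinder_neBot hz
  by_contra! hlt
  obtain ⟨c, hc1, hc2⟩ := exists_between hlt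
  have h1 := eventually_lt_of_upperLimit_lt hb hz hc1
  have h2 := eventually_lt_of_upperLimit_lt hb.neg hz (c := -c) (by linarith)
  obtain ⟨q, hq1, hq2⟩ := (h1.and h2).exists
  linarith

theorem IsViscositySupersolution.congr {H : Euc d → Euc d → ℝ} {v w : ℝ × Euc d → ℝ}
    (hv : IsViscositySupersolution T H v) (h : EqOn v w (Ioo 0 T ×ˢ univ)) :
    IsViscositySupersolution T H w := by
  refine ⟨fun z hz c hc => ?_, fun φ hφ t ht x hmin => hv.2 φ hφ t ht x ?_⟩
  · have hc' : c < w z := hc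
    filter_upwards [hv.1 z hz c (by rw [← h hz] at hc'; exact hc'), self_mem_nhdsWithin]
      with y hy hyD
    change c < w y
    rw [← h hyD]
    exact hy
  have h0 : v (t, x) = w (t, x) := h ⟨ht, trivial⟩
  filter_upwards [hmin, mem_nhds_cylinder ht x] with z hz hz'
  rw [h0, h hz']
  exact hz

theorem IsViscositySubsolution.congr {H : Euc d → Euc d → ℝ} {v w : ℝ × Euc d → ℝ}
    (hv : IsViscositySubsolution T H v) (h : EqOn v w (Ioo 0 T ×ˢ univ)) :
    IsViscositySubsolution T H w := by
  refine ⟨fun z hz c hc => ?_, fun φ hφ t ht x hmax => hv.2 φ hφ t ht x ?_⟩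
  · have hc' : w z < c := hc
    filter_upwards [hv.1 z hz c (by rw [← h hz] at hc'; exact hc'), self_mem_nhdsWithin]
      with y hy hyD
    change w y < c
    rw [← h hyD]
    exact hy
  have h0 : v (t, x) = w (t, x) := h ⟨ht, trivial⟩
  filter_upwards [hmax, mem_nhds_cylinder ht x] with z hz hz'
  rw [h0, h hz']
  exact hz

/-- A locally bounded, consistent family with the right initial behaviour converges locally
uniformly to a viscosity solution of the Cauchy problem. -/
theorem exists_isCauchySolution_tendstoUniformlyOn [l.NeBot] {H : Euc d → Euc d → ℝ} {β K R : ℝ}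
    (hβ : 0 < β) (hp : ∀ x, MomentumLipschitz β (H x))
    (hx : ∀ x y p, |H x p - H y p| ≤ K * ‖x - y‖) (hR : 0 < R) (hT : 0 < T)
    (hb : LocallyBoundedAlong T l u) (hup : UpperConsistent T H R l u)
    (hlow : UpperConsistent T (fun x p => -H x (-p)) R l fun i z => -u i z) {g : Euc d → ℝ}
    (hg : ∀ x, Tendsto (fun q : ι × (ℝ × Euc d) => u q.1 q.2)
      (l ×ˢ 𝓝[Ico 0 T ×ˢ univ] (0, x)) (𝓝 (g x))) :
    ∃ v, IsCauchySolution T H g v ∧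
      ∀ S : Set (ℝ × Euc d), IsCompact S → S ⊆ Ico 0 T ×ˢ univ → TendstoUniformlyOn u v l S := by
  have hIcoIoo : Ioo 0 T ×ˢ (univ : Set (Euc d)) ⊆ Ico 0 T ×ˢ univ :=
    prod_mono Ioo_subset_Ico_self le_rfl
  set U := upperLimit T l u with hU
  set V := upperLimit T l (fun i z => -u i z) with hV
  have hz0 : ∀ x : Euc d, ((0 : ℝ), x) ∈ Ico 0 T ×ˢ (univ : Set (Euc d)) :=
    fun x => ⟨⟨le_rfl, hT⟩, trivial⟩
  have hU0 : ∀ x, U (0, x) = g x := fun x => upperLimit_eq_of_tendsto (hz0 x) (hg x)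
  have hV0 : ∀ x, V (0, x) = -g x := fun x => upperLimit_eq_of_tendsto (hz0 x) (hg x).neg
  have hUsc := upperLimit_upperSemicontinuousOn hb
  have hVsc : LowerSemicontinuousOn (fun z => -V z) (Ico 0 T ×ˢ univ) := by
    intro z hz c hc
    filter_upwards [upperLimit_upperSemicontinuousOn hb.neg z hz (-c)
      (by change V z < -c; change c < -V z at hc; linarith)] with w hw
    change V w < -c at hw
    change c < -V w
    linarith
  have hsub : IsViscositySubsolution T H U := hup.isViscositySubsolution hR hb
  have hsup : IsViscositySupersolution T H fun z => -V z := by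
    apply IsViscositySubsolution.neg
    simpa using hlow.isViscositySubsolution hR hb.neg
  -- The upper limit is a subsolution, the lower one a supersolution, with the same initial values;
  -- comparison gives the inequality that is not automatic.
  have heq : EqOn (fun z => -V z) U (Ico 0 T ×ˢ univ) := by
    rintro ⟨t, x⟩ hz
    refine le_antisymm (neg_upperLimit_neg_le hb hz) ?_
    refine local_comparison (R := β * t + 1) hβ hp hx hUsc hVsc hsub hsup (fun y _ => ?_) hz.1
      (by linarith)
    change U (0, y) ≤ -V (0, y)
    rw [hU0, hV0, neg_neg]
  have hlim : ∀ z ∈ Ico 0 T ×ˢ (univ : Set (Euc d)),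
      Tendsto (fun q : ι × (ℝ × Euc d) => u q.1 q.2) (l ×ˢ 𝓝[Ico 0 T ×ˢ univ] z) (𝓝 (U z)) := by
    intro z hz
    refine tendsto_order.2 ⟨fun c hc => ?_, fun c hc => eventually_lt_of_upperLimit_lt hb hz hc⟩
    have h1 := heq hz
    simp only at h1
    filter_upwards [eventually_lt_of_upperLimit_lt hb.neg hz (c := -c) (by
      change V z < -c; linarith)] with q hq
    linarith
  have hcont : ContinuousOn U (Ico 0 T ×ˢ univ) := by
    intro z hz
    refine tendsto_order.2 ⟨fun c hc => ?_, fun c hc => hUsc z hz c hc⟩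
    have h1 : c < -V z := by rw [show -V z = U z from heq hz]; exact hc
    filter_upwards [hVsc z hz c h1, self_mem_nhdsWithin] with w hw hwD
    rw [← show -V w = U w from heq hwD]
    exact hw
  refine ⟨U, ⟨hcont, hU0, hsub, hsup.congr (heq.mono hIcoIoo)⟩, fun S hS hSD => ?_⟩
  rw [← tendstoLocallyUniformlyOn_iff_tendstoUniformlyOn_of_compact hS]
  refine TendstoLocallyUniformlyOn.mono ?_ hSD
  rw [tendstoLocallyUniformlyOn_iff_forall_tendsto]
  intro z hz
  have h1 : Tendsto (fun q : ι × (ℝ × Euc d) => U q.2) (l ×ˢ 𝓝[Ico 0 T ×ˢ univ] z) (𝓝 (U z)) :=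
    (hcont z hz).tendsto.comp tendsto_snd
  refine (h1.prodMk_nhds (hlim z hz)).mono_right ?_
  exact nhds_le_uniformity (U z)

theorem IsCauchySolution.eqOn {H : Euc d → Euc d → ℝ} {β K : ℝ}
    (hβ : 0 < β) (hp : ∀ x, MomentumLipschitz β (H x))
    (hx : ∀ x y p, |H x p - H y p| ≤ K * ‖x - y‖) {g : Euc d → ℝ} {v w : ℝ × Euc d → ℝ}
    (hv : IsCauchySolution T H g v) (hw : IsCauchySolution T H g w) :
    EqOn v w (Ico 0 T ×ˢ univ) := by
  rintro ⟨t, x⟩ hz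
  refine le_antisymm ?_ ?_
  · exact local_comparison (R := β * t + 1) hβ hp hx hv.continuousOn.upperSemicontinuousOn
      hw.continuousOn.lowerSemicontinuousOn hv.subsolution hw.supersolution
      (fun y _ => by rw [hv.initial, hw.initial]) hz.1 (by linarith)
  · exact local_comparison (R := β * t + 1) hβ hp hx hw.continuousOn.upperSemicontinuousOn
      hv.continuousOn.lowerSemicontinuousOn hw.subsolution hv.supersolution
      (fun y _ => by rw [hv.initial, hw.initial]) hz.1 (by linarith)

theorem IsCauchySolution.congr {H : Euc d → Euc d → ℝ} {g : Euc d → ℝ} (hT : 0 < T)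
    {v w : ℝ × Euc d → ℝ} (hv : IsCauchySolution T H g v) (h : EqOn v w (Ico 0 T ×ˢ univ)) :
    IsCauchySolution T H g w where
  continuousOn := hv.continuousOn.congr h.symm
  initial x := by rw [← h ⟨⟨le_rfl, hT⟩, trivial⟩, hv.initial]
  subsolution := hv.subsolution.congr (h.mono (prod_mono Ioo_subset_Ico_self le_rfl))
  supersolution := hv.supersolution.congr (h.mono (prod_mono Ioo_subset_Ico_self le_rfl))

end

/-! ### Time discretization of a differential game -/

/-- The data of a game in operator form: a functional `M` on bounded functions of the controls
which is monotone, commutes with constants and is positively homogeneous, a bounded dynamics `f`,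
and a bounded running cost `ℓ`, Lipschitz in space. -/
structure IsGame {d : ℕ} {I : Type*} (M : (I → ℝ) → ℝ) (f : I → Euc d) (ℓ : Euc d → I → ℝ)
    (F C L : ℝ) : Prop where
  mono : ∀ (φ ψ : I → ℝ) (c : ℝ), (∃ D, ∀ i, |φ i| ≤ D) → (∃ D, ∀ i, |ψ i| ≤ D) →
    (∀ i, φ i ≤ ψ i + c) → M φ ≤ M ψ + c
  smul : ∀ (φ : I → ℝ) (c : ℝ), 0 ≤ c → (∃ D, ∀ i, |φ i| ≤ D) →
    M (fun i => c * φ i) = c * M φ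
  F_pos : 0 < F
  C_nonneg : 0 ≤ C
  L_nonneg : 0 ≤ L
  speed : ∀ i, ‖f i‖ ≤ F
  bdd : ∀ x i, |ℓ x i| ≤ C
  lip : ∀ x y i, |ℓ x i - ℓ y i| ≤ L * ‖x - y‖

/-- One step of size `h` of the discrete game with terminal payoff `u`. -/
def gameStep {d : ℕ} {I : Type*} (M : (I → ℝ) → ℝ) (f : I → Euc d) (ℓ : Euc d → I → ℝ) (h : ℝ)
    (u : Euc d → ℝ) (x : Euc d) : ℝ :=
  M fun i => u (x + h • f i) + h * ℓ x i

/-- The Hamiltonian of the game. -/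
noncomputable def gameHam {d : ℕ} {I : Type*} (M : (I → ℝ) → ℝ) (f : I → Euc d) (ℓ : Euc d → I → ℝ)
    (x p : Euc d) : ℝ :=
  -M fun i => ℓ x i + inner ℝ (f i) p

/-- At most linear growth. -/
def LinBdd {d : ℕ} (u : Euc d → ℝ) : Prop := ∃ D, ∀ x, |u x| ≤ D * (1 + ‖x‖)

theorem LinBdd.neg {d : ℕ} {u : Euc d → ℝ} (hu : LinBdd u) : LinBdd fun x => -u x := by
  simpa [LinBdd] using hu

theorem linBdd_zero {d : ℕ} : LinBdd fun _ : Euc d => (0 : ℝ) := ⟨0, by simp⟩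

/-- The segment from `y` to `x` is cut into pieces shorter than the δ belonging to η. A uniformly
continuous datum thus behaves like a Lipschitz one up to η, and a single explicit barrier controls
the solution near the initial time. -/
theorem UniformContinuous.exists_affine_modulus {d : ℕ} {g : Euc d → ℝ} (hg : UniformContinuous g)
    {η : ℝ} (hη : 0 < η) : ∃ D, 0 ≤ D ∧ ∀ x y, |g x - g y| ≤ η + D * ‖x - y‖ := by
  obtain ⟨δ, hδ, h⟩ := Metric.uniformContinuous_iff.1 hg η hη
  have key : ∀ (n : ℕ) (x y : Euc d), ‖x - y‖ < n * δ → |g x - g y| ≤ n * η := by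
    intro n
    induction n with
    | zero =>
      intro x y hx
      simp only [Nat.cast_zero, zero_mul] at hx
      linarith [norm_nonneg (x - y)]
    | succ n ih =>
      intro x y hx
      push_cast at hx ⊢
      have hn : (0 : ℝ) < n + 1 := by positivity
      set z := y + ((n : ℝ) / (n + 1)) • (x - y) with hz
      have h1 : x - z = (1 / ((n : ℝ) + 1)) • (x - y) := by
        have : (1 / ((n : ℝ) + 1)) = 1 - (n : ℝ) / (n + 1) := by field_simp; ring
        rw [this, sub_smul, one_smul, hz]
        abel
      have h2 : |g x - g z| ≤ η := by
        refine (h ?_).le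
        rw [dist_eq_norm, h1, norm_smul, Real.norm_eq_abs, abs_of_pos (by positivity),
          div_mul_eq_mul_div, div_lt_iff₀ hn]
        linarith
      have h3 : |g z - g y| ≤ n * η := by
        rcases Nat.eq_zero_or_pos n with h0 | h0
        · subst h0
          simp [hz]
        · have h0' : (0 : ℝ) < n := by exact_mod_cast h0
          refine ih z y ?_
          rw [hz, add_sub_cancel_left, norm_smul, Real.norm_eq_abs, abs_of_pos (by positivity),
            div_mul_eq_mul_div, div_lt_iff₀ hn]
          nlinarith
      linarith [abs_sub_le (g x) (g z) (g y)]
  refine ⟨η / δ, by positivity, fun x y => ?_⟩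
  have hn := Nat.lt_floor_add_one (‖x - y‖ / δ)
  have h1 := key (⌊‖x - y‖ / δ⌋₊ + 1) x y (by push_cast; rwa [div_lt_iff₀ hδ] at hn)
  have h2 : (⌊‖x - y‖ / δ⌋₊ : ℝ) ≤ ‖x - y‖ / δ := Nat.floor_le (by positivity)
  push_cast at h1
  have h3 : η / δ * ‖x - y‖ = ‖x - y‖ / δ * η := by ring
  rw [h3]
  nlinarith

theorem UniformContinuous.linBdd {d : ℕ} {g : Euc d → ℝ} (hg : UniformContinuous g) :
    LinBdd g := by
  obtain ⟨D, hD, h⟩ := hg.exists_affine_modulus one_pos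
  refine ⟨|g 0| + 1 + D, fun x => ?_⟩
  have h1 := h x 0
  have h3 : |g x| ≤ |g x - g 0| + |g 0| := by simpa using abs_add_le (g x - g 0) (g 0)
  rw [sub_zero] at h1
  have h4 : 0 ≤ |g 0| * ‖x‖ := by positivity
  nlinarith [norm_nonneg x]

section

variable {d : ℕ} {I : Type*} {M : (I → ℝ) → ℝ} {f : I → Euc d} {ℓ : Euc d → I → ℝ} {F C L : ℝ}

theorem IsGame.functional_zero (G : IsGame M f ℓ F C L) : M (fun _ => 0) = 0 := by
  simpa using G.smul (fun _ => 0) 0 le_rfl ⟨0, by simp⟩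

theorem IsGame.functional_le (G : IsGame M f ℓ F C L) {φ : I → ℝ} {c : ℝ}
    (hφ : ∃ D, ∀ i, |φ i| ≤ D) (h : ∀ i, φ i ≤ c) : M φ ≤ c := by
  simpa [G.functional_zero] using G.mono φ (fun _ => 0) c hφ ⟨0, by simp⟩ (by simpa using h)

theorem IsGame.le_functional (G : IsGame M f ℓ F C L) {φ : I → ℝ} {c : ℝ}
    (hφ : ∃ D, ∀ i, |φ i| ≤ D) (h : ∀ i, c ≤ φ i) : c ≤ M φ := by
  have := G.mono (fun _ => 0) φ (-c) ⟨0, by simp⟩ hφ (fun i => by linarith [h i])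
  rw [G.functional_zero] at this
  linarith

/-- The axioms on the functional do not distinguish the players. Exchanging them through φ ↦ -M(-φ)
is the discrete form of the symmetry u ↦ -u. -/
theorem IsGame.dual (G : IsGame M f ℓ F C L) :
    IsGame (fun φ => -M fun i => -φ i) f (fun x i => -ℓ x i) F C L where
  mono φ ψ c hφ hψ h := by
    have := G.mono (fun i => -ψ i) (fun i => -φ i) c (by simpa using hψ) (by simpa using hφ)
      (fun i => by linarith [h i])
    linarith
  smul φ c hc hφ := by
    have := G.smul (fun i => -φ i) c hc (by simpa using hφ)
    simp only [mul_neg] at this ⊢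
    rw [this]
  F_pos := G.F_pos
  C_nonneg := G.C_nonneg
  L_nonneg := G.L_nonneg
  speed := G.speed
  bdd x i := by simpa using G.bdd x i
  lip x y i := by
    rw [show -ℓ x i - -ℓ y i = -(ℓ x i - ℓ y i) by ring, abs_neg]
    exact G.lip x y i

theorem gameHam_dual (x p : Euc d) :
    gameHam (fun φ => -M fun i => -φ i) f (fun x i => -ℓ x i) x p = -gameHam M f ℓ x (-p) := by
  simp only [gameHam, neg_add, neg_neg, inner_neg_right]

theorem gameStep_dual (h : ℝ) (u : Euc d → ℝ) :
    gameStep (fun φ => -M fun i => -φ i) f (fun x i => -ℓ x i) h (fun x => -u x) =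
      fun x => -gameStep M f ℓ h u x := by
  ext x
  simp only [gameStep, neg_add, neg_neg, mul_neg]

theorem gameStep_iterate_dual (h : ℝ) (u : Euc d → ℝ) (k : ℕ) :
    (gameStep (fun φ => -M fun i => -φ i) f (fun x i => -ℓ x i) h)^[k] (fun x => -u x) =
      fun x => -(gameStep M f ℓ h)^[k] u x := by
  induction k with
  | zero => rfl
  | succ k ih => rw [Function.iterate_succ_apply', Function.iterate_succ_apply', ih, gameStep_dual]

theorem IsGame.bdd_payoff (G : IsGame M f ℓ F C L) {u : Euc d → ℝ} (hu : LinBdd u) (h : ℝ)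
    (x : Euc d) : ∃ D, ∀ i, |u (x + h • f i) + h * ℓ x i| ≤ D := by
  obtain ⟨D, hD⟩ := hu
  refine ⟨|D| * (1 + (‖x‖ + |h| * F)) + |h| * C, fun i => ?_⟩
  have h1 : ‖x + h • f i‖ ≤ ‖x‖ + |h| * F := by
    refine (norm_add_le _ _).trans ?_
    rw [norm_smul, Real.norm_eq_abs]
    have := G.speed i
    gcongr
  calc |u (x + h • f i) + h * ℓ x i| ≤ |u (x + h • f i)| + |h * ℓ x i| := abs_add_le _ _
    _ ≤ |D| * (1 + (‖x‖ + |h| * F)) + |h| * C := by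
      rw [abs_mul]
      have := G.bdd x i
      gcongr
      refine (hD _).trans ?_
      have h2 := le_abs_self D
      gcongr

theorem IsGame.bdd_momentum (G : IsGame M f ℓ F C L) (x p : Euc d) :
    ∃ D, ∀ i, |ℓ x i + inner ℝ (f i) p| ≤ D := by
  refine ⟨C + F * ‖p‖, fun i => (abs_add_le _ _).trans ?_⟩
  have h1 := abs_real_inner_le_norm (f i) p
  have h2 := G.speed i
  have h3 := G.bdd x i
  have : ‖f i‖ * ‖p‖ ≤ F * ‖p‖ := by gcongr
  linarith

theorem IsGame.linBdd_step (G : IsGame M f ℓ F C L) {u : Euc d → ℝ} (hu : LinBdd u) (h : ℝ) :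
    LinBdd (gameStep M f ℓ h u) := by
  have hb := G.bdd_payoff hu h
  obtain ⟨D, hD⟩ := hu
  have h0 := G.F_pos
  have h0' := G.C_nonneg
  have key : ∀ x i, |u (x + h • f i) + h * ℓ x i| ≤
      (|D| * (1 + |h| * F) + |h| * C) * (1 + ‖x‖) := by
    intro x i
    have h1 : ‖x + h • f i‖ ≤ ‖x‖ + |h| * F := by
      refine (norm_add_le _ _).trans ?_
      rw [norm_smul, Real.norm_eq_abs]
      have := G.speed i
      gcongr
    calc |u (x + h • f i) + h * ℓ x i| ≤ |u (x + h • f i)| + |h * ℓ x i| := abs_add_le _ _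
      _ ≤ |D| * (1 + (‖x‖ + |h| * F)) + |h| * C := by
        rw [abs_mul]
        have := G.bdd x i
        gcongr
        refine (hD _).trans ?_
        have h2 := le_abs_self D
        gcongr
      _ ≤ _ := by
        have e1 : 0 ≤ |D| * (|h| * F) * ‖x‖ := by positivity
        have e2 : 0 ≤ |h| * C * ‖x‖ := by positivity
        nlinarith
  refine ⟨|D| * (1 + |h| * F) + |h| * C, fun x => abs_le.2 ⟨?_, ?_⟩⟩
  · exact G.le_functional (hb x) fun i => (abs_le.1 (key x i)).1
  · exact G.functional_le (hb x) fun i => (abs_le.1 (key x i)).2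

theorem IsGame.linBdd_iterate (G : IsGame M f ℓ F C L) {u : Euc d → ℝ} (hu : LinBdd u) (h : ℝ)
    (k : ℕ) : LinBdd ((gameStep M f ℓ h)^[k] u) := by
  induction k with
  | zero => exact hu
  | succ k ih => rw [Function.iterate_succ_apply']; exact G.linBdd_step ih h

theorem IsGame.norm_move_le (G : IsGame M f ℓ F C L) {h : ℝ} (hh : 0 ≤ h) (x y : Euc d) (i : I) :
    ‖y + h • f i - x‖ ≤ ‖y - x‖ + h * F := by
  rw [show y + h • f i - x = (y - x) + h • f i by abel]
  refine (norm_add_le _ _).trans ?_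
  rw [norm_smul, Real.norm_eq_abs, abs_of_nonneg hh]
  have := G.speed i
  gcongr

/-- Propagation of an affine upper bound. -/
theorem IsGame.iterate_le_affine (G : IsGame M f ℓ F C L) {u : Euc d → ℝ} (hu : LinBdd u) {h : ℝ}
    (hh : 0 ≤ h) {x p : Euc d} {a Λ r : ℝ} (hΛ : ∀ y, ‖y - x‖ ≤ r → -gameHam M f ℓ y p ≤ Λ)
    (hua : ∀ y, ‖y - x‖ ≤ r → u y ≤ a + inner ℝ p (y - x)) (k : ℕ) :
    ∀ y, ‖y - x‖ + k * h * F ≤ r →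
      (gameStep M f ℓ h)^[k] u y ≤ a + inner ℝ p (y - x) + k * h * Λ := by
  have hF := G.F_pos
  induction k with
  | zero => intro y hy; simpa using hua y (by simpa using hy)
  | succ k ih =>
    intro y hy
    push_cast at hy ⊢
    rw [Function.iterate_succ_apply']
    -- An affine payoff makes the increment h (ℓ + ⟨f, p⟩), so positive homogeneity extracts h times
    -- minus the Hamiltonian. Each step shrinks the ball by h F, the longest possible move.
    have h1 := G.mono (fun i => (gameStep M f ℓ h)^[k] u (y + h • f i) + h * ℓ y i)
      (fun i => h * (ℓ y i + inner ℝ (f i) p)) (a + inner ℝ p (y - x) + k * h * Λ)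
      (G.bdd_payoff (G.linBdd_iterate hu h k) h y) ?_ ?_
    · rw [G.smul _ _ hh (G.bdd_momentum y p)] at h1
      have hpos : 0 ≤ ((k : ℝ) + 1) * h * F := by positivity
      have h2 := hΛ y (by linarith)
      have h3 := mul_le_mul_of_nonneg_left h2 hh
      rw [gameHam, neg_neg] at h3
      calc _ ≤ _ := h1
        _ ≤ _ := by linarith
    · obtain ⟨D, hD⟩ := G.bdd_momentum y p
      exact ⟨h * D, fun i => by rw [abs_mul, abs_of_nonneg hh]; have := hD i; gcongr⟩
    · intro i
      have h2 := ih (y + h • f i) (by have := G.norm_move_le hh x y i; nlinarith)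
      rw [show y + h • f i - x = (y - x) + h • f i by abel, inner_add_right, inner_smul_right,
        real_inner_comm (f i) p] at h2
      linarith

/-- The scheme is monotone and commutes with constants, with finite speed of propagation; the
running costs are allowed to differ. -/
theorem IsGame.iterate_le_iterate {ℓ' : Euc d → I → ℝ} {C' L' : ℝ} (G : IsGame M f ℓ F C L)
    (G' : IsGame M f ℓ' F C' L') {u v : Euc d → ℝ} (hu : LinBdd u) (hv : LinBdd v) {h : ℝ}
    (hh : 0 ≤ h) {x : Euc d} {c r e : ℝ} (z : Euc d)
    (hℓ : ∀ y i, ℓ (y + z) i ≤ ℓ' y i + e)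
    (huv : ∀ y, ‖y - x‖ ≤ r → u (y + z) ≤ v y + c) (k : ℕ) :
    ∀ y, ‖y - x‖ + k * h * F ≤ r →
      (gameStep M f ℓ h)^[k] u (y + z) ≤ (gameStep M f ℓ' h)^[k] v y + (c + k * h * e) := by
  have hF := G.F_pos
  induction k with
  | zero => intro y hy; simpa using huv y (by simpa using hy)
  | succ k ih =>
    intro y hy
    push_cast at hy ⊢
    rw [Function.iterate_succ_apply', Function.iterate_succ_apply']
    refine G.mono _ _ _ (G.bdd_payoff (G.linBdd_iterate hu h k) h _)
      (G'.bdd_payoff (G'.linBdd_iterate hv h k) h y) fun i => ?_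
    have h2 := ih (y + h • f i) (by have := G.norm_move_le hh x y i; nlinarith)
    rw [show y + h • f i + z = y + z + h • f i by abel] at h2
    have h3 := mul_le_mul_of_nonneg_left (hℓ y i) hh
    linarith

theorem IsGame.momentumLipschitz (G : IsGame M f ℓ F C L) (x : Euc d) :
    MomentumLipschitz F (gameHam M f ℓ x) := by
  have key : ∀ p q, M (fun i => ℓ x i + inner ℝ (f i) p) ≤
      M (fun i => ℓ x i + inner ℝ (f i) q) + F * ‖p - q‖ := by
    intro p q
    refine G.mono _ _ _ (G.bdd_momentum x p) (G.bdd_momentum x q) fun i => ?_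
    have h1 := (abs_le.1 (abs_real_inner_le_norm (f i) (p - q))).2
    rw [inner_sub_right] at h1
    have : ‖f i‖ * ‖p - q‖ ≤ F * ‖p - q‖ := by have := G.speed i; gcongr
    linarith
  intro p q
  have h1 := key p q
  have h2 := key q p
  rw [norm_sub_rev] at h2
  simp only [gameHam]
  rw [abs_le]
  constructor <;> linarith

theorem IsGame.lip_ham (G : IsGame M f ℓ F C L) (x y p : Euc d) :
    |gameHam M f ℓ x p - gameHam M f ℓ y p| ≤ L * ‖x - y‖ := by
  have key : ∀ x y, M (fun i => ℓ x i + inner ℝ (f i) p) ≤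
      M (fun i => ℓ y i + inner ℝ (f i) p) + L * ‖x - y‖ := by
    intro x y
    refine G.mono _ _ _ (G.bdd_momentum x p) (G.bdd_momentum y p) fun i => ?_
    have h1 := (abs_le.1 (G.lip x y i)).2
    linarith
  have h1 := key x y
  have h2 := key y x
  rw [norm_sub_rev] at h2
  simp only [gameHam]
  rw [abs_le]
  constructor <;> linarith

theorem IsGame.neg_ham_zero_le (G : IsGame M f ℓ F C L) (x : Euc d) : -gameHam M f ℓ x 0 ≤ C := by
  rw [gameHam, neg_neg]
  refine G.functional_le (G.bdd_momentum x 0) fun i => ?_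
  simpa using (abs_le.1 (G.bdd x i)).2

/-- The scheme with time step `1 / (n + 1)`, extended to all times as a step function. -/
noncomputable def schemeFn (M : (I → ℝ) → ℝ) (f : I → Euc d) (ℓ : Euc d → I → ℝ) (g : Euc d → ℝ)
    (n : ℕ) (z : ℝ × Euc d) : ℝ :=
  (gameStep M f ℓ (1 / ((n : ℝ) + 1)))^[⌊((n : ℝ) + 1) * z.1⌋₊] g z.2

theorem schemeFn_dual (g : Euc d → ℝ) (n : ℕ) (z : ℝ × Euc d) :
    schemeFn (fun φ => -M fun i => -φ i) f (fun x i => -ℓ x i) (fun x => -g x) n z =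
      -schemeFn M f ℓ g n z := by
  simp only [schemeFn, gameStep_iterate_dual]

theorem floor_mul_step_le {t : ℝ} (ht : 0 ≤ t) (n : ℕ) :
    (⌊((n : ℝ) + 1) * t⌋₊ : ℝ) * (1 / ((n : ℝ) + 1)) ≤ t := by
  have hn : (0 : ℝ) < (n : ℝ) + 1 := by positivity
  rw [mul_one_div, div_le_iff₀ hn, mul_comm t]
  exact Nat.floor_le (by positivity)

theorem IsGame.schemeFn_le (G : IsGame M f ℓ F C L) {g : Euc d → ℝ} (hg : LinBdd g) {x : Euc d}
    {a r : ℝ} (h : ∀ y, ‖y - x‖ ≤ r → g y ≤ a) (n : ℕ) {t : ℝ} (ht : 0 ≤ t) {y : Euc d}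
    (hy : ‖y - x‖ + t * F ≤ r) : schemeFn M f ℓ g n (t, y) ≤ a + t * C := by
  have hF := G.F_pos
  have hC := G.C_nonneg
  have hk := floor_mul_step_le ht n
  have h1 := G.iterate_le_affine hg (h := 1 / ((n : ℝ) + 1)) (by positivity) (x := x) (p := 0)
    (a := a) (Λ := C) (r := r) (fun y _ => G.neg_ham_zero_le y) (by simpa using h)
    ⌊((n : ℝ) + 1) * t⌋₊ y (by
      have := mul_le_mul_of_nonneg_right hk hF.le
      linarith)
  have h2 := mul_le_mul_of_nonneg_right hk hC
  simp only [inner_zero_left, add_zero] at h1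
  exact h1.trans (by linarith)

theorem IsGame.le_schemeFn (G : IsGame M f ℓ F C L) {g : Euc d → ℝ} (hg : LinBdd g) {x : Euc d}
    {a r : ℝ} (h : ∀ y, ‖y - x‖ ≤ r → a ≤ g y) (n : ℕ) {t : ℝ} (ht : 0 ≤ t) {y : Euc d}
    (hy : ‖y - x‖ + t * F ≤ r) : a - t * C ≤ schemeFn M f ℓ g n (t, y) := by
  have h1 := G.dual.schemeFn_le hg.neg (a := -a) (r := r) (x := x)
    (fun y hy => by linarith [h y hy]) n ht hy
  rw [schemeFn_dual] at h1
  linarith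

theorem IsGame.locallyBoundedAlong (G : IsGame M f ℓ F C L) {g : Euc d → ℝ} (hg : LinBdd g)
    (T : ℝ) : LocallyBoundedAlong T atTop (schemeFn M f ℓ g) := by
  have hg' := hg
  obtain ⟨D, hD⟩ := hg
  rintro ⟨t₀, x₀⟩ ⟨ht₀, -⟩
  have hF := G.F_pos
  have hC := G.C_nonneg
  set r := 1 + (t₀ + 1) * F
  set A := |D| * (1 + (‖x₀‖ + r)) with hA
  have hball : ∀ y, ‖y - x₀‖ ≤ r → |g y| ≤ A := by
    intro y hy
    refine (hD y).trans ?_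
    have h1 : ‖y‖ ≤ ‖x₀‖ + r := by
      have := norm_add_le x₀ (y - x₀)
      rw [add_sub_cancel] at this
      linarith
    rw [hA]
    have := le_abs_self D
    gcongr
  refine ⟨A + (t₀ + 1) * C, ?_⟩
  have h1 : ∀ᶠ z : ℝ × Euc d in 𝓝[Ico 0 T ×ˢ univ] (t₀, x₀),
      0 ≤ z.1 ∧ z.1 < t₀ + 1 ∧ ‖z.2 - x₀‖ < 1 := by
    have e1 : ∀ᶠ z : ℝ × Euc d in 𝓝 (t₀, x₀), z.1 < t₀ + 1 :=
      (continuous_fst.tendsto (t₀, x₀)).eventually_lt_const (by simp)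
    have e2 : ∀ᶠ z : ℝ × Euc d in 𝓝 (t₀, x₀), ‖z.2 - x₀‖ < 1 := by
      have hc : Continuous fun z : ℝ × Euc d => ‖z.2 - x₀‖ := by fun_prop
      exact (hc.tendsto (t₀, x₀)).eventually_lt_const (by simp)
    filter_upwards [eventually_nhdsWithin_of_eventually_nhds e1,
      eventually_nhdsWithin_of_eventually_nhds e2, self_mem_nhdsWithin] with z h1 h2 h3
    exact ⟨h3.1.1, h1, h2⟩
  filter_upwards [h1.prod_inr atTop] with ⟨n, t, y⟩ ⟨hq1, hq2, hq3⟩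
  simp only at hq1 hq2 hq3
  have hr : ‖y - x₀‖ + t * F ≤ r := by
    have : t * F ≤ (t₀ + 1) * F := by gcongr
    linarith
  have hC' : t * C ≤ (t₀ + 1) * C := by gcongr
  have h2 := G.schemeFn_le hg' (fun y hy => (abs_le.1 (hball y hy)).2) n hq1 hr
  have h3 := G.le_schemeFn hg' (fun y hy => (abs_le.1 (hball y hy)).1) n hq1 hr
  exact abs_le.2 ⟨by linarith, by linarith⟩

theorem IsGame.tendsto_initial (G : IsGame M f ℓ F C L) {g : Euc d → ℝ} (hg : LinBdd g)
    (hgc : Continuous g) (T : ℝ) (x : Euc d) :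
    Tendsto (fun q : ℕ × (ℝ × Euc d) => schemeFn M f ℓ g q.1 q.2)
      (atTop ×ˢ 𝓝[Ico 0 T ×ˢ univ] (0, x)) (𝓝 (g x)) := by
  rw [Metric.tendsto_nhds]
  intro η hη
  obtain ⟨r, hr, hgr⟩ := Metric.continuous_iff.1 hgc x (η / 3) (by positivity)
  have hball : ∀ y, ‖y - x‖ ≤ r / 2 → |g y - g x| ≤ η / 3 := fun y hy =>
    (hgr y (by rw [dist_eq_norm]; linarith)).le
  have h1 : ∀ᶠ z : ℝ × Euc d in 𝓝[Ico 0 T ×ˢ univ] (0, x),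
      0 ≤ z.1 ∧ ‖z.2 - x‖ + z.1 * F < r / 2 ∧ z.1 * C < η / 3 := by
    have e1 : ∀ᶠ z : ℝ × Euc d in 𝓝 (0, x), ‖z.2 - x‖ + z.1 * F < r / 2 := by
      have hc : Continuous fun z : ℝ × Euc d => ‖z.2 - x‖ + z.1 * F := by fun_prop
      exact (hc.tendsto (0, x)).eventually_lt_const (by simp [hr])
    have e2 : ∀ᶠ z : ℝ × Euc d in 𝓝 (0, x), z.1 * C < η / 3 := by
      have hc : Continuous fun z : ℝ × Euc d => z.1 * C := by fun_prop
      exact (hc.tendsto (0, x)).eventually_lt_const (by simp [hη])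
    filter_upwards [eventually_nhdsWithin_of_eventually_nhds e1,
      eventually_nhdsWithin_of_eventually_nhds e2, self_mem_nhdsWithin] with z h1 h2 h3
    exact ⟨h3.1.1, h1, h2⟩
  filter_upwards [h1.prod_inr atTop] with ⟨n, t, y⟩ ⟨hq1, hq2, hq3⟩
  simp only at hq1 hq2 hq3
  have h2 := G.schemeFn_le hg (a := g x + η / 3)
    (fun y hy => by linarith [(abs_le.1 (hball y hy)).2]) n hq1 hq2.le
  have h3 := G.le_schemeFn hg (a := g x - η / 3)
    (fun y hy => by linarith [(abs_le.1 (hball y hy)).1]) n hq1 hq2.le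
  rw [Real.dist_eq, abs_lt]
  constructor <;> linarith

/-- Rounding both times to multiples of τ = 1 / (n + 1) leaves `j` steps with h - τ ≤ j τ ≤ h + τ,
and an affine bound is propagated through these steps. The speed 2 F absorbs the rounding once τ <
h; the spatial variation of the Hamiltonian and the rounding error each cost at most (η / 2) h. -/
theorem IsGame.upperConsistent (G : IsGame M f ℓ F C L) {g : Euc d → ℝ} (hg : LinBdd g)
    (T : ℝ) : UpperConsistent T (gameHam M f ℓ) (2 * F) atTop (schemeFn M f ℓ g) := by
  intro t ht x p η hη
  have hF := G.F_pos
  have hL := G.L_nonneg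
  have e1 : ∀ᶠ h in 𝓝[>] (0 : ℝ), L * (2 * F * h) < η / 4 := by
    have hc : Continuous fun h : ℝ => L * (2 * F * h) := by fun_prop
    exact eventually_nhdsWithin_of_eventually_nhds
      ((hc.tendsto 0).eventually_lt_const (by simp [hη]))
  filter_upwards [e1, eventually_nhdsWithin_of_eventually_nhds (eventually_lt_nhds ht.1),
    self_mem_nhdsWithin] with h hh1 hht hh0
  have hh0 : 0 < h := hh0
  have e2 : ∀ᶠ z in 𝓝 (t, x), h < z.1 ∧ L * ‖z.2 - x‖ < η / 4 := by
    have hc : Continuous fun z : ℝ × Euc d => L * ‖z.2 - x‖ := by fun_prop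
    exact ((continuous_fst.tendsto (t, x)).eventually_const_lt hht).and
      ((hc.tendsto (t, x)).eventually_lt_const (by simp [hη]))
  have e3 : ∀ᶠ n : ℕ in atTop, 1 / ((n : ℝ) + 1) < h ∧
      1 / ((n : ℝ) + 1) * (|gameHam M f ℓ x p| + η) < η / 2 * h := by
    have h1 := tendsto_one_div_add_atTop_nhds_zero_nat (𝕜 := ℝ)
    have h2 := h1.mul_const (|gameHam M f ℓ x p| + η)
    rw [zero_mul] at h2
    exact (h1.eventually_lt_const hh0).and (h2.eventually_lt_const (by positivity))
  filter_upwards [e2.prod_inr atTop, e3.prod_inl (𝓝 (t, x))] with ⟨n, s, y⟩ ⟨hs, hy⟩ ⟨hn1, hn2⟩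
    a ha
  simp only at hs hy hn1 hn2 ha ⊢
  have hN : (0 : ℝ) < (n : ℝ) + 1 := by positivity
  set τ := 1 / ((n : ℝ) + 1) with hτ
  have hτ0 : 0 < τ := by positivity
  set k₁ := ⌊((n : ℝ) + 1) * s⌋₊ with hk₁
  set k₀ := ⌊((n : ℝ) + 1) * (s - h)⌋₊ with hk₀
  have hle : k₀ ≤ k₁ := Nat.floor_mono (by gcongr; linarith)
  obtain ⟨j, hj⟩ := Nat.exists_eq_add_of_le' hle
  have hs0 : 0 ≤ s - h := by linarith
  have f1 : (k₁ : ℝ) ≤ ((n : ℝ) + 1) * s := Nat.floor_le (by nlinarith)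
  have f2 : ((n : ℝ) + 1) * s < k₁ + 1 := Nat.lt_floor_add_one _
  have f3 : (k₀ : ℝ) ≤ ((n : ℝ) + 1) * (s - h) := Nat.floor_le (by positivity)
  have f4 : ((n : ℝ) + 1) * (s - h) < k₀ + 1 := Nat.lt_floor_add_one _
  have hjr : (k₁ : ℝ) = j + k₀ := by exact_mod_cast hj
  have j1 : (j : ℝ) * τ ≤ h + τ := by
    rw [hτ, mul_one_div, div_le_iff₀ hN, add_mul, one_div_mul_cancel hN.ne']
    nlinarith
  have j2 : h - τ ≤ (j : ℝ) * τ := by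
    rw [hτ, mul_one_div, le_div_iff₀ hN, sub_mul, one_div_mul_cancel hN.ne']
    nlinarith
  have hF2 : (j : ℝ) * τ * F ≤ 2 * F * h := by
    have := mul_le_mul_of_nonneg_right (j1.trans (show h + τ ≤ 2 * h by linarith)) hF.le
    linarith
  set Λ := -gameHam M f ℓ x p + η / 2 with hΛ
  have key := G.iterate_le_affine (G.linBdd_iterate hg τ k₀) hτ0.le (x := y) (p := p) (a := a)
    (Λ := Λ) (r := 2 * F * h) (fun y' hy' => ?_) ha j y (by simpa using hF2)
  · have e : schemeFn M f ℓ g n (s, y) =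
        (gameStep M f ℓ τ)^[j] ((gameStep M f ℓ τ)^[k₀] g) y := by
      rw [← Function.iterate_add_apply, ← hj]
      rfl
    rw [e]
    refine key.trans ?_
    rw [sub_self, inner_zero_right, add_zero]
    have hΛabs : |Λ| ≤ |gameHam M f ℓ x p| + η := by
      rw [hΛ]
      refine (abs_add_le _ _).trans ?_
      rw [abs_neg, abs_of_pos (by positivity : (0 : ℝ) < η / 2)]
      linarith
    have h1 : (j * τ - h) * Λ ≤ τ * |Λ| := by
      refine (le_abs_self _).trans ?_
      rw [abs_mul]
      gcongr
      rw [abs_le]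
      constructor <;> linarith
    have h2 : τ * |Λ| ≤ τ * (|gameHam M f ℓ x p| + η) := by gcongr
    have h3 : (j : ℝ) * τ * Λ = (j * τ - h) * Λ + h * Λ := by ring
    rw [h3]
    have h4 : h * Λ = -(h * gameHam M f ℓ x p) + η / 2 * h := by rw [hΛ]; ring
    linarith
  · have h1 := (abs_le.1 (G.lip_ham x y' p)).2
    have h2 : ‖x - y'‖ ≤ ‖y - x‖ + 2 * F * h := by
      rw [norm_sub_rev x y', show y' - x = (y' - y) + (y - x) by abel]
      exact (norm_add_le _ _).trans (by linarith)
    have h3 := mul_le_mul_of_nonneg_left h2 hL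
    rw [hΛ]
    linarith

/-- The discrete games converge to the viscosity solution of the Cauchy problem. -/
theorem IsGame.exists_isCauchySolution (G : IsGame M f ℓ F C L) {g : Euc d → ℝ} (hg : LinBdd g)
    (hgc : Continuous g) {T : ℝ} (hT : 0 < T) :
    ∃ v, IsCauchySolution T (gameHam M f ℓ) g v ∧
      ∀ S : Set (ℝ × Euc d), IsCompact S → S ⊆ Ico 0 T ×ˢ univ →
        TendstoUniformlyOn (schemeFn M f ℓ g) v atTop S := by
  refine exists_isCauchySolution_tendstoUniformlyOn G.F_pos G.momentumLipschitz G.lip_ham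
    (R := 2 * F) (by have := G.F_pos; positivity) hT (G.locallyBoundedAlong hg T)
    (G.upperConsistent hg T) ?_ (G.tendsto_initial hg hgc T)
  have h := G.dual.upperConsistent hg.neg T
  convert h using 1
  · ext x p
    rw [gameHam_dual]
  · ext n z
    rw [schemeFn_dual]

/-- The value of the game, as the limit of the discrete games. -/
noncomputable def gameValue (M : (I → ℝ) → ℝ) (f : I → Euc d) (ℓ : Euc d → I → ℝ) (g : Euc d → ℝ)
    (z : ℝ × Euc d) : ℝ :=
  limUnder atTop fun n => schemeFn M f ℓ g n z

theorem IsGame.tendsto_gameValue (G : IsGame M f ℓ F C L) {g : Euc d → ℝ} (hg : LinBdd g)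
    (hgc : Continuous g) {t : ℝ} (ht : 0 ≤ t) (x : Euc d) :
    Tendsto (fun n => schemeFn M f ℓ g n (t, x)) atTop (𝓝 (gameValue M f ℓ g (t, x))) := by
  obtain ⟨v, -, hv⟩ := G.exists_isCauchySolution hg hgc (T := t + 1) (by linarith)
  have h := (hv {(t, x)} isCompact_singleton (by
    rintro _ rfl
    exact ⟨⟨ht, by simp⟩, trivial⟩)).tendsto_at (mem_singleton _)
  exact tendsto_nhds_limUnder ⟨_, h⟩

/-- The pointwise limit of the schemes does not involve the horizon, so one function solves the
Cauchy problem for every `T`. -/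
theorem IsGame.isCauchySolution (G : IsGame M f ℓ F C L) {g : Euc d → ℝ} (hg : LinBdd g)
    (hgc : Continuous g) {T : ℝ} (hT : 0 < T) :
    IsCauchySolution T (gameHam M f ℓ) g (gameValue M f ℓ g) := by
  obtain ⟨v, hv, hlim⟩ := G.exists_isCauchySolution hg hgc hT
  refine hv.congr hT ?_
  rintro ⟨t, x⟩ hz
  have h := (hlim {(t, x)} isCompact_singleton (by rintro _ rfl; exact hz)).tendsto_at
    (mem_singleton _)
  exact tendsto_nhds_unique h (G.tendsto_gameValue hg hgc hz.1.1 x)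

end

/-! ### Conditional expectations and concentration -/

theorem sup_eq_generateFrom_inter {Ω : Type*} (m₁ m₃ : MeasurableSpace Ω) :
    m₁ ⊔ m₃ = MeasurableSpace.generateFrom
      {s | ∃ A B, MeasurableSet[m₁] A ∧ MeasurableSet[m₃] B ∧ s = A ∩ B} := by
  refine le_antisymm (sup_le ?_ ?_) (MeasurableSpace.generateFrom_le ?_)
  · intro A hA
    exact MeasurableSpace.measurableSet_generateFrom
      ⟨A, univ, hA, @MeasurableSet.univ _ m₃, by simp⟩
  · intro B hB
    exact MeasurableSpace.measurableSet_generateFrom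
      ⟨univ, B, @MeasurableSet.univ _ m₁, hB, by simp⟩
  · rintro _ ⟨A, B, hA, hB, rfl⟩
    exact @MeasurableSet.inter _ (m₁ ⊔ m₃) _ _ (le_sup_left (b := m₃) A hA)
      (le_sup_right (a := m₁) B hB)

theorem isPiSystem_inter {Ω : Type*} (m₁ m₃ : MeasurableSpace Ω) :
    IsPiSystem {s | ∃ A B, MeasurableSet[m₁] A ∧ MeasurableSet[m₃] B ∧ s = A ∩ B} := by
  rintro _ ⟨A, B, hA, hB, rfl⟩ _ ⟨A', B', hA', hB', rfl⟩ -
  exact ⟨A ∩ A', B ∩ B', @MeasurableSet.inter _ m₁ _ _ hA hA', @MeasurableSet.inter _ m₃ _ _ hB hB',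
    by rw [inter_inter_inter_comm]⟩

section

variable {Ω : Type*} {m₀ : MeasurableSpace Ω} {P : Measure Ω} [IsProbabilityMeasure P]

theorem integrable_of_abs_le {X : Ω → ℝ} {B : ℝ} (hX : AEStronglyMeasurable X P)
    (hB : ∀ᵐ ω ∂P, |X ω| ≤ B) : Integrable X P :=
  Integrable.of_bound hX B hB

theorem integral_mul_condExp_of_stronglyMeasurable {m : MeasurableSpace Ω} (hm : m ≤ m₀)
    {Y X : Ω → ℝ} (hY : StronglyMeasurable[m] Y) (hYX : Integrable (fun ω => Y ω * X ω) P)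
    (hX : Integrable X P) : ∫ ω, Y ω * (P[X|m]) ω ∂P = ∫ ω, Y ω * X ω ∂P := by
  rw [← integral_condExp hm (f := fun ω => Y ω * X ω)]
  exact integral_congr_ae (condExp_mul_of_stronglyMeasurable_left hY hYX hX).symm

/-- If `m₃` is independent of `m₂ ≥ m₁`, then conditioning an event of `m₂` on `m₁ ⊔ m₃` amounts
to conditioning it on `m₁`. -/
theorem setIntegral_indicator_sub_condExp_eq_zero {m₁ m₂ m₃ : MeasurableSpace Ω} (h12 : m₁ ≤ m₂)
    (h2 : m₂ ≤ m₀) (h3 : m₃ ≤ m₀) (hind : Indep m₂ m₃ P) {D : Set Ω} (hD : MeasurableSet[m₂] D)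
    {E : Set Ω} (hE : MeasurableSet[m₁ ⊔ m₃] E) :
    ∫ ω in E, (D.indicator (fun _ => (1 : ℝ)) ω - (P[D.indicator fun _ => (1 : ℝ)|m₁]) ω) ∂P
      = 0 := by
  have h1 : m₁ ≤ m₀ := h12.trans h2
  have hsup : m₁ ⊔ m₃ ≤ m₀ := sup_le h1 h3
  have hDint : Integrable (D.indicator fun _ => (1 : ℝ)) P :=
    (integrable_const 1).indicator (h2 D hD)
  set W : Ω → ℝ := fun ω =>
    D.indicator (fun _ => (1 : ℝ)) ω - (P[D.indicator fun _ => (1 : ℝ)|m₁]) ω with hW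
  have hWint : Integrable W P := hDint.sub integrable_condExp
  have huniv : ∫ ω, W ω ∂P = 0 := by
    simp only [hW]
    rw [integral_sub hDint integrable_condExp, integral_condExp h1, sub_self]
  induction E, hE using MeasurableSpace.induction_on_inter
    (sup_eq_generateFrom_inter m₁ m₃) (isPiSystem_inter m₁ m₃) with
  | empty => simp
  | basic s hs =>
    obtain ⟨A, B, hA, hB, rfl⟩ := hs
    have hA0 := h1 A hA
    have hB0 := h3 B hB
    have hAD : Integrable (fun ω => A.indicator (D.indicator fun _ => (1 : ℝ)) ω) P :=
      hDint.indicator hA0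
    have hAZ : Integrable (A.indicator (P[D.indicator fun _ => (1 : ℝ)|m₁])) P :=
      integrable_condExp.indicator hA0
    -- By independence an m₂-measurable `Y` may be replaced by its mean on events of m₃. On A ∩ B
    -- both terms then reduce to integrals over A, which agree by the definition of conditional
    -- expectation.
    have key : ∀ Y : Ω → ℝ, StronglyMeasurable[m₂] Y → Integrable Y P →
        ∫ ω in B, Y ω ∂P = ∫ ω in B, (fun _ => ∫ ω, Y ω ∂P) ω ∂P := by
      intro Y hY hYint
      rw [← setIntegral_condExp h3 hYint hB]
      exact setIntegral_congr_ae hB0 ((condExp_indep_eq h2 h3 hY hind).mono fun ω h _ => h)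
    have e1 : ∫ ω in A ∩ B, W ω ∂P = ∫ ω in B, A.indicator (D.indicator fun _ => (1 : ℝ)) ω ∂P -
        ∫ ω in B, A.indicator (P[D.indicator fun _ => (1 : ℝ)|m₁]) ω ∂P := by
      rw [inter_comm, ← setIntegral_indicator hA0, ← integral_sub hAD.integrableOn hAZ.integrableOn]
      refine integral_congr_ae (Eventually.of_forall fun ω => ?_)
      by_cases hω : ω ∈ A <;> simp [hω, hW]
    rw [e1, key _ ?_ hAD, key _ ?_ hAZ, integral_indicator hA0, integral_indicator hA0,
      setIntegral_condExp h1 hDint hA, sub_self]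
    · exact ((stronglyMeasurable_condExp (m := m₁)).mono h12).indicator (h12 A hA)
    · exact ((@stronglyMeasurable_const _ _ m₂ _ (1 : ℝ)).indicator hD).indicator (h12 A hA)
  | compl s hs ih =>
    have := integral_add_compl (hsup s hs) hWint
    linarith
  | iUnion g hdisj hg ih =>
    rw [integral_iUnion (fun i => hsup _ (hg i)) hdisj hWint.integrableOn]
    simp [ih]

/-- Resampling of an independent component does not change the conditional expectation. -/
theorem condExp_eq_of_indep_sup {m₁ m₂ m₃ : MeasurableSpace Ω} (h12 : m₁ ≤ m₂) (h2 : m₂ ≤ m₀)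
    (h3 : m₃ ≤ m₀) (hind : Indep m₂ m₃ P) {X : Ω → ℝ} (hX : StronglyMeasurable[m₁ ⊔ m₃] X)
    {B : ℝ} (hB : ∀ ω, |X ω| ≤ B) : P[X|m₂] =ᵐ[P] P[X|m₁] := by
  have h1 : m₁ ≤ m₀ := h12.trans h2
  have hsup : m₁ ⊔ m₃ ≤ m₀ := sup_le h1 h3
  have hXint : Integrable X P :=
    integrable_of_abs_le (hX.mono hsup).aestronglyMeasurable (Eventually.of_forall hB)
  refine (ae_eq_condExp_of_forall_setIntegral_eq h2 hXint
    (fun s _ _ => integrable_condExp.integrableOn) (fun D hD _ => ?_)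
    ((stronglyMeasurable_condExp (m := m₁)).mono h12).aestronglyMeasurable).symm
  have hD0 := h2 D hD
  have hDint : Integrable (D.indicator fun _ => (1 : ℝ)) P :=
    (integrable_const 1).indicator hD0
  -- For D in m₂, self-adjointness gives ∫_D E[X | m₁] = E[Z X], while ∫_D X - E[Z X] = E[X (1_D -
  -- Z)] vanishes because 1_D - Z has zero conditional expectation given m₁ ⊔ m₃.
  set Z := P[D.indicator fun _ => (1 : ℝ)|m₁] with hZ
  have hmul : ∀ Y : Ω → ℝ, ∫ ω in D, Y ω ∂P =
      ∫ ω, D.indicator (fun _ => (1 : ℝ)) ω * Y ω ∂P := by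
    intro Y
    rw [← integral_indicator hD0]
    refine integral_congr_ae (Eventually.of_forall fun ω => ?_)
    by_cases hω : ω ∈ D <;> simp [hω]
  have hint : ∀ {Y V : Ω → ℝ}, Integrable Y P → AEStronglyMeasurable[m₀] V P →
      (∀ᵐ ω ∂P, |V ω| ≤ |B|) → Integrable (fun ω => Y ω * V ω) P := by
    intro Y V hY hV hVB
    exact hY.mul_bdd hV hVB
  have hXB : ∀ᵐ ω ∂P, |X ω| ≤ |B| := Eventually.of_forall fun ω => (hB ω).trans (le_abs_self B)
  have hcX : ∀ᵐ ω ∂P, |(P[X|m₁]) ω| ≤ |B| := ae_bdd_abs_condExp_of_ae_bdd_abs hXB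
  have e1 : ∫ ω in D, (P[X|m₁]) ω ∂P = ∫ ω, Z ω * X ω ∂P := by
    rw [hmul]
    have a1 : ∫ ω, (P[X|m₁]) ω * (P[D.indicator fun _ => (1 : ℝ)|m₁]) ω ∂P =
        ∫ ω, (P[X|m₁]) ω * D.indicator (fun _ => (1 : ℝ)) ω ∂P :=
      integral_mul_condExp_of_stronglyMeasurable h1 stronglyMeasurable_condExp
        (by simpa only [mul_comm] using
          hint hDint integrable_condExp.aestronglyMeasurable hcX) hDint
    have a2 : ∫ ω, Z ω * (P[X|m₁]) ω ∂P = ∫ ω, Z ω * X ω ∂P :=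
      integral_mul_condExp_of_stronglyMeasurable h1 stronglyMeasurable_condExp
        (hint integrable_condExp hXint.aestronglyMeasurable hXB) hXint
    rw [← a2]
    simp only [mul_comm (Z _)]
    rw [← hZ] at a1
    rw [a1]
    simp only [mul_comm]
  rw [e1, hmul]
  have hWint : Integrable (fun ω => D.indicator (fun _ => (1 : ℝ)) ω - Z ω) P :=
    hDint.sub integrable_condExp
  have hW0 : P[fun ω => D.indicator (fun _ => (1 : ℝ)) ω - Z ω|m₁ ⊔ m₃] =ᵐ[P] 0 := by
    refine (ae_eq_condExp_of_forall_setIntegral_eq hsup hWint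
      (fun s _ _ => (integrable_zero _ _ _).integrableOn) (fun E hE _ => ?_)
      stronglyMeasurable_zero.aestronglyMeasurable).symm
    have := setIntegral_indicator_sub_condExp_eq_zero h12 h2 h3 hind hD hE
    rw [← hZ] at this
    simpa using this.symm
  have b1 : ∫ ω, X ω * (P[fun ω => D.indicator (fun _ => (1 : ℝ)) ω - Z ω|m₁ ⊔ m₃]) ω ∂P =
      ∫ ω, X ω * (D.indicator (fun _ => (1 : ℝ)) ω - Z ω) ∂P :=
    integral_mul_condExp_of_stronglyMeasurable hsup hX (by
      simpa only [mul_comm] using hint hWint hXint.aestronglyMeasurable hXB) hWint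
  have b2 : ∫ ω, X ω * (P[fun ω => D.indicator (fun _ => (1 : ℝ)) ω - Z ω|m₁ ⊔ m₃]) ω ∂P = 0 := by
    rw [integral_congr_ae (g := fun _ => (0 : ℝ)) (hW0.mono fun ω h => by simp [h])]
    simp
  rw [b2] at b1
  have b3 : ∫ ω, X ω * (D.indicator (fun _ => (1 : ℝ)) ω - Z ω) ∂P =
      ∫ ω, D.indicator (fun _ => (1 : ℝ)) ω * X ω ∂P - ∫ ω, Z ω * X ω ∂P := by
    rw [← integral_sub (hint hDint hXint.aestronglyMeasurable hXB)
      (hint integrable_condExp hXint.aestronglyMeasurable hXB)]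
    exact integral_congr_ae (Eventually.of_forall fun ω => by ring)
  linarith

/-- On [-c, c] the convex exponential lies below its chord. For a martingale increment the linear
term of the chord integrates to zero, which leaves cosh(θ c) ≤ exp((θ c)² / 2). -/
theorem exp_mul_le_cosh_add {θ c x : ℝ} (hc : 0 < c) (hx : |x| ≤ c) :
    Real.exp (θ * x) ≤ Real.cosh (θ * c) + x * (Real.sinh (θ * c) / c) := by
  obtain ⟨h1, h2⟩ := abs_le.1 hx
  have h := convexOn_exp.2 (mem_univ (θ * c)) (mem_univ (-(θ * c)))
    (show 0 ≤ (1 + x / c) / 2 by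
      have : -1 ≤ x / c := by rw [le_div_iff₀ hc]; linarith
      linarith)
    (show 0 ≤ (1 - x / c) / 2 by
      have : x / c ≤ 1 := by rw [div_le_iff₀ hc]; linarith
      linarith) (by ring)
  simp only [smul_eq_mul] at h
  have e : (1 + x / c) / 2 * (θ * c) + (1 - x / c) / 2 * -(θ * c) = θ * x := by
    field_simp; ring
  rw [e] at h
  rw [Real.cosh_eq, Real.sinh_eq]
  refine h.trans (le_of_eq ?_)
  field_simp
  ring

/-- The Azuma–Hoeffding bound on the moment generating function, for the Doob martingale of a
bounded random variable. -/
theorem integral_exp_le_of_bounded_differences {ℱ : ℕ → MeasurableSpace Ω} (hmono : Monotone ℱ)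
    (hle : ∀ k, ℱ k ≤ m₀) {X : Ω → ℝ} (hX : AEStronglyMeasurable X P) {B : ℝ}
    (hB : ∀ ω, |X ω| ≤ B) {c : ℝ} (hc : 0 < c) {n : ℕ}
    (hdiff : ∀ k, ∀ᵐ ω ∂P, |(P[X|ℱ (k + 1)]) ω - (P[X|ℱ k]) ω| ≤ c)
    (h0 : P[X|ℱ 0] =ᵐ[P] fun _ => ∫ ω, X ω ∂P) (hn : P[X|ℱ n] =ᵐ[P] X) (θ : ℝ) :
    ∫ ω, Real.exp (θ * (X ω - ∫ ω, X ω ∂P)) ∂P ≤ Real.exp (n * ((θ * c) ^ 2 / 2)) := by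
  have hXB : ∀ᵐ ω ∂P, |X ω| ≤ |B| := Eventually.of_forall fun ω => (hB ω).trans (le_abs_self B)
  have hXint : Integrable X P := integrable_of_abs_le hX hXB
  set μ := ∫ ω, X ω ∂P with hμ
  set Y : ℕ → Ω → ℝ := fun k ω => Real.exp (θ * ((P[X|ℱ k]) ω - μ)) with hY
  have hYm : ∀ k, StronglyMeasurable[ℱ k] (Y k) := by
    intro k
    have : StronglyMeasurable[ℱ k] fun ω => θ * ((P[X|ℱ k]) ω - μ) :=
      (stronglyMeasurable_condExp.sub stronglyMeasurable_const).const_mul θ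
    exact Real.continuous_exp.comp_stronglyMeasurable this
  have hYb : ∀ k, ∀ᵐ ω ∂P, |Y k ω| ≤ Real.exp (|θ| * (|B| + |μ|)) := by
    intro k
    filter_upwards [ae_bdd_abs_condExp_of_ae_bdd_abs (m := ℱ k) hXB] with ω hω
    rw [Real.abs_exp, Real.exp_le_exp]
    refine (le_abs_self _).trans ?_
    rw [abs_mul]
    gcongr
    exact (abs_sub _ _).trans (by linarith)
  have hYint : ∀ k, Integrable (Y k) P := fun k =>
    integrable_of_abs_le ((hYm k).mono (hle k)).aestronglyMeasurable (hYb k)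
  have hprod : ∀ k {V : Ω → ℝ}, Integrable V P → Integrable (fun ω => Y k ω * V ω) P :=
    fun k V hV => hV.bdd_mul ((hYm k).mono (hle k)).aestronglyMeasurable (hYb k)
  have hmain : ∀ k, ∫ ω, Y k ω ∂P ≤ Real.exp (k * ((θ * c) ^ 2 / 2)) := by
    intro k
    induction k with
    | zero =>
      have : ∫ ω, Y 0 ω ∂P = ∫ _, (1 : ℝ) ∂P := by
        refine integral_congr_ae (h0.mono fun ω hω => ?_)
        simp [hY, hω]
      rw [this]
      simp
    | succ k ih =>
      -- The increment of the Doob martingale is orthogonal to every integrable factor known at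
      -- stage `k`.
      have e1 : ∫ ω, Y k ω * ((P[X|ℱ (k + 1)]) ω - (P[X|ℱ k]) ω) ∂P = 0 := by
        simp only [mul_sub]
        rw [integral_sub (hprod k integrable_condExp) (hprod k integrable_condExp),
          integral_mul_condExp_of_stronglyMeasurable (hle (k + 1))
            ((hYm k).mono (hmono k.le_succ)) (hprod k hXint) hXint,
          integral_mul_condExp_of_stronglyMeasurable (hle k) (hYm k) (hprod k hXint) hXint,
          sub_self]
      have hdint : Integrable (fun ω => (P[X|ℱ (k + 1)]) ω - (P[X|ℱ k]) ω) P :=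
        integrable_condExp.sub integrable_condExp
      have e2 : ∫ ω, Y (k + 1) ω ∂P ≤ ∫ ω, (Y k ω * Real.cosh (θ * c) +
          Y k ω * ((P[X|ℱ (k + 1)]) ω - (P[X|ℱ k]) ω) * (Real.sinh (θ * c) / c)) ∂P := by
        refine integral_mono_ae (hYint (k + 1))
          (((hYint k).mul_const _).add ((hprod k hdint).mul_const _)) ?_
        filter_upwards [hdiff k] with ω hω
        have h1 := exp_mul_le_cosh_add (θ := θ) hc hω
        have h2 : Y (k + 1) ω = Y k ω *
            Real.exp (θ * ((P[X|ℱ (k + 1)]) ω - (P[X|ℱ k]) ω)) := by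
          simp only [hY]
          rw [← Real.exp_add]
          congr 1
          ring
        rw [h2]
        have h3 : 0 < Y k ω := Real.exp_pos _
        nlinarith
      rw [integral_add ((hYint k).mul_const _) ((hprod k hdint).mul_const _),
        integral_mul_const, integral_mul_const, e1, zero_mul, add_zero] at e2
      calc ∫ ω, Y (k + 1) ω ∂P ≤ (∫ ω, Y k ω ∂P) * Real.cosh (θ * c) := e2
        _ ≤ Real.exp (k * ((θ * c) ^ 2 / 2)) * Real.exp ((θ * c) ^ 2 / 2) := by
          have := Real.cosh_le_exp_half_sq (θ * c)
          have := Real.cosh_pos (θ * c)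
          gcongr
        _ = Real.exp ((k + 1 : ℕ) * ((θ * c) ^ 2 / 2)) := by
          rw [← Real.exp_add]
          congr 1
          push_cast
          ring
  refine le_of_eq_of_le ?_ (hmain n)
  refine integral_congr_ae (hn.mono fun ω hω => ?_)
  simp [hY, hω]

end

/-! ### The min-max functional -/

/-- The lower value functional `min_b max_a`. -/
noncomputable def minmax {A B : Type*} (φ : A × B → ℝ) : ℝ := ⨅ b, ⨆ a, φ (a, b)

section

variable {A B : Type*}

theorem bddAbove_range_of_abs_le {φ : A × B → ℝ} {D : ℝ} (h : ∀ i, |φ i| ≤ D) (b : B) :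
    BddAbove (range fun a => φ (a, b)) :=
  ⟨D, by rintro _ ⟨a, rfl⟩; exact (abs_le.1 (h (a, b))).2⟩

theorem bddBelow_range_iSup_of_abs_le [Nonempty A] {φ : A × B → ℝ} {D : ℝ}
    (h : ∀ i, |φ i| ≤ D) : BddBelow (range fun b => ⨆ a, φ (a, b)) := by
  refine ⟨-D, ?_⟩
  rintro _ ⟨b, rfl⟩
  exact (abs_le.1 (h (Classical.arbitrary A, b))).1.trans
    (le_ciSup (bddAbove_range_of_abs_le h b) _)

theorem minmax_mono [Nonempty A] [Nonempty B] (φ ψ : A × B → ℝ) (c : ℝ)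
    (hφ : ∃ D, ∀ i, |φ i| ≤ D) (hψ : ∃ D, ∀ i, |ψ i| ≤ D) (h : ∀ i, φ i ≤ ψ i + c) :
    minmax φ ≤ minmax ψ + c := by
  obtain ⟨D, hD⟩ := hφ
  obtain ⟨D', hD'⟩ := hψ
  rw [← sub_le_iff_le_add]
  refine le_ciInf fun b => ?_
  rw [sub_le_iff_le_add]
  refine (ciInf_le (bddBelow_range_iSup_of_abs_le hD) b).trans (ciSup_le fun a => ?_)
  have := le_ciSup (bddAbove_range_of_abs_le hD' b) a
  linarith [h (a, b)]

theorem minmax_smul (φ : A × B → ℝ) (c : ℝ) (hc : 0 ≤ c) :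
    minmax (fun i => c * φ i) = c * minmax φ := by
  simp only [minmax, Real.mul_iInf_of_nonneg hc, Real.mul_iSup_of_nonneg hc]

variable [TopologicalSpace A] [TopologicalSpace B]

theorem ciSup_denseSeq [Nonempty A] [TopologicalSpace.SeparableSpace A] {k : A → ℝ}
    (hk : Continuous k) (hb : BddAbove (range k)) :
    ⨆ a, k a = ⨆ n, k (TopologicalSpace.denseSeq A n) := by
  have hb' : BddAbove (range fun n => k (TopologicalSpace.denseSeq A n)) :=
    hb.mono (by rintro _ ⟨n, rfl⟩; exact ⟨_, rfl⟩)
  refine le_antisymm (ciSup_le fun a => ?_) (ciSup_le fun n => le_ciSup hb _)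
  have hcl : IsClosed {a | k a ≤ ⨆ n, k (TopologicalSpace.denseSeq A n)} :=
    isClosed_le hk continuous_const
  exact (TopologicalSpace.denseRange_denseSeq A).induction_on a hcl fun n => le_ciSup hb' n

theorem ciInf_denseSeq [Nonempty B] [TopologicalSpace.SeparableSpace B] {k : B → ℝ}
    (hk : Continuous k) (hb : BddBelow (range k)) :
    ⨅ a, k a = ⨅ n, k (TopologicalSpace.denseSeq B n) := by
  have hb' : BddBelow (range fun n => k (TopologicalSpace.denseSeq B n)) :=
    hb.mono (by rintro _ ⟨n, rfl⟩; exact ⟨_, rfl⟩)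
  refine le_antisymm (le_ciInf fun n => ciInf_le hb _) (le_ciInf fun a => ?_)
  have hcl : IsClosed {a | ⨅ n, k (TopologicalSpace.denseSeq B n) ≤ k a} :=
    isClosed_le continuous_const hk
  exact (TopologicalSpace.denseRange_denseSeq B).induction_on a hcl fun n => ciInf_le hb' n

/-- Compactness of `A` makes the inner supremum continuous in `b`, so both extrema may be taken
along dense sequences and become countable. -/
theorem measurable_minmax [CompactSpace A] [CompactSpace B] [Nonempty A] [Nonempty B]
    [TopologicalSpace.SeparableSpace A] [TopologicalSpace.SeparableSpace B]
    {Ω : Type*} [MeasurableSpace Ω] {Φ : A × B → Ω → ℝ} (hc : ∀ ω, Continuous fun i => Φ i ω)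
    (hm : ∀ i, Measurable (Φ i)) : Measurable fun ω => minmax fun i => Φ i ω := by
  have hb : ∀ ω, ∃ D, ∀ i, |Φ i ω| ≤ D := fun ω => by
    obtain ⟨D, hD⟩ := isCompact_univ.exists_bound_of_continuousOn (hc ω).continuousOn
    exact ⟨D, fun i => hD i trivial⟩
  have e : (fun ω => minmax fun i => Φ i ω) = fun ω =>
      ⨅ n, ⨆ k, Φ (TopologicalSpace.denseSeq A k, TopologicalSpace.denseSeq B n) ω := by
    ext ω
    obtain ⟨D, hD⟩ := hb ω
    have h1 : ∀ b, ⨆ a, Φ (a, b) ω = ⨆ k, Φ (TopologicalSpace.denseSeq A k, b) ω := fun b =>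
      ciSup_denseSeq (k := fun a => Φ (a, b) ω) ((hc ω).comp (by fun_prop))
        (bddAbove_range_of_abs_le (φ := fun i => Φ i ω) hD b)
    have hcont : Continuous fun b => ⨆ a, Φ (a, b) ω := by
      have := IsCompact.continuous_sSup (f := fun b a => Φ (a, b) ω) (isCompact_univ (X := A))
        ((hc ω).comp continuous_swap)
      simpa only [image_univ, sSup_range] using this
    have h2 := ciInf_denseSeq hcont (bddBelow_range_iSup_of_abs_le (φ := fun i => Φ i ω) hD)
    simp only [minmax]
    rw [h2]
    exact iInf_congr fun n => h1 _
  rw [e]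
  exact Measurable.iInf fun n => Measurable.iSup fun k => hm _

end

/-! ### Regularity of the discrete value -/

section

variable {d : ℕ} {I : Type*} {M : (I → ℝ) → ℝ} {f : I → Euc d} {ℓ ℓ' : Euc d → I → ℝ}
  {F C L C' L' : ℝ}

theorem IsGame.abs_iterate_zero_le (G : IsGame M f ℓ F C L) {h : ℝ} (hh : 0 ≤ h) (k : ℕ)
    (x : Euc d) : |(gameStep M f ℓ h)^[k] (fun _ => 0) x| ≤ k * h * C := by
  have key : ∀ {M : (I → ℝ) → ℝ} {ℓ : Euc d → I → ℝ}, IsGame M f ℓ F C L →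
      (gameStep M f ℓ h)^[k] (fun _ => 0) x ≤ k * h * C := fun G => by
    simpa using G.iterate_le_affine linBdd_zero hh (x := x) (p := 0) (a := 0) (Λ := C)
      (r := k * h * F) (fun y _ => G.neg_ham_zero_le y) (by simp) k x (by simp)
  have h1 := key G
  have h2 := key G.dual
  have h3 := congrFun (gameStep_iterate_dual (M := M) (f := f) (ℓ := ℓ) h (fun _ => 0) k) x
  simp only [neg_zero] at h3
  rw [h3] at h2
  exact abs_le.2 ⟨by linarith, h1⟩

/-- Moving the starting point amounts to translating the environment, which changes the cost by at
most L |x - y| per unit of time. -/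
theorem IsGame.iterate_zero_lip (G : IsGame M f ℓ F C L) {h : ℝ} (hh : 0 ≤ h) (k : ℕ)
    (x y : Euc d) : |(gameStep M f ℓ h)^[k] (fun _ => 0) x -
      (gameStep M f ℓ h)^[k] (fun _ => 0) y| ≤ k * h * L * ‖x - y‖ := by
  have key : ∀ x y, (gameStep M f ℓ h)^[k] (fun _ => 0) x ≤
      (gameStep M f ℓ h)^[k] (fun _ => 0) y + k * h * L * ‖x - y‖ := by
    intro x y
    have := G.iterate_le_iterate G linBdd_zero linBdd_zero hh (x := y) (c := 0) (r := k * h * F)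
      (e := L * ‖x - y‖) (x - y) (fun w i => by
        have := (abs_le.1 (G.lip (w + (x - y)) w i)).2
        rw [add_sub_cancel_left] at this
        linarith) (by simp) k y (by simp)
    rw [add_sub_cancel] at this
    linarith
  have h1 := key x y
  have h2 := key y x
  rw [norm_sub_rev] at h2
  exact abs_le.2 ⟨by linarith, by linarith⟩

/-- Changing the running cost in a slab orthogonal to the direction of motion changes the value by
at most the time needed to cross the slab. -/
theorem IsGame.iterate_le_of_eq_off_slab (G : IsGame M f ℓ F C L) (G' : IsGame M f ℓ' F C' L')
    {e : Euc d} {δ : ℝ} (hδ : 0 < δ) (hfe : ∀ i, δ ≤ inner ℝ (f i) e) {a b D : ℝ} (hab : a ≤ b)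
    (hD : 0 ≤ D) (heq : ∀ x i, (inner ℝ x e ≤ a ∨ b ≤ inner ℝ x e) → ℓ x i = ℓ' x i)
    (hle : ∀ x i, ℓ x i ≤ ℓ' x i + D) {h : ℝ} (hh : 0 ≤ h) (k : ℕ) :
    ∀ x, (gameStep M f ℓ h)^[k] (fun _ => 0) x ≤ (gameStep M f ℓ' h)^[k] (fun _ => 0) x +
      D / δ * (b - a + h * δ) := by
  have hDδ : 0 ≤ D / δ := by positivity
  -- Φ is `D` times an upper bound for the time still to be spent in the slab, with one step h δ of
  -- overshoot. A step inside the slab advances by at least h δ and lowers Φ by at least h D,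
  -- exactly the cost discrepancy; outside the slab Φ need only be nonincreasing.
  set Φ : ℝ → ℝ := fun s => D / δ * max 0 (min (b + h * δ - s) (b - a + h * δ)) with hΦ
  have hanti : ∀ s s', s ≤ s' → Φ s' ≤ Φ s := by
    intro s s' hs
    simp only [hΦ]
    gcongr
  have hmain : ∀ k x, (gameStep M f ℓ h)^[k] (fun _ => 0) x ≤
      (gameStep M f ℓ' h)^[k] (fun _ => 0) x + Φ (inner ℝ x e) := by
    intro k
    induction k with
    | zero => intro x; simp only [Function.iterate_zero, id, zero_add, hΦ]; positivity
    | succ k ih =>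
      intro x
      rw [Function.iterate_succ_apply', Function.iterate_succ_apply']
      refine G.mono _ _ _ (G.bdd_payoff (G.linBdd_iterate linBdd_zero h k) h x)
        (G'.bdd_payoff (G'.linBdd_iterate linBdd_zero h k) h x) fun i => ?_
      have h1 := ih (x + h • f i)
      rw [inner_add_left, inner_smul_left] at h1
      simp only [conj_trivial] at h1
      set s := (inner ℝ x e : ℝ) with hs
      have h2 := hanti (s + h * δ) (s + h * inner ℝ (f i) e)
        (by have := mul_le_mul_of_nonneg_left (hfe i) hh; linarith)
      by_cases hin : s ≤ a ∨ b ≤ s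
      · rw [heq x i hin]
        have h3 := hanti s (s + h * δ) (by have := mul_nonneg hh hδ.le; linarith)
        linarith
      · push Not at hin
        have h3 := mul_le_mul_of_nonneg_left (hle x i) hh
        have h4 : Φ (s + h * δ) ≤ D / δ * (b - s) := by
          simp only [hΦ]
          gcongr
          refine max_le (by linarith) ((min_le_left _ _).trans (by linarith))
        have h5 : D / δ * (b + h * δ - s) ≤ Φ s := by
          simp only [hΦ]
          gcongr
          exact le_max_of_le_right (le_min le_rfl (by linarith))
        have h6 : D / δ * (b + h * δ - s) = D / δ * (b - s) + h * D := by
          field_simp; ring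
        linarith
  intro x
  refine (hmain k x).trans ?_
  have : Φ (inner ℝ x e) ≤ D / δ * (b - a + h * δ) := by
    simp only [hΦ]
    gcongr
    exact max_le (by have := mul_nonneg hh hδ.le; linarith) (min_le_right _ _)
  linarith

end

/-! ### Cutting off the environment in a slab -/

/-- A Lipschitz cutoff which vanishes for `|s - s₀| ≤ ρ` and is one for `|s - s₀| ≥ 2 ρ`. -/
noncomputable def slabCutoff (ρ s₀ s : ℝ) : ℝ := max 0 (min 1 (|s - s₀| / ρ - 1))

theorem slabCutoff_nonneg (ρ s₀ s : ℝ) : 0 ≤ slabCutoff ρ s₀ s := le_max_left _ _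

theorem slabCutoff_le_one (ρ s₀ s : ℝ) : slabCutoff ρ s₀ s ≤ 1 :=
  max_le zero_le_one (min_le_left _ _)

theorem slabCutoff_eq_zero {ρ s₀ s : ℝ} (hρ : 0 < ρ) (h : |s - s₀| ≤ ρ) :
    slabCutoff ρ s₀ s = 0 := by
  refine max_eq_left ((min_le_right _ _).trans ?_)
  rw [sub_nonpos, div_le_one hρ]
  exact h

theorem slabCutoff_eq_one {ρ s₀ s : ℝ} (hρ : 0 < ρ) (h : 2 * ρ ≤ |s - s₀|) :
    slabCutoff ρ s₀ s = 1 := by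
  have : 1 ≤ |s - s₀| / ρ - 1 := by
    rw [le_sub_iff_add_le, le_div_iff₀ hρ]
    linarith
  rw [slabCutoff, min_eq_left this, max_eq_right zero_le_one]

theorem slabCutoff_lip {ρ : ℝ} (hρ : 0 < ρ) (s₀ s s' : ℝ) :
    |slabCutoff ρ s₀ s - slabCutoff ρ s₀ s'| ≤ |s - s'| / ρ := by
  have h1 : |(|s - s₀| / ρ - 1) - (|s' - s₀| / ρ - 1)| ≤ |s - s'| / ρ := by
    rw [show (|s - s₀| / ρ - 1) - (|s' - s₀| / ρ - 1) = (|s - s₀| - |s' - s₀|) / ρ by ring,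
      abs_div, abs_of_pos hρ]
    refine div_le_div_of_nonneg_right ?_ hρ.le
    refine (abs_abs_sub_abs_le_abs_sub (s - s₀) (s' - s₀)).trans (le_of_eq ?_)
    congr 1; ring
  refine le_trans ?_ h1
  simp only [slabCutoff]
  refine (abs_max_sub_max_le_max _ _ _ _).trans (max_le (by simp) ?_)
  exact (abs_min_sub_min_le_max _ _ _ _).trans (max_le (by simp) le_rfl)

/-- The running cost cut off in a slab. -/
noncomputable def slabCost {d : ℕ} {I Ω : Type*} (ℓ : Euc d → I → Ω → ℝ) (e : Euc d) (ρ s₀ : ℝ) (x : Euc d)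
    (i : I) (ω : Ω) : ℝ :=
  slabCutoff ρ s₀ (inner ℝ x e) * ℓ x i ω

theorem isGame_slabCost {d : ℕ} {I Ω : Type*} {M : (I → ℝ) → ℝ} {f : I → Euc d}
    {ℓ : Euc d → I → Ω → ℝ} {F C L : ℝ} {ω : Ω} (G : IsGame M f (fun x i => ℓ x i ω) F C L) {e : Euc d}
    (he : ‖e‖ = 1) {ρ : ℝ} (hρ : 0 < ρ) (s₀ : ℝ) :
    IsGame M f (fun x i => slabCost ℓ e ρ s₀ x i ω) F C (L + C / ρ) where
  mono := G.mono
  smul := G.smul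
  F_pos := G.F_pos
  C_nonneg := G.C_nonneg
  L_nonneg := by have := G.L_nonneg; have := G.C_nonneg; positivity
  speed := G.speed
  bdd x i := by
    rw [slabCost, abs_mul, abs_of_nonneg (slabCutoff_nonneg _ _ _)]
    have h1 := G.bdd x i
    have h2 := slabCutoff_le_one ρ s₀ (inner ℝ x e)
    have h3 := slabCutoff_nonneg ρ s₀ (inner ℝ x e)
    nlinarith [abs_nonneg (ℓ x i ω)]
  lip x y i := by
    have h1 := slabCutoff_lip hρ s₀ (inner ℝ x e) (inner ℝ y e)
    have h2 : |(inner ℝ x e : ℝ) - inner ℝ y e| ≤ ‖x - y‖ := by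
      rw [← inner_sub_left]
      simpa [he] using abs_real_inner_le_norm (x - y) e
    have h3 : |(inner ℝ x e : ℝ) - inner ℝ y e| / ρ ≤ ‖x - y‖ / ρ := by gcongr
    have h4 := G.lip x y i
    have h5 := G.bdd y i
    have h6 := slabCutoff_le_one ρ s₀ (inner ℝ x e)
    have h7 := slabCutoff_nonneg ρ s₀ (inner ℝ x e)
    have hC := G.C_nonneg
    have hL := G.L_nonneg
    simp only [slabCost]
    calc |slabCutoff ρ s₀ (inner ℝ x e) * ℓ x i ω - slabCutoff ρ s₀ (inner ℝ y e) * ℓ y i ω|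
        = |slabCutoff ρ s₀ (inner ℝ x e) * (ℓ x i ω - ℓ y i ω) +
          (slabCutoff ρ s₀ (inner ℝ x e) - slabCutoff ρ s₀ (inner ℝ y e)) * ℓ y i ω| := by
          congr 1; ring
      _ ≤ 1 * (L * ‖x - y‖) + ‖x - y‖ / ρ * C := by
          refine (abs_add_le _ _).trans ?_
          rw [abs_mul, abs_mul, abs_of_nonneg h7]
          gcongr
          exact h1.trans h3
      _ = (L + C / ρ) * ‖x - y‖ := by ring

/-! ### Concentration of the discrete value -/

section

variable {d : ℕ} {Ω A B : Type*} [TopologicalSpace A] [TopologicalSpace B] [CompactSpace A]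
  [CompactSpace B] [Nonempty A] [Nonempty B] [TopologicalSpace.SeparableSpace A]
  [TopologicalSpace.SeparableSpace B] {f : A × B → Euc d} {ℓ : Euc d → A × B → Ω → ℝ}
  {F C L : ℝ}

/-- The value of the discrete game with zero terminal payoff, `k` steps of size `h`. -/
noncomputable def discreteValue (f : A × B → Euc d) (ℓ : Euc d → A × B → Ω → ℝ) (h : ℝ) (k : ℕ)
    (x : Euc d) (ω : Ω) : ℝ :=
  (gameStep minmax f (fun x i => ℓ x i ω) h)^[k] (fun _ => 0) x

/-- `U k` stands for the positions allowed when `k` steps remain. Measurability of the cost is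
required only where it is read, so the σ-algebra may be the one generated by the environment in the
region the game can visit. -/
theorem measurable_discreteValue [MeasurableSpace Ω] (hf : Continuous f)
    (hG : ∀ ω, IsGame minmax f (fun x i => ℓ x i ω) F C L)
    (hcont : ∀ x ω, Continuous fun i => ℓ x i ω) {h : ℝ} (hh : 0 ≤ h) (U : ℕ → Set (Euc d))
    (hU : ∀ k x, x ∈ U (k + 1) → ∀ i, x + h • f i ∈ U k)
    (hm : ∀ k x, x ∈ U (k + 1) → ∀ i, Measurable (ℓ x i)) (k : ℕ) :
    ∀ x ∈ U k, Measurable (discreteValue f ℓ h k x) := by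
  induction k with
  | zero => intro x _; exact measurable_const
  | succ k ih =>
    intro x hx
    have e : discreteValue f ℓ h (k + 1) x = fun ω => minmax fun i =>
        discreteValue f ℓ h k (x + h • f i) ω + h * ℓ x i ω := by
      ext ω
      simp only [discreteValue]
      rw [Function.iterate_succ_apply']
      rfl
    rw [e]
    refine measurable_minmax (fun ω => ?_) fun i =>
      (ih _ (hU k x hx i)).add ((hm k x hx i).const_mul h)
    have hlip : Continuous fun y => discreteValue f ℓ h k y ω := by
      have h0 : 0 ≤ (k : ℝ) * h * L := by have := (hG ω).L_nonneg; positivity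
      exact (LipschitzWith.of_dist_le_mul (K := ⟨_, h0⟩) fun y z => by
        rw [Real.dist_eq, dist_eq_norm]
        exact (hG ω).iterate_zero_lip hh k y z).continuous
    exact (hlip.comp (by fun_prop)).add (continuous_const.mul (hcont x ω))

theorem measurable_generatedSigma {ι : Type*} {X : ι → Euc d → Ω → ℝ} {S : Set (Euc d)} {x : Euc d}
    (hx : x ∈ S) (i : ι) : Measurable[generatedSigma X S] (X i x) := by
  refine Measurable.of_comap_le ?_
  exact le_iSup_of_le i (le_iSup_of_le x (le_iSup_of_le hx le_rfl))

theorem generatedSigma_mono {ι : Type*} {X : ι → Euc d → Ω → ℝ} {S S' : Set (Euc d)}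
    (h : S ⊆ S') : generatedSigma X S ≤ generatedSigma X S' :=
  iSup_mono fun _ => iSup_mono fun _ => iSup_le fun hx => le_iSup_of_le (h hx) le_rfl

theorem generatedSigma_le {ι : Type*} [m₀ : MeasurableSpace Ω] {X : ι → Euc d → Ω → ℝ}
    (hX : ∀ i x, Measurable (X i x)) (S : Set (Euc d)) : generatedSigma X S ≤ m₀ :=
  iSup_le fun i => iSup_le fun x => iSup_le fun _ => (hX i x).comap_le

/-- The Doob martingale reveals the environment in the half-spaces ⟨x, e⟩ ≤ (j - 1) ρ. Erasing the
cost around ⟨x, e⟩ = j ρ changes the value by at most `c`, and the modified value has the same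
conditional expectation at stages j and j + 1. The martingale increments are therefore bounded by 2
c. The constant is uniform in the time step. -/
theorem exists_mgf_bound [m₀ : MeasurableSpace Ω] {P : Measure Ω} [IsProbabilityMeasure P]
    (hf : Continuous f) (hG : ∀ ω, IsGame minmax f (fun x i => ℓ x i ω) F C L)
    (hcont : ∀ x ω, Continuous fun i => ℓ x i ω) (hm : ∀ x i, Measurable (ℓ x i))
    (hind : LongRangeIndependent P fun i x ω => ℓ x i ω) {e : Euc d} {δ : ℝ} (he : ‖e‖ = 1)
    (hδ : 0 < δ) (hfe : ∀ i, δ ≤ inner ℝ (f i) e) :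
    ∃ K, 0 < K ∧ ∀ h, 0 < h → h ≤ 1 → ∀ (k : ℕ) (θ : ℝ),
      ∫ ω, Real.exp (θ * (discreteValue f ℓ h k 0 ω - ∫ ω, discreteValue f ℓ h k 0 ω ∂P)) ∂P ≤
        Real.exp (K * θ ^ 2 * (k * h + 1)) := by
  obtain ⟨ρ, hρ, hind⟩ := hind
  obtain ⟨ω₀⟩ : Nonempty Ω := nonempty_of_isProbabilityMeasure P
  have hF := (hG ω₀).F_pos
  have hC := (hG ω₀).C_nonneg
  -- Erasing a cost changes it by at most `C`; the extra 1 only makes the increment bound positive.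
  -- In `c`, 4 ρ is the width of the slab and δ bounds the overshoot h δ, since h ≤ 1.
  set D := C + 1 with hD
  set c := D / δ * (4 * ρ + δ) with hc
  have hcpos : 0 < c := by positivity
  refine ⟨(F / ρ + 2) * (2 * c) ^ 2 / 2, by positivity, fun h hh hh1 k θ => ?_⟩
  set X : A × B → Euc d → Ω → ℝ := fun i x ω => ℓ x i ω with hX
  have hXm : ∀ i x, Measurable (X i x) := fun i x => hm x i
  set past : ℕ → Set (Euc d) := fun j => {x | inner ℝ x e ≤ ((j : ℝ) - 1) * ρ} with hpast
  set future : ℕ → Set (Euc d) := fun j => {x | (j : ℝ) * ρ ≤ inner ℝ x e} with hfut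
  set ℱ : ℕ → MeasurableSpace Ω := fun j => generatedSigma X (past j) with hℱ
  have hℱle : ∀ j, ℱ j ≤ m₀ := fun j => generatedSigma_le hXm _
  have hindep : ∀ j, Indep (ℱ j) (generatedSigma X (future j)) P := by
    intro j
    refine hind _ _ fun x hx y hy => ?_
    have h1 : (inner ℝ (y - x) e : ℝ) ≤ ‖y - x‖ := by
      simpa [he] using real_inner_le_norm (y - x) e
    rw [inner_sub_left] at h1
    rw [dist_comm, dist_eq_norm]
    have h2 : (inner ℝ x e : ℝ) ≤ ((j : ℝ) - 1) * ρ := hx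
    have h3 : (j : ℝ) * ρ ≤ inner ℝ y e := hy
    linarith
  set V := discreteValue f ℓ h k 0 with hV
  have hVb : ∀ ω, |V ω| ≤ k * h * C := fun ω => (hG ω).abs_iterate_zero_le hh.le k 0
  have hmove : ∀ (x : Euc d) i, (inner ℝ (x + h • f i) e : ℝ) =
      inner ℝ x e + h * inner ℝ (f i) e := by
    intro x i
    rw [inner_add_left, inner_smul_left]
    simp
  have hVm : ∀ m : MeasurableSpace Ω, ∀ U : ℕ → Set (Euc d),
      (∀ k x, x ∈ U (k + 1) → ∀ i, x + h • f i ∈ U k) →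
      (∀ k x, x ∈ U (k + 1) → ∀ i, Measurable[m] (ℓ x i)) → (0 : Euc d) ∈ U k →
      Measurable[m] V := fun m U h1 h2 h3 =>
    measurable_discreteValue hf hG hcont hh.le U h1 h2 k 0 h3
  have hV0 : Measurable V := hVm m₀ (fun _ => univ) (by simp) (fun _ x _ i => hm x i) trivial
  -- From the origin the game reaches at most ⟨x, e⟩ = k h F ≤ (n - 1) ρ, so at stage `n` the value
  -- is fully revealed.
  set n := ⌈k * h * F / ρ⌉₊ + 1 with hn
  have hnle : (n : ℝ) ≤ (F / ρ + 2) * (k * h + 1) := by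
    have h1 := Nat.ceil_lt_add_one (show 0 ≤ k * h * F / ρ by positivity)
    have h2 : k * h * F / ρ = F / ρ * (k * h) := by ring
    have h3 : 0 ≤ F / ρ := by positivity
    have h4 : 0 ≤ (k : ℝ) * h := by positivity
    rw [hn]
    push_cast
    nlinarith
  have hmain := integral_exp_le_of_bounded_differences (P := P) (ℱ := ℱ) (X := V) (B := k * h * C)
    (c := 2 * c) (n := n) ?_ hℱle hV0.aestronglyMeasurable hVb (by positivity) ?_ ?_ ?_ θ
  · refine hmain.trans (Real.exp_le_exp.2 ?_)
    have h1 : 0 ≤ (θ * (2 * c)) ^ 2 / 2 := by positivity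
    have h2 := mul_le_mul_of_nonneg_right hnle h1
    refine h2.trans (le_of_eq ?_)
    ring
  · intro j j' hjj
    refine generatedSigma_mono fun x hx => ?_
    have h1 : (inner ℝ x e : ℝ) ≤ ((j : ℝ) - 1) * ρ := hx
    refine h1.trans ?_
    have : (j : ℝ) ≤ j' := by exact_mod_cast hjj
    gcongr
  · intro j
    set V' := discreteValue f (slabCost ℓ e ρ (j * ρ)) h k 0 with hV'
    have hG' : ∀ ω, IsGame minmax f (fun x i => slabCost ℓ e ρ (j * ρ) x i ω) F C (L + C / ρ) :=
      fun ω => isGame_slabCost (hG ω) he hρ _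
    have hV'b : ∀ ω, |V' ω| ≤ k * h * C := fun ω => (hG' ω).abs_iterate_zero_le hh.le k 0
    -- The erased band |⟨x, e⟩ - j ρ| ≤ ρ is exactly the gap between the past at stage j and the
    -- future at stage j + 1, and that future is independent of `ℱ (j + 1)`.
    have hV'm : Measurable[ℱ j ⊔ generatedSigma X (future (j + 1))] V' := by
      refine @measurable_discreteValue d Ω A B _ _ _ _ _ _ _ _ f (slabCost ℓ e ρ (j * ρ)) F C _
        (_) hf hG' (fun x ω => continuous_const.mul (hcont x ω)) h hh.le
        (fun _ => univ) (by simp) (fun _ x _ i => ?_) k 0 trivial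
      rcases le_or_gt |(inner ℝ x e : ℝ) - j * ρ| ρ with hx | hx
      · have : slabCost ℓ e ρ (j * ρ) x i = fun _ => 0 := by
          ext ω
          rw [slabCost, slabCutoff_eq_zero hρ hx, zero_mul]
        rw [this]
        exact measurable_const
      · have h1 : Measurable[ℱ j ⊔ generatedSigma X (future (j + 1))] (ℓ x i) := by
          rcases lt_abs.1 hx with h2 | h2
          · refine (measurable_generatedSigma (X := X) (S := future (j + 1)) ?_ i).mono
              le_sup_right le_rfl
            change ((j + 1 : ℕ) : ℝ) * ρ ≤ inner ℝ x e
            push_cast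
            linarith
          · refine (measurable_generatedSigma (X := X) (S := past j) ?_ i).mono
              le_sup_left le_rfl
            change (inner ℝ x e : ℝ) ≤ ((j : ℝ) - 1) * ρ
            linarith
        exact h1.const_mul _
    have hsup : ℱ j ⊔ generatedSigma X (future (j + 1)) ≤ m₀ :=
      sup_le (hℱle j) (generatedSigma_le hXm _)
    have hV'0 : Measurable V' := hV'm.mono hsup le_rfl
    have hmono : ℱ j ≤ ℱ (j + 1) := by
      refine generatedSigma_mono fun x hx => ?_
      have h1 : (inner ℝ x e : ℝ) ≤ ((j : ℝ) - 1) * ρ := hx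
      change (inner ℝ x e : ℝ) ≤ (((j + 1 : ℕ) : ℝ) - 1) * ρ
      push_cast
      nlinarith
    have hcond := condExp_eq_of_indep_sup hmono (hℱle (j + 1)) (generatedSigma_le hXm _)
      (hindep (j + 1)) hV'm.stronglyMeasurable hV'b
    have hclose : ∀ ω, |V ω - V' ω| ≤ c := by
      intro ω
      have hch : D / δ * (((j : ℝ) + 2) * ρ - ((j : ℝ) - 2) * ρ + h * δ) ≤ c := by
        rw [hc]
        refine mul_le_mul_of_nonneg_left ?_ (by positivity)
        nlinarith
      have heq : ∀ x i, ((inner ℝ x e : ℝ) ≤ ((j : ℝ) - 2) * ρ ∨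
          ((j : ℝ) + 2) * ρ ≤ inner ℝ x e) → ℓ x i ω = slabCost ℓ e ρ (j * ρ) x i ω := by
        intro x i hx
        rw [slabCost, slabCutoff_eq_one hρ, one_mul]
        rcases hx with hx | hx
        · exact le_abs.2 (Or.inr (by linarith))
        · exact le_abs.2 (Or.inl (by linarith))
      have hle : ∀ x i, |ℓ x i ω - slabCost ℓ e ρ (j * ρ) x i ω| ≤ D := by
        intro x i
        rw [slabCost, show ℓ x i ω - slabCutoff ρ (j * ρ) (inner ℝ x e) * ℓ x i ω =
          (1 - slabCutoff ρ (j * ρ) (inner ℝ x e)) * ℓ x i ω by ring, abs_mul]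
        have h1 := slabCutoff_nonneg ρ (j * ρ) (inner ℝ x e)
        have h2 := slabCutoff_le_one ρ (j * ρ) (inner ℝ x e)
        have h3 := (hG ω).bdd x i
        rw [abs_of_nonneg (by linarith)]
        nlinarith [abs_nonneg (ℓ x i ω)]
      have hab : ((j : ℝ) - 2) * ρ ≤ ((j : ℝ) + 2) * ρ := by gcongr; linarith
      have h1 := (hG ω).iterate_le_of_eq_off_slab (hG' ω) hδ hfe hab (D := D) (by positivity) heq
        (fun x i => by linarith [(abs_le.1 (hle x i)).2]) hh.le k 0
      have h2 := (hG' ω).iterate_le_of_eq_off_slab (hG ω) hδ hfe hab (D := D) (by positivity)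
        (fun x i hx => (heq x i hx).symm)
        (fun x i => by linarith [(abs_le.1 (hle x i)).1]) hh.le k 0
      rw [abs_le]
      simp only [hV, hV', discreteValue]
      constructor <;> linarith
    have hVint : Integrable V P :=
      integrable_of_abs_le hV0.aestronglyMeasurable (Eventually.of_forall hVb)
    have hV'int : Integrable V' P :=
      integrable_of_abs_le hV'0.aestronglyMeasurable (Eventually.of_forall hV'b)
    have hce : ∀ m : MeasurableSpace Ω, ∀ᵐ ω ∂P, |(P[V|m]) ω - (P[V'|m]) ω| ≤ c := by
      intro m
      filter_upwards [condExp_sub hVint hV'int m, ae_bdd_abs_condExp_of_ae_bdd_abs (m := m)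
        (f := V - V') (μ := P) (Eventually.of_forall hclose)] with ω h1 h2
      rw [h1] at h2
      exact h2
    filter_upwards [hcond, hce (ℱ j), hce (ℱ (j + 1))] with ω h1 h2 h3
    rw [abs_le] at h2 h3 ⊢
    rw [h1] at h3
    constructor <;> linarith
  -- A game started at the origin never leaves ⟨x, e⟩ ≥ 0, at distance ρ from the past at stage 0.
  · refine condExp_indep_eq (generatedSigma_le hXm (future 0)) (hℱle 0) ?_ (hindep 0).symm
    refine (hVm _ (fun _ => future 0) (fun _ x hx i => ?_)
      (fun _ x hx i => measurable_generatedSigma (X := X) hx i) ?_).stronglyMeasurable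
    · change ((0 : ℕ) : ℝ) * ρ ≤ inner ℝ (x + h • f i) e
      have h1 : ((0 : ℕ) : ℝ) * ρ ≤ inner ℝ x e := hx
      rw [hmove]
      have h2 := mul_le_mul_of_nonneg_left (hfe i) hh.le
      have h3 := mul_pos hh hδ
      linarith
    · change ((0 : ℕ) : ℝ) * ρ ≤ inner ℝ (0 : Euc d) e
      simp
  · have hstr : StronglyMeasurable[ℱ n] V := by
      -- With `j` steps remaining, the coordinate ⟨x, e⟩ can still grow by j h F, which is kept in
      -- reserve.
      refine (hVm _ (fun j => {x | inner ℝ x e ≤ ((n : ℝ) - 1) * ρ - j * h * F})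
        (fun j x hx i => ?_) (fun j x hx i => ?_) ?_).stronglyMeasurable
      · change (inner ℝ (x + h • f i) e : ℝ) ≤ ((n : ℝ) - 1) * ρ - j * h * F
        have h1 : (inner ℝ x e : ℝ) ≤ ((n : ℝ) - 1) * ρ - (j + 1 : ℕ) * h * F := hx
        push_cast at h1
        have h2 : (inner ℝ (f i) e : ℝ) ≤ F := by
          have := real_inner_le_norm (f i) e
          rw [he, mul_one] at this
          exact this.trans ((hG ω₀).speed i)
        have h3 := mul_le_mul_of_nonneg_left h2 hh.le
        rw [hmove]
        linarith
      · refine measurable_generatedSigma (X := X) ?_ i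
        have h1 : (inner ℝ x e : ℝ) ≤ ((n : ℝ) - 1) * ρ - (j + 1 : ℕ) * h * F := hx
        change (inner ℝ x e : ℝ) ≤ ((n : ℝ) - 1) * ρ
        have h2 : 0 ≤ ((j + 1 : ℕ) : ℝ) * h * F := by positivity
        linarith
      · change (inner ℝ (0 : Euc d) e : ℝ) ≤ ((n : ℝ) - 1) * ρ - k * h * F
        have h1 := Nat.le_ceil (k * h * F / ρ)
        rw [div_le_iff₀ hρ] at h1
        rw [hn]
        push_cast
        simp only [inner_zero_left]
        linarith
    rw [condExp_of_stronglyMeasurable (hℱle n) hstr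
      (integrable_of_abs_le hV0.aestronglyMeasurable (Eventually.of_forall hVb))]

end

/-! ### Almost additive sequences -/

theorem two_rpow_div_two_lt_one : (2 : ℝ) ^ (3 / 4 : ℝ) / 2 < 1 := by
  rw [div_lt_one two_pos]
  calc (2 : ℝ) ^ (3 / 4 : ℝ) < 2 ^ (1 : ℝ) :=
        Real.rpow_lt_rpow_of_exponent_lt one_lt_two (by norm_num)
    _ = 2 := Real.rpow_one 2

/-- A sequence which is additive up to an error of order `n ^ (3/4)` is close to a linear one. -/
theorem exists_linear_approx {a : ℕ → ℝ} {D : ℝ}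
    (h : ∀ i j, |a (i + j) - a i - a j| ≤ D * ((i + j : ℕ) : ℝ) ^ (3 / 4 : ℝ)) :
    ∃ c D', ∀ n : ℕ, |a n - c * n| ≤ D' * (n : ℝ) ^ (3 / 4 : ℝ) := by
  set r := (2 : ℝ) ^ (3 / 4 : ℝ) / 2 with hr
  have hr0 : 0 ≤ r := by positivity
  have hr1 : r < 1 := two_rpow_div_two_lt_one
  have hpow : ∀ k n : ℕ, ((2 ^ k * n : ℕ) : ℝ) ^ (3 / 4 : ℝ) / 2 ^ k =
      r ^ k * (n : ℝ) ^ (3 / 4 : ℝ) := by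
    intro k n
    push_cast
    rw [Real.mul_rpow (by positivity) (by positivity), hr, div_pow, ← Real.rpow_natCast (2 : ℝ) k,
      ← Real.rpow_mul two_pos.le, ← Real.rpow_natCast ((2 : ℝ) ^ (3 / 4 : ℝ)) k,
      ← Real.rpow_mul two_pos.le, mul_comm (k : ℝ)]
    ring
  -- The averages along doublings of `n` form a Cauchy sequence with geometric rate r = 2^(3/4) / 2
  -- < 1. The additivity error also vanishes after division by 2^k, so the limits are additive in
  -- `n`, hence linear.
  set b : ℕ → ℕ → ℝ := fun n k => a (2 ^ k * n) / 2 ^ k with hb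
  have hstep : ∀ n k, dist (b n k) (b n (k + 1)) ≤ D * r * (n : ℝ) ^ (3 / 4 : ℝ) * r ^ k := by
    intro n k
    have h1 := h (2 ^ k * n) (2 ^ k * n)
    rw [← two_mul, ← mul_assoc, ← pow_succ'] at h1
    rw [dist_comm, Real.dist_eq]
    have e : b n (k + 1) - b n k =
        (a (2 ^ (k + 1) * n) - a (2 ^ k * n) - a (2 ^ k * n)) / 2 ^ (k + 1) := by
      simp only [hb]
      rw [pow_succ]
      field_simp
      ring
    rw [e, abs_div, abs_of_pos (by positivity : (0 : ℝ) < 2 ^ (k + 1))]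
    calc |a (2 ^ (k + 1) * n) - a (2 ^ k * n) - a (2 ^ k * n)| / 2 ^ (k + 1)
        ≤ D * ((2 ^ (k + 1) * n : ℕ) : ℝ) ^ (3 / 4 : ℝ) / 2 ^ (k + 1) := by gcongr
      _ = D * (((2 ^ (k + 1) * n : ℕ) : ℝ) ^ (3 / 4 : ℝ) / 2 ^ (k + 1)) := by ring
      _ = D * r * (n : ℝ) ^ (3 / 4 : ℝ) * r ^ k := by rw [hpow, pow_succ]; ring
  have hlim : ∀ n, ∃ y, Tendsto (b n) atTop (𝓝 y) := fun n =>
    cauchySeq_tendsto_of_complete (cauchySeq_of_le_geometric r _ hr1 (hstep n))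
  choose y hy using hlim
  have hadd : ∀ i j, y (i + j) = y i + y j := by
    intro i j
    have h1 : Tendsto (fun k => b (i + j) k - b i k - b j k) atTop (𝓝 (y (i + j) - y i - y j)) :=
      ((hy _).sub (hy _)).sub (hy _)
    have h2 : Tendsto (fun k => b (i + j) k - b i k - b j k) atTop (𝓝 0) := by
      refine squeeze_zero_norm (a := fun k => D * ((i + j : ℕ) : ℝ) ^ (3 / 4 : ℝ) * r ^ k) ?_ ?_
      · intro k
        have h3 := h (2 ^ k * i) (2 ^ k * j)
        rw [← mul_add] at h3
        have e : b (i + j) k - b i k - b j k =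
            (a (2 ^ k * (i + j)) - a (2 ^ k * i) - a (2 ^ k * j)) / 2 ^ k := by
          simp only [hb]; ring
        rw [Real.norm_eq_abs, e, abs_div, abs_of_pos (by positivity : (0 : ℝ) < 2 ^ k)]
        calc _ ≤ D * ((2 ^ k * (i + j) : ℕ) : ℝ) ^ (3 / 4 : ℝ) / 2 ^ k := by gcongr
          _ = D * (((2 ^ k * (i + j) : ℕ) : ℝ) ^ (3 / 4 : ℝ) / 2 ^ k) := by ring
          _ = _ := by rw [hpow]; ring
      · simpa using (tendsto_pow_atTop_nhds_zero_of_lt_one hr0 hr1).const_mul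
          (D * ((i + j : ℕ) : ℝ) ^ (3 / 4 : ℝ))
    have := tendsto_nhds_unique h1 h2
    linarith
  have hlin : ∀ n : ℕ, y n = y 1 * n := by
    intro n
    induction n with
    | zero => have := hadd 0 0; simp at this; simp [this]
    | succ n ih => rw [hadd, ih]; push_cast; ring
  refine ⟨y 1, D * r / (1 - r), fun n => ?_⟩
  have h1 := dist_le_of_le_geometric_of_tendsto₀ r _ hr1 (hstep n) (hy n)
  rw [Real.dist_eq, hlin] at h1
  simp only [hb, pow_zero, one_mul, div_one] at h1
  refine h1.trans (le_of_eq ?_)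
  ring

theorem tendsto_rpow_three_quarters_div :
    Tendsto (fun n : ℕ => (n : ℝ) ^ (3 / 4 : ℝ) / n) atTop (𝓝 0) := by
  have h1 : Tendsto (fun n : ℕ => (n : ℝ) ^ (-(1 / 4 : ℝ))) atTop (𝓝 0) :=
    (tendsto_rpow_neg_atTop (by norm_num : (0 : ℝ) < 1 / 4)).comp tendsto_natCast_atTop_atTop
  refine h1.congr' ?_
  filter_upwards [eventually_gt_atTop 0] with n hn
  have hn' : (0 : ℝ) < n := by exact_mod_cast hn
  rw [eq_div_iff hn'.ne']
  nth_rewrite 2 [← Real.rpow_one (n : ℝ)]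
  rw [← Real.rpow_add hn']
  norm_num

/-! ### Deviation estimates for random fields -/

/-- The points of the lattice `N⁻¹ ℤᵈ` in the cube of half-side `R N`. -/
noncomputable def gridPoint {d : ℕ} (N : ℕ) (z : Fin d → ℤ) : Euc d :=
  WithLp.toLp 2 fun i => (z i : ℝ) / N

/-- Indices of the grid points. -/
noncomputable def gridIndex (d R N : ℕ) : Finset (Fin d → ℤ) :=
  Fintype.piFinset fun _ => Finset.Icc (-((R * N ^ 2 : ℕ) : ℤ)) ((R * N ^ 2 : ℕ) : ℤ)

theorem card_gridIndex (d R N : ℕ) : (gridIndex d R N).card = (2 * (R * N ^ 2) + 1) ^ d := by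
  rw [gridIndex, Fintype.card_piFinset_const, Int.card_Icc]
  congr 1
  omega

theorem exists_gridPoint_near {d R N : ℕ} (hN : 0 < N) {x : Euc d} (hx : ‖x‖ ≤ R * N) :
    ∃ z ∈ gridIndex d R N, ‖x - gridPoint N z‖ ≤ d / N := by
  have hN' : (0 : ℝ) < N := by exact_mod_cast hN
  have hxi : ∀ i, |x i| ≤ R * N := fun i => (PiLp.norm_apply_le x i).trans hx
  refine ⟨fun i => ⌊N * x i⌋, ?_, ?_⟩
  · rw [gridIndex, Fintype.mem_piFinset]
    intro i
    obtain ⟨h1, h2⟩ := abs_le.1 (hxi i)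
    rw [Finset.mem_Icc]
    constructor
    · rw [Int.le_floor]
      push_cast
      nlinarith
    · have : (⌊N * x i⌋ : ℝ) ≤ ((R * N ^ 2 : ℕ) : ℝ) := by
        refine (Int.floor_le _).trans ?_
        push_cast
        nlinarith
      exact_mod_cast this
  · have hcoord : ∀ i, |(x - gridPoint N fun i => ⌊N * x i⌋) i| ≤ 1 / N := by
      intro i
      have e : (x - gridPoint N fun i => ⌊N * x i⌋) i = (N * x i - ⌊N * x i⌋) / N := by
        simp only [gridPoint, PiLp.sub_apply]
        field_simp
      rw [e, abs_div, abs_of_pos hN']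
      have h1 := Int.floor_le (N * x i)
      have h2 := Int.lt_floor_add_one (N * x i)
      gcongr
      rw [abs_le]
      constructor <;> linarith
    rw [EuclideanSpace.norm_eq]
    refine Real.sqrt_le_iff.2 ⟨by positivity, ?_⟩
    calc ∑ i, ‖(x - gridPoint N fun i => ⌊N * x i⌋) i‖ ^ 2
        ≤ ∑ _i : Fin d, (1 / (N : ℝ)) ^ 2 := by
          refine Finset.sum_le_sum fun i _ => ?_
          have := hcoord i
          rw [Real.norm_eq_abs]
          gcongr
      _ = d * (1 / (N : ℝ)) ^ 2 := by simp
      _ ≤ (d / N : ℝ) ^ 2 := by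
          rw [div_pow, div_pow, one_pow, mul_one_div]
          gcongr
          have : d ≤ d ^ 2 := Nat.le_self_pow two_ne_zero d
          exact_mod_cast this

section

variable {d : ℕ} {Ω : Type*} [MeasurableSpace Ω] {P : Measure Ω} [IsProbabilityMeasure P]

/-- Two-sided Chernoff bound. -/
theorem measureReal_abs_sub_ge_le {Y : Ω → ℝ} (hY : Measurable Y) {B : ℝ} (hB : ∀ ω, |Y ω| ≤ B)
    {v : ℝ} (hv : 0 < v) {μ : ℝ}
    (hmgf : ∀ θ : ℝ, ∫ ω, Real.exp (θ * (Y ω - μ)) ∂P ≤ Real.exp (v * θ ^ 2)) {t : ℝ}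
    (ht : 0 ≤ t) : P.real {ω | t ≤ |Y ω - μ|} ≤ 2 * Real.exp (-(t ^ 2 / (4 * v))) := by
  have hint : ∀ θ : ℝ, Integrable (fun ω => Real.exp (θ * (Y ω - μ))) P := by
    intro θ
    refine integrable_of_abs_le (B := Real.exp (|θ| * (B + |μ|))) ?_ (Eventually.of_forall ?_)
    · exact (Real.measurable_exp.comp ((hY.sub_const μ).const_mul θ)).aestronglyMeasurable
    · intro ω
      rw [Real.abs_exp, Real.exp_le_exp]
      refine (le_abs_self _).trans ?_
      rw [abs_mul]
      have := hB ω
      gcongr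
      exact (abs_sub _ _).trans (by linarith)
  -- The choice θ = t / (2 v) minimizes -θ t + v θ².
  have e1 : -(t / (2 * v)) * t + v * (t / (2 * v)) ^ 2 = -(t ^ 2 / (4 * v)) := by
    field_simp; ring
  have h1 : P.real {ω | t ≤ Y ω - μ} ≤ Real.exp (-(t ^ 2 / (4 * v))) := by
    refine (measure_ge_le_exp_mul_mgf t (show 0 ≤ t / (2 * v) by positivity) (hint _)).trans ?_
    rw [← e1, Real.exp_add]
    gcongr
    exact hmgf _
  have h2 : P.real {ω | Y ω - μ ≤ -t} ≤ Real.exp (-(t ^ 2 / (4 * v))) := by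
    refine (measure_le_le_exp_mul_mgf (-t) (show -(t / (2 * v)) ≤ 0 by
      rw [neg_nonpos]; positivity) (hint _)).trans ?_
    rw [← e1, Real.exp_add]
    have := hmgf (-(t / (2 * v)))
    rw [neg_sq] at this
    rw [show - -(t / (2 * v)) * -t = -(t / (2 * v)) * t by ring]
    gcongr
    exact this
  calc P.real {ω | t ≤ |Y ω - μ|} ≤ P.real ({ω | t ≤ Y ω - μ} ∪ {ω | Y ω - μ ≤ -t}) := by
        refine measureReal_mono ?_
        intro ω hω
        rcases le_abs.1 (show t ≤ |Y ω - μ| from hω) with h | h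
        · exact Or.inl h
        · exact Or.inr (by change Y ω - μ ≤ -t; linarith)
    _ ≤ _ := (measureReal_union_le _ _).trans (by linarith)

theorem exp_neg_le_factorial_div {y : ℝ} (hy : 0 < y) (n : ℕ) :
    Real.exp (-y) ≤ n.factorial / y ^ n := by
  rw [Real.exp_neg, inv_le_comm₀ (Real.exp_pos _) (by positivity), inv_div]
  exact Real.pow_div_factorial_le_exp y hy.le n

/-- A stationary-in-law family of random fields with Gaussian concentration. -/
structure IsConcentratedField (P : Measure Ω) (X : ℕ → Euc d → Ω → ℝ) (C L K : ℝ) : Prop where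
  C_nonneg : 0 ≤ C
  L_nonneg : 0 ≤ L
  K_pos : 0 < K
  measurable : ∀ k x, Measurable (X k x)
  bdd : ∀ k x ω, |X k x ω| ≤ C * k
  lip : ∀ k x y ω, |X k x ω - X k y ω| ≤ L * k * ‖x - y‖
  mgf : ∀ (k : ℕ) (x : Euc d) (θ : ℝ),
    ∫ ω, Real.exp (θ * (X k x ω - ∫ ω, X k 0 ω ∂P)) ∂P ≤ Real.exp (K * θ ^ 2 * (k + 1))

variable {X : ℕ → Euc d → Ω → ℝ} {C L K : ℝ}

/-- The threshold N^(3/4) exceeds the fluctuation scale N^(1/2), so the Chernoff exponent is at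
least √N / (8 K) and beats every power of N. -/
theorem IsConcentratedField.exists_tail_bound (hX : IsConcentratedField P X C L K) (q : ℕ) :
    ∃ Q, 0 ≤ Q ∧ ∀ N k : ℕ, 0 < N → k ≤ N → ∀ x,
      P.real {ω | (N : ℝ) ^ (3 / 4 : ℝ) ≤ |X k x ω - ∫ ω, X k 0 ω ∂P|} ≤ Q / (N : ℝ) ^ q := by
  have hK := hX.K_pos
  refine ⟨2 * ((2 * q).factorial * (8 * K) ^ (2 * q)), by positivity, fun N k hN hk x => ?_⟩
  have hN' : (0 : ℝ) < N := by exact_mod_cast hN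
  have hN1 : (1 : ℝ) ≤ N := by exact_mod_cast hN
  have hkN : (k : ℝ) ≤ N := by exact_mod_cast hk
  have h1 := measureReal_abs_sub_ge_le (P := P) (hX.measurable k x) (hX.bdd k x)
    (v := K * (k + 1)) (by positivity) (μ := ∫ ω, X k 0 ω ∂P) (fun θ => by
      refine (hX.mgf k x θ).trans (le_of_eq ?_)
      congr 1; ring) (t := (N : ℝ) ^ (3 / 4 : ℝ)) (by positivity)
  refine h1.trans ?_
  have e1 : ((N : ℝ) ^ (3 / 4 : ℝ)) ^ 2 = N * √N := by
    rw [← Real.rpow_natCast, ← Real.rpow_mul hN'.le, Real.sqrt_eq_rpow]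
    nth_rewrite 2 [← Real.rpow_one (N : ℝ)]
    rw [← Real.rpow_add hN']
    norm_num
  have h2 : √N / (8 * K) ≤ ((N : ℝ) ^ (3 / 4 : ℝ)) ^ 2 / (4 * (K * (k + 1))) := by
    rw [e1, div_le_div_iff₀ (by positivity) (by positivity)]
    have h3 : (k : ℝ) + 1 ≤ 2 * N := by linarith
    have h4 : 0 ≤ √(N : ℝ) * K := by positivity
    nlinarith
  have h3 : Real.exp (-(((N : ℝ) ^ (3 / 4 : ℝ)) ^ 2 / (4 * (K * (k + 1))))) ≤
      (2 * q).factorial * (8 * K) ^ (2 * q) / (N : ℝ) ^ q := by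
    calc _ ≤ Real.exp (-(√N / (8 * K))) := Real.exp_le_exp.2 (by linarith)
      _ ≤ (2 * q).factorial / (√N / (8 * K)) ^ (2 * q) :=
        exp_neg_le_factorial_div (by positivity) _
      _ = _ := by
        rw [div_pow, div_div_eq_mul_div, pow_mul (√(N : ℝ)), Real.sq_sqrt hN'.le]
  calc _ ≤ 2 * ((2 * q).factorial * (8 * K) ^ (2 * q) / (N : ℝ) ^ q) := by gcongr
    _ = _ := by ring

/-- A grid of mesh 1 / N has at most ((2 R + 1) N²)^d points in the cube, so a tail of order
N^(-2d-2) leaves the summable bound N^(-2) after the union bound. Between grid points the Lipschitz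
constant L k ≤ L N times d / N costs only L d. -/
theorem IsConcentratedField.exists_uniform_bound (hX : IsConcentratedField P X C L K) (R : ℕ) :
    ∃ Q, 0 ≤ Q ∧ ∀ N k : ℕ, 0 < N → k ≤ N → ∃ E : Set Ω, MeasurableSet E ∧
      P.real E ≤ Q / (N : ℝ) ^ 2 ∧ ∀ ω ∉ E, ∀ x : Euc d, ‖x‖ ≤ R * N →
        |X k x ω - ∫ ω, X k 0 ω ∂P| ≤ (N : ℝ) ^ (3 / 4 : ℝ) + L * d := by
  obtain ⟨Q, hQ, htail⟩ := hX.exists_tail_bound (2 * d + 2)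
  refine ⟨(2 * R + 1) ^ d * Q, by positivity, fun N k hN hk => ?_⟩
  have hN' : (0 : ℝ) < N := by exact_mod_cast hN
  have hN1 : (1 : ℝ) ≤ N := by exact_mod_cast hN
  have hkN : (k : ℝ) ≤ N := by exact_mod_cast hk
  have hL := hX.L_nonneg
  set bad : (Fin d → ℤ) → Set Ω := fun z =>
    {ω | (N : ℝ) ^ (3 / 4 : ℝ) ≤ |X k (gridPoint N z) ω - ∫ ω, X k 0 ω ∂P|} with hbad
  refine ⟨⋃ z ∈ gridIndex d R N, bad z, ?_, ?_, ?_⟩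
  · refine Finset.measurableSet_biUnion _ fun z _ => ?_
    exact measurableSet_le measurable_const ((hX.measurable k _).sub_const _).abs
  · calc P.real (⋃ z ∈ gridIndex d R N, bad z) ≤ ∑ z ∈ gridIndex d R N, P.real (bad z) :=
          measureReal_biUnion_finset_le _ _
      _ ≤ ∑ _z ∈ gridIndex d R N, Q / (N : ℝ) ^ (2 * d + 2) :=
          Finset.sum_le_sum fun z _ => htail N k hN hk _
      _ = (2 * (R * (N : ℝ) ^ 2) + 1) ^ d * (Q / (N : ℝ) ^ (2 * d + 2)) := by
          rw [Finset.sum_const, card_gridIndex, nsmul_eq_mul]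
          push_cast
          rfl
      _ ≤ ((2 * R + 1) * (N : ℝ) ^ 2) ^ d * (Q / (N : ℝ) ^ (2 * d + 2)) := by
          gcongr
          nlinarith
      _ = (2 * R + 1) ^ d * Q / (N : ℝ) ^ 2 := by
          rw [mul_pow, ← pow_mul, pow_add]
          field_simp
  · intro ω hω x hx
    obtain ⟨z, hz, hxz⟩ := exists_gridPoint_near hN hx
    have h1 : ω ∉ bad z := fun h => hω (mem_biUnion hz h)
    have h2 : |X k (gridPoint N z) ω - ∫ ω, X k 0 ω ∂P| < (N : ℝ) ^ (3 / 4 : ℝ) := not_le.1 h1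
    have h3 := hX.lip k x (gridPoint N z) ω
    have h4 : L * k * ‖x - gridPoint N z‖ ≤ L * d := by
      calc L * k * ‖x - gridPoint N z‖ ≤ L * N * (d / N) := by gcongr
        _ = L * d := by field_simp
    have h5 := abs_sub_le (X k x ω) (X k (gridPoint N z) ω) (∫ ω, X k 0 ω ∂P)
    linarith

/-- The hypothesis `hadd` is dynamic programming with finite speed. It is applied with `c` the mean
of X j 0 off the bad event. On the bad event the defect is at most 3 C N, which its probability Q /
N² makes harmless. -/
theorem IsConcentratedField.exists_mean_almost_additive (hX : IsConcentratedField P X C L K)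
    {F : ℝ} (hadd : ∀ (i j : ℕ) (ω : Ω) (c η : ℝ),
      (∀ y, ‖y‖ ≤ F * i + 1 → |X j y ω - c| ≤ η) → |X (i + j) 0 ω - X i 0 ω - c| ≤ η) :
    ∃ D, ∀ i j : ℕ, |(∫ ω, X (i + j) 0 ω ∂P) - (∫ ω, X i 0 ω ∂P) - ∫ ω, X j 0 ω ∂P| ≤
      D * ((i + j : ℕ) : ℝ) ^ (3 / 4 : ℝ) := by
  set R := ⌈|F| + 1⌉₊ with hR
  have hC := hX.C_nonneg
  have hL := hX.L_nonneg
  obtain ⟨Q, hQ, hunif⟩ := hX.exists_uniform_bound R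
  refine ⟨1 + L * d + 3 * C * Q, fun i j => ?_⟩
  have hint : ∀ k, Integrable (X k 0) P := fun k =>
    integrable_of_abs_le (hX.measurable k 0).aestronglyMeasurable
      (Eventually.of_forall (hX.bdd k 0))
  rcases Nat.eq_zero_or_pos (i + j) with h0 | hN
  · obtain ⟨rfl, rfl⟩ : i = 0 ∧ j = 0 := by omega
    have hz : ∀ ω, X 0 0 ω = 0 := fun ω => by simpa using hX.bdd 0 0 ω
    simp only [hz, add_zero, integral_zero, sub_self, abs_zero, CharP.cast_eq_zero]
    positivity
  obtain ⟨E, hE, hPE, hgood⟩ := hunif (i + j) j hN (by omega)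
  set N := i + j with hNdef
  have hN1 : (1 : ℝ) ≤ N := by exact_mod_cast hN
  have hiN : (i : ℝ) ≤ N := by exact_mod_cast (by omega : i ≤ N)
  have hjN : (j : ℝ) ≤ N := by exact_mod_cast (by omega : j ≤ N)
  set φ := (N : ℝ) ^ (3 / 4 : ℝ) with hφ
  have hφ1 : 1 ≤ φ := Real.one_le_rpow hN1 (by norm_num)
  set μ := ∫ ω, X j 0 ω ∂P with hμ
  have hμb : |μ| ≤ C * j := by
    have := norm_integral_le_of_norm_le_const (μ := P) (f := X j 0)
      (Eventually.of_forall (hX.bdd j 0))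
    simpa using this
  have hpt : ∀ ω, |X N 0 ω - X i 0 ω - μ| ≤
      (φ + L * d) + E.indicator (fun _ => 3 * C * N) ω := by
    intro ω
    by_cases hω : ω ∈ E
    · rw [indicator_of_mem hω]
      have h1 := hX.bdd N 0 ω
      have h2 := hX.bdd i 0 ω
      have h3 : |X N 0 ω - X i 0 ω - μ| ≤ |X N 0 ω| + |X i 0 ω| + |μ| := by
        exact (abs_sub _ _).trans (by linarith [abs_sub (X N 0 ω) (X i 0 ω)])
      have h4 : C * i ≤ C * N := by gcongr
      have h5 : C * j ≤ C * N := by gcongr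
      have h6 : 0 ≤ L * d := by positivity
      linarith
    · rw [indicator_of_notMem hω, add_zero]
      refine hadd i j ω μ _ fun y hy => hgood ω hω y (hy.trans ?_)
      have h1 : |F| + 1 ≤ R := Nat.le_ceil _
      have h2 := le_abs_self F
      have h3 : 0 ≤ |F| := abs_nonneg F
      calc F * i + 1 ≤ |F| * N + 1 * N := by
            have : F * i ≤ |F| * N := by gcongr
            linarith
        _ ≤ R * N := by rw [← add_mul]; gcongr
  have hEint : Integrable (E.indicator fun _ => 3 * C * (N : ℝ)) P :=
    (integrable_const _).indicator hE
  calc |(∫ ω, X N 0 ω ∂P) - (∫ ω, X i 0 ω ∂P) - μ| = |∫ ω, (X N 0 ω - X i 0 ω - μ) ∂P| := by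
        rw [integral_sub (f := fun ω => X N 0 ω - X i 0 ω) ((hint N).sub (hint i))
          (integrable_const _), integral_sub (hint N) (hint i)]
        simp
    _ ≤ ∫ ω, |X N 0 ω - X i 0 ω - μ| ∂P := abs_integral_le_integral_abs
    _ ≤ ∫ ω, ((φ + L * d) + E.indicator (fun _ => 3 * C * (N : ℝ)) ω) ∂P :=
        integral_mono (((hint N).sub (hint i)).sub (integrable_const _)).abs
          ((integrable_const _).add hEint) hpt
    _ = (φ + L * d) + P.real E * (3 * C * N) := by
        rw [integral_add (integrable_const _) hEint, integral_indicator_const _ hE]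
        simp
    _ ≤ (φ + L * d) + Q / (N : ℝ) ^ 2 * (3 * C * N) := by gcongr
    _ = (φ + L * d) + 3 * C * Q * (1 / N) := by field_simp
    _ ≤ (φ + L * d) + 3 * C * Q * 1 := by
        gcongr
        rw [div_le_one (by linarith)]
        exact hN1
    _ ≤ (1 + L * d + 3 * C * Q) * φ := by
        have h1 : 0 ≤ L * d := by positivity
        have h2 : 0 ≤ 3 * C * Q := by positivity
        nlinarith

/-- Law of large numbers, locally uniformly in space, for a concentrated and almost additive family
of random fields. -/
theorem IsConcentratedField.exists_limit (hX : IsConcentratedField P X C L K)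
    {F : ℝ} (hadd : ∀ (i j : ℕ) (ω : Ω) (c η : ℝ),
      (∀ y, ‖y‖ ≤ F * i + 1 → |X j y ω - c| ≤ η) → |X (i + j) 0 ω - X i 0 ω - c| ≤ η) :
    ∃ c : ℝ, ∀ᵐ ω ∂P, ∀ R : ℕ, ∀ η > 0, ∀ᶠ N : ℕ in atTop, ∀ x : Euc d, ‖x‖ ≤ R * N →
      |X N x ω - c * N| ≤ η * N := by
  obtain ⟨D, hD⟩ := hX.exists_mean_almost_additive hadd
  obtain ⟨c, D', hc⟩ := exists_linear_approx (a := fun k => ∫ ω, X k 0 ω ∂P) hD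
  refine ⟨c, ae_all_iff.2 fun R => ?_⟩
  obtain ⟨Q, hQ, hunif⟩ := hX.exists_uniform_bound R
  have hunif' : ∀ N : ℕ, ∃ E : Set Ω, P.real E ≤ Q / ((N : ℝ) + 1) ^ 2 ∧ ∀ ω ∉ E,
      ∀ x : Euc d, ‖x‖ ≤ R * ((N + 1 : ℕ) : ℝ) →
        |X (N + 1) x ω - ∫ ω, X (N + 1) 0 ω ∂P| ≤
          ((N + 1 : ℕ) : ℝ) ^ (3 / 4 : ℝ) + L * d := by
    intro N
    obtain ⟨E, -, h1, h2⟩ := hunif (N + 1) (N + 1) N.succ_pos le_rfl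
    exact ⟨E, by exact_mod_cast h1, h2⟩
  choose E hE hgood using hunif'
  -- Summability of the bad events feeds Borel–Cantelli; the index is shifted by one because the
  -- uniform bound requires N > 0.
  have hsum : ∑' N, P (E N) ≠ ⊤ := by
    have h1 : Summable fun N : ℕ => Q / ((N : ℝ) + 1) ^ 2 := by
      have h2 : Summable fun N : ℕ => 1 / (N : ℝ) ^ 2 :=
        Real.summable_one_div_nat_pow.2 one_lt_two
      have h3 := ((summable_nat_add_iff 1).2 h2).mul_left Q
      refine h3.congr fun N => ?_
      push_cast
      ring
    have h2 : Summable fun N => P.real (E N) :=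
      Summable.of_nonneg_of_le (fun _ => measureReal_nonneg) hE h1
    have h3 := h2.tsum_ofReal_ne_top
    simpa using h3
  filter_upwards [ae_eventually_notMem hsum] with ω hω η hη
  have hsmall : ∀ᶠ N : ℕ in atTop, (1 + D') * (N : ℝ) ^ (3 / 4 : ℝ) + L * d ≤ η * N := by
    have h1 : Tendsto (fun N : ℕ => (1 + D') * ((N : ℝ) ^ (3 / 4 : ℝ) / N) + L * d / N)
        atTop (𝓝 ((1 + D') * 0 + 0)) :=
      (tendsto_rpow_three_quarters_div.const_mul _).add
        (tendsto_const_div_atTop_nhds_zero_nat _)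
    rw [mul_zero, add_zero] at h1
    filter_upwards [h1.eventually_lt_const hη, eventually_gt_atTop 0] with N hN hN0
    have hN' : (0 : ℝ) < N := by exact_mod_cast hN0
    rw [← mul_div_assoc, ← add_div, div_lt_iff₀ hN'] at hN
    exact hN.le
  have hev : ∀ᶠ N : ℕ in atTop, ∀ x : Euc d, ‖x‖ ≤ R * (N : ℝ) →
      |X N x ω - ∫ ω, X N 0 ω ∂P| ≤ (N : ℝ) ^ (3 / 4 : ℝ) + L * d := by
    filter_upwards [(tendsto_sub_atTop_nat 1).eventually hω, eventually_gt_atTop 0] with N hN hN0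
    obtain ⟨n, rfl⟩ := Nat.exists_eq_succ_of_ne_zero hN0.ne'
    exact hgood n ω hN
  filter_upwards [hsmall, hev] with N h1 h2 x hx
  have h3 := abs_sub_le (X N x ω) (∫ ω, X N 0 ω ∂P) (c * N)
  linarith [h2 x hx, hc N]

end

/-! ### Barriers and consequences of comparison -/

section

variable {d : ℕ} {T : ℝ} {H : Euc d → Euc d → ℝ}

theorem isViscositySupersolution_of_classical {v : ℝ × Euc d → ℝ} (hv : Continuous v)
    (h : ∀ t x, ∃ a p, HasDerivAt (fun s => v (s, x)) a t ∧
      HasGradientAt (fun y => v (t, y)) p x ∧ 0 ≤ a + H x p) : IsViscositySupersolution T H v := by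
  refine ⟨hv.lowerSemicontinuous.lowerSemicontinuousOn _, fun φ hφ t ht x hmin => ?_⟩
  obtain ⟨a, p, ha, hp, hap⟩ := h t x
  have hd : DifferentiableAt ℝ φ (t, x) :=
    (hφ.contDiffAt (mem_nhds_cylinder ht x)).differentiableAt (by simp)
  have hd1 : HasDerivAt (fun s => φ (s, x)) (deriv (fun s => φ (s, x)) t) t :=
    (hd.comp t (f := fun s : ℝ => (s, x)) (by fun_prop)).hasDerivAt
  have hd2 : HasGradientAt (fun y => φ (t, y)) (gradient (fun y => φ (t, y)) x) x :=
    (hd.comp x (f := fun y : Euc d => (t, y)) (by fun_prop)).hasGradientAt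
  have h1 : IsLocalMin (fun s => v (s, x) - φ (s, x)) t := by
    have hc : ContinuousAt (fun s : ℝ => (s, x)) t := by fun_prop
    exact hc.eventually hmin
  have h2 : IsLocalMin (fun y => v (t, y) - φ (t, y)) x := by
    have hc : ContinuousAt (fun y : Euc d => (t, y)) x := by fun_prop
    exact hc.eventually hmin
  have e1 := h1.hasDerivAt_eq_zero (ha.sub hd1)
  have e2 := h2.hasFDerivAt_eq_zero (hp.sub' hd2).hasFDerivAt
  have e3 : p - gradient (fun y => φ (t, y)) x = 0 :=
    (InnerProductSpace.toDual ℝ (Euc d)).map_eq_zero_iff.1 e2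
  rw [sub_eq_zero] at e1 e3
  rw [← e1, ← e3]
  exact hap

theorem IsViscositySupersolution.mono {H' : Euc d → Euc d → ℝ} {v : ℝ × Euc d → ℝ}
    (hv : IsViscositySupersolution T H v) (h : ∀ x p, H x p ≤ H' x p) :
    IsViscositySupersolution T H' v :=
  ⟨hv.1, fun φ hφ t ht x hmin =>
    (hv.2 φ hφ t ht x hmin).trans (add_le_add_right (h x (gradient (fun y => φ (t, y)) x)) _)⟩

theorem IsCauchySolution.rescale {g : Euc d → ℝ} {u : ℝ × Euc d → ℝ} {T' r : ℝ}
    (hu : IsCauchySolution T H g u) (hr : 0 < r) (hT : r⁻¹ * T' ≤ T) (q : Euc d) (b c : ℝ) :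
    IsCauchySolution T' (fun x p => H (r⁻¹ • x) (p - q) - b)
      (fun x => r * g (r⁻¹ • x) + (inner ℝ q x + c)) (_root_.rescale r 0 q b c u) where
  continuousOn := by
    have hr' : 0 < r⁻¹ := inv_pos.2 hr
    have h1 : ContinuousOn (fun z : ℝ × Euc d => u (0 + r⁻¹ * z.1, r⁻¹ • z.2))
        (Ico 0 T' ×ˢ univ) := by
      refine hu.continuousOn.comp (Continuous.continuousOn (by fun_prop)) ?_
      rintro ⟨s, x⟩ ⟨hs, -⟩
      refine ⟨⟨by have := hs.1; positivity, ?_⟩, trivial⟩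
      have := mul_lt_mul_of_pos_left hs.2 hr'
      linarith
    exact (continuousOn_const.mul h1).add (Continuous.continuousOn (by fun_prop))
  initial x := by simp [_root_.rescale, hu.initial]
  subsolution := hu.subsolution.rescale hr le_rfl (by simpa using hT) q b c
  supersolution := hu.supersolution.rescale hr le_rfl (by simpa using hT) q b c

theorem IsViscositySupersolution.restrict {T' : ℝ} {v : ℝ × Euc d → ℝ}
    (hv : IsViscositySupersolution T H v) (hT : T' ≤ T) : IsViscositySupersolution T' H v := by
  have h := hv.rescale one_pos le_rfl (T' := T') (by simpa using hT) 0 0 0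
  have e : _root_.rescale 1 0 0 0 0 v = v := by ext z; simp [_root_.rescale]
  rw [e] at h
  simpa using h

/-- Comparison of a solution, from time `a` on, with a supersolution. -/
theorem IsCauchySolution.le_of_le {β K R : ℝ} (hβ : 0 < β) (hp : ∀ x, MomentumLipschitz β (H x))
    (hx : ∀ x y p, |H x p - H y p| ≤ K * ‖x - y‖) {g : Euc d → ℝ} {u v : ℝ × Euc d → ℝ}
    (hu : IsCauchySolution T H g u) {T' : ℝ} (hvc : ContinuousOn v (Ico 0 T' ×ˢ univ))
    (hv : IsViscositySupersolution T' H v) {a s : ℝ} (ha : 0 ≤ a) (hs : 0 ≤ s) (hsT : a + s < T)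
    (hsT' : s < T') {x : Euc d} (hR : β * s < R) (h : ∀ y, ‖y - x‖ ≤ R → u (a, y) ≤ v (0, y)) :
    u (a + s, x) ≤ v (s, x) := by
  set T₀ := min (T - a) T' with hT₀
  have e : ∀ z : ℝ × Euc d, _root_.rescale 1 a 0 0 0 u z = u (a + z.1, z.2) := fun z => by
    simp [_root_.rescale]
  have hsub := hu.subsolution.rescale one_pos ha (T' := T₀)
    (by have := min_le_left (T - a) T'; rw [← hT₀] at this; simp; linarith) 0 0 0
  have hc : ContinuousOn (_root_.rescale 1 a 0 0 0 u) (Ico 0 T₀ ×ˢ univ) := by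
    have h1 : ContinuousOn (fun z : ℝ × Euc d => u (a + z.1, z.2)) (Ico 0 T₀ ×ˢ univ) := by
      refine hu.continuousOn.comp (Continuous.continuousOn (by fun_prop)) ?_
      rintro ⟨s, x⟩ ⟨hs, -⟩
      have := min_le_left (T - a) T'
      rw [← hT₀] at this
      exact ⟨⟨by have := hs.1; linarith, by have := hs.2; linarith⟩, trivial⟩
    exact h1.congr fun z _ => e z
  have hsub' : IsViscositySubsolution T₀ H (_root_.rescale 1 a 0 0 0 u) := by simpa using hsub
  have key := local_comparison (t := s) hβ hp hx hc.upperSemicontinuousOn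
    (hvc.mono (prod_mono (Ico_subset_Ico_right (min_le_right _ _)) le_rfl)).lowerSemicontinuousOn
    hsub' (hv.restrict (min_le_right _ _)) (x₀ := x) (R := R)
    (fun y hy => by rw [e]; simpa using h y hy) ⟨hs, lt_min (by linarith) hsT'⟩ hR
  rwa [e] at key

theorem IsCauchySolution.neg {g : Euc d → ℝ} {u : ℝ × Euc d → ℝ} (hu : IsCauchySolution T H g u) :
    IsCauchySolution T (fun x p => -H x (-p)) (fun x => -g x) (fun z => -u z) where
  continuousOn := hu.continuousOn.neg
  initial x := by rw [hu.initial]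
  subsolution := hu.supersolution.neg
  supersolution := by
    apply IsViscositySubsolution.neg
    simpa using hu.subsolution

theorem MomentumLipschitz.neg {β : ℝ} {k : Euc d → ℝ} (h : MomentumLipschitz β k) :
    MomentumLipschitz β fun p => -k (-p) := by
  intro p q
  have := h (-q) (-p)
  rw [neg_sub_neg] at this
  rw [neg_sub_neg]
  exact this

theorem IsCauchySolution.ge_of_ge {β K R : ℝ} (hβ : 0 < β) (hp : ∀ x, MomentumLipschitz β (H x))
    (hx : ∀ x y p, |H x p - H y p| ≤ K * ‖x - y‖) {g g' : Euc d → ℝ} {u v : ℝ × Euc d → ℝ}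
    (hu : IsCauchySolution T H g u) {T' : ℝ} (hv : IsCauchySolution T' H g' v) {a s : ℝ}
    (ha : 0 ≤ a) (hs : 0 ≤ s) (hsT : a + s < T) (hsT' : s < T') {x : Euc d} (hR : β * s < R)
    (h : ∀ y, ‖y - x‖ ≤ R → v (0, y) ≤ u (a, y)) : v (s, x) ≤ u (a + s, x) := by
  have := hu.neg.le_of_le hβ (fun x => (hp x).neg) (K := K) (fun x y p => by
    rw [neg_sub_neg, norm_sub_rev]; exact hx y x (-p)) hv.neg.continuousOn hv.neg.supersolution
    ha hs hsT hsT' hR (fun y hy => by linarith [h y hy])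
  linarith

/-- The barrier g(x) + η + D (smoothed |y - x|) + β (1 + D) t is a supersolution by linear growth,
its gradient having norm at most D. The smoothing κ = η / (D + 1) adds at most η at the centre. The
bound does not involve `K`, so it is uniform in ε for the oscillating problems. -/
theorem IsCauchySolution.le_initial_add {β K : ℝ} (hβ : 0 < β)
    (hp : ∀ x, MomentumLipschitz β (H x)) (hx : ∀ x y p, |H x p - H y p| ≤ K * ‖x - y‖)
    (hgr : ∀ x, LinearGrowth β (H x)) {g : Euc d → ℝ} {u : ℝ × Euc d → ℝ}
    (hu : IsCauchySolution T H g u) {η D : ℝ} (hη : 0 < η) (hD : 0 ≤ D)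
    (hg : ∀ x y, |g x - g y| ≤ η + D * ‖x - y‖) {t : ℝ} (ht : t ∈ Ico 0 T) (x : Euc d) :
    u (t, x) ≤ g x + 2 * η + β * (1 + D) * t := by
  set κ := η / (D + 1) with hκ
  have hκpos : 0 < κ := by positivity
  have hDκ : D * κ ≤ η := by
    rw [hκ, mul_div_assoc', div_le_iff₀ (by positivity)]
    nlinarith
  set v : ℝ × Euc d → ℝ := fun z => D * smoothDist κ x z.2 + (β * (1 + D) * z.1 + (g x + η)) with hv
  have hvc : Continuous v := by
    have := (contDiff_smoothDist hκpos x).continuous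
    fun_prop
  have hsup : IsViscositySupersolution (t + 1) H v := by
    refine isViscositySupersolution_of_classical hvc fun s y =>
      ⟨β * (1 + D), D • ((smoothDist κ x y)⁻¹ • (y - x)), ?_, ?_, ?_⟩
    · exact ((((hasDerivAt_id s).const_mul (β * (1 + D))).add_const (g x + η)).const_add
        (D * smoothDist κ x y)).congr_deriv (mul_one _)
    · have := ((hasGradientAt_smoothDist hκpos x y).const_mul' D).add'
        (hasGradientAt_const' (β * (1 + D) * s + (g x + η)) y)
      rwa [add_zero] at this
    · have h1 := (abs_le.1 (hgr y (D • ((smoothDist κ x y)⁻¹ • (y - x))))).1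
      have h2 : ‖D • ((smoothDist κ x y)⁻¹ • (y - x))‖ ≤ D := by
        rw [norm_smul, Real.norm_eq_abs, abs_of_nonneg hD]
        have := norm_gradient_smoothDist_le hκpos x y
        nlinarith
      nlinarith
  have key := hu.le_of_le hβ hp hx hvc.continuousOn hsup le_rfl ht.1 (by simpa using ht.2)
    (by linarith) (x := x) (R := β * t + 1) (by linarith) (fun y _ => by
      rw [hu.initial]
      have h1 := (abs_le.1 (hg y x)).2
      have h2 := norm_sub_le_smoothDist κ x y
      have h3 : D * ‖y - x‖ ≤ D * smoothDist κ x y := by gcongr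
      simp only [hv]
      linarith)
  simp only [hv, smoothDist_self hκpos, zero_add] at key
  linarith

theorem IsCauchySolution.abs_sub_initial_le {β K : ℝ} (hβ : 0 < β)
    (hp : ∀ x, MomentumLipschitz β (H x)) (hx : ∀ x y p, |H x p - H y p| ≤ K * ‖x - y‖)
    (hgr : ∀ x, LinearGrowth β (H x)) {g : Euc d → ℝ} {u : ℝ × Euc d → ℝ}
    (hu : IsCauchySolution T H g u) {η D : ℝ} (hη : 0 < η) (hD : 0 ≤ D)
    (hg : ∀ x y, |g x - g y| ≤ η + D * ‖x - y‖) {t : ℝ} (ht : t ∈ Ico 0 T) (x : Euc d) :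
    |u (t, x) - g x| ≤ 2 * η + β * (1 + D) * t := by
  have h1 := hu.le_initial_add hβ hp hx hgr hη hD hg ht x
  have h2 := hu.neg.le_initial_add hβ (fun x => (hp x).neg) (K := K) (fun x y p => by
    rw [neg_sub_neg, norm_sub_rev]; exact hx y x (-p)) (fun x p => by
      rw [abs_neg, ← norm_neg p]; exact hgr x (-p)) hη hD (fun x y => by
      rw [neg_sub_neg, norm_sub_rev]; exact hg y x) ht x
  rw [abs_le]
  constructor <;> linarith

end

/-! ### The value of the game with zero terminal payoff -/

section

variable {d : ℕ} {I : Type*} {M : (I → ℝ) → ℝ} {f : I → Euc d} {ℓ : Euc d → I → ℝ} {F C L : ℝ}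

theorem schemeFn_natCast (g : Euc d → ℝ) (n k : ℕ) (x : Euc d) :
    schemeFn M f ℓ g n (k, x) = (gameStep M f ℓ (1 / ((n : ℝ) + 1)))^[(n + 1) * k] g x := by
  have : ⌊((n : ℝ) + 1) * (k : ℝ)⌋₊ = (n + 1) * k := by
    rw [show ((n : ℝ) + 1) * (k : ℝ) = (((n + 1) * k : ℕ) : ℝ) by push_cast; ring,
      Nat.floor_natCast]
  simp only [schemeFn, this]

theorem IsGame.abs_schemeFn_zero_le (G : IsGame M f ℓ F C L) {t : ℝ} (ht : 0 ≤ t) (n : ℕ)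
    (x : Euc d) : |schemeFn M f ℓ (fun _ => 0) n (t, x)| ≤ C * t := by
  have h1 := G.abs_iterate_zero_le (h := 1 / ((n : ℝ) + 1)) (by positivity)
    ⌊((n : ℝ) + 1) * t⌋₊ x
  have h2 := mul_le_mul_of_nonneg_right (floor_mul_step_le ht n) G.C_nonneg
  rw [mul_comm C]
  exact h1.trans h2

theorem IsGame.abs_gameValue_zero_le (G : IsGame M f ℓ F C L) {t : ℝ} (ht : 0 ≤ t) (x : Euc d) :
    |gameValue M f ℓ (fun _ => 0) (t, x)| ≤ C * t :=
  le_of_tendsto (G.tendsto_gameValue linBdd_zero continuous_const ht x).abs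
    (Eventually.of_forall fun n => G.abs_schemeFn_zero_le ht n x)

theorem IsGame.gameValue_zero_lip (G : IsGame M f ℓ F C L) {t : ℝ} (ht : 0 ≤ t) (x y : Euc d) :
    |gameValue M f ℓ (fun _ => 0) (t, x) - gameValue M f ℓ (fun _ => 0) (t, y)| ≤
      L * t * ‖x - y‖ := by
  refine le_of_tendsto ((G.tendsto_gameValue linBdd_zero continuous_const ht x).sub
    (G.tendsto_gameValue linBdd_zero continuous_const ht y)).abs (Eventually.of_forall fun n => ?_)
  have h1 := G.iterate_zero_lip (h := 1 / ((n : ℝ) + 1)) (by positivity)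
    ⌊((n : ℝ) + 1) * t⌋₊ x y
  refine h1.trans ?_
  have h2 := mul_le_mul_of_nonneg_right (floor_mul_step_le ht n) G.L_nonneg
  rw [mul_comm L]
  gcongr

/-- The value restarted at time `a` and the value itself raised by c ± η solve the same equation;
comparison over a time `s` only sees the ball of radius F s + 1. -/
theorem IsGame.abs_gameValue_add_sub_le (G : IsGame M f ℓ F C L) {a s : ℝ} (ha : 0 ≤ a)
    (hs : 0 ≤ s) {x : Euc d} {c η : ℝ} (h : ∀ y, ‖y - x‖ ≤ F * s + 1 →
      |gameValue M f ℓ (fun _ => 0) (a, y) - c| ≤ η) :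
    |gameValue M f ℓ (fun _ => 0) (a + s, x) - gameValue M f ℓ (fun _ => 0) (s, x) - c| ≤ η := by
  set w := gameValue M f ℓ (fun _ => 0)
  have hw : IsCauchySolution (a + s + 1) (gameHam M f ℓ) (fun _ => 0) w :=
    G.isCauchySolution linBdd_zero continuous_const (by linarith)
  have hv : ∀ k : ℝ, IsCauchySolution (a + s + 1) (gameHam M f ℓ) (fun _ => k)
      (rescale 1 0 0 0 k w) := fun k => by
    simpa using hw.rescale one_pos (T' := a + s + 1) (by simp) 0 0 k
  have e : ∀ k r y, rescale 1 0 0 0 k w (r, y) = w (r, y) + k := fun k r y => by simp [rescale]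
  have h1 := hw.le_of_le G.F_pos G.momentumLipschitz G.lip_ham (hv (c + η)).continuousOn
    (hv (c + η)).supersolution ha hs (by linarith) (by linarith) (x := x) (R := F * s + 1)
    (by linarith) (fun y hy => by
      rw [(hv _).initial]; linarith [(abs_le.1 (h y hy)).2])
  have h2 := hw.ge_of_ge G.F_pos G.momentumLipschitz G.lip_ham (hv (c - η)) ha hs (by linarith)
    (by linarith) (x := x) (R := F * s + 1) (by linarith) (fun y hy => by
      rw [(hv _).initial]; linarith [(abs_le.1 (h y hy)).1])
  rw [e] at h1 h2
  rw [abs_le]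
  constructor <;> linarith

/-- The fractional part is placed at the start, where the value changes by at most `C`; comparison
preserves that error during the remaining integer time. -/
theorem IsGame.abs_gameValue_sub_floor_le (G : IsGame M f ℓ F C L) {t : ℝ} (ht : 0 ≤ t)
    (x : Euc d) : |gameValue M f ℓ (fun _ => 0) (t, x) -
      gameValue M f ℓ (fun _ => 0) ((⌊t⌋₊ : ℝ), x)| ≤ C := by
  have h0 : 0 ≤ t - ⌊t⌋₊ := sub_nonneg.2 (Nat.floor_le ht)
  have h := G.abs_gameValue_add_sub_le h0 (Nat.cast_nonneg ⌊t⌋₊) (x := x) (c := 0) (η := C)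
    (fun y _ => by
      rw [sub_zero]
      refine (G.abs_gameValue_zero_le h0 y).trans ?_
      have := Nat.lt_floor_add_one t
      have := G.C_nonneg
      nlinarith)
  simpa using h

end

/-! ### Game values as random fields, and their shift covariance -/

section

variable {d : ℕ} {A B : Type*} {Ω : Type*} {f : A × B → Euc d} {ℓ : Euc d → A × B → Ω → ℝ}
  {F C L : ℝ}

/-- The value, at the time `k`, of the game with zero terminal payoff, as a random field. -/
noncomputable def valueField (f : A × B → Euc d) (ℓ : Euc d → A × B → Ω → ℝ) (k : ℕ) (x : Euc d)
    (ω : Ω) : ℝ :=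
  gameValue minmax f (fun x i => ℓ x i ω) (fun _ => 0) ((k : ℝ), x)

theorem tendsto_valueField {ω : Ω} (G : IsGame minmax f (fun x i => ℓ x i ω) F C L) (k : ℕ)
    (x : Euc d) : Tendsto (fun n : ℕ => discreteValue f ℓ (1 / ((n : ℝ) + 1)) ((n + 1) * k) x ω)
      atTop (𝓝 (valueField f ℓ k x ω)) := by
  have h := G.tendsto_gameValue linBdd_zero continuous_const (Nat.cast_nonneg k) x
  simp only [schemeFn_natCast] at h
  exact h

theorem abs_discreteValue_le {ω : Ω} (G : IsGame minmax f (fun x i => ℓ x i ω) F C L) (n k : ℕ)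
    (x : Euc d) : |discreteValue f ℓ (1 / ((n : ℝ) + 1)) ((n + 1) * k) x ω| ≤ C * k := by
  have h := G.abs_schemeFn_zero_le (Nat.cast_nonneg k) n x
  rwa [schemeFn_natCast] at h

theorem discreteValue_shift {τ : Euc d → Ω → Ω} (hst : ∀ x y i ω, ℓ x i (τ y ω) = ℓ (x + y) i ω)
    (h : ℝ) (k : ℕ) (x y : Euc d) (ω : Ω) :
    discreteValue f ℓ h k x (τ y ω) = discreteValue f ℓ h k (x + y) ω := by
  unfold discreteValue
  induction k generalizing x with
  | zero => rfl
  | succ k ih =>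
    rw [Function.iterate_succ_apply', Function.iterate_succ_apply']
    rw [gameStep, gameStep]
    congr 1
    ext i
    rw [ih, hst, add_right_comm]

theorem valueField_shift (hG : ∀ ω, IsGame minmax f (fun x i => ℓ x i ω) F C L)
    {τ : Euc d → Ω → Ω} (hst : ∀ x y i ω, ℓ x i (τ y ω) = ℓ (x + y) i ω) (k : ℕ) (y : Euc d)
    (ω : Ω) : valueField f ℓ k 0 (τ y ω) = valueField f ℓ k y ω := by
  have h := tendsto_valueField (hG (τ y ω)) k 0
  simp only [discreteValue_shift hst, zero_add] at h
  exact tendsto_nhds_unique h (tendsto_valueField (hG ω) k y)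

end

/-! ### Concentration and law of large numbers for the game values -/

section

variable {d : ℕ} {A B : Type*} [TopologicalSpace A] [TopologicalSpace B] [CompactSpace A]
  [CompactSpace B] [Nonempty A] [Nonempty B] [TopologicalSpace.SeparableSpace A]
  [TopologicalSpace.SeparableSpace B] {Ω : Type*} [MeasurableSpace Ω] {P : Measure Ω}
  [IsProbabilityMeasure P] {f : A × B → Euc d} {ℓ : Euc d → A × B → Ω → ℝ} {F C L : ℝ}

theorem measurable_discreteValue' (hf : Continuous f)
    (hG : ∀ ω, IsGame minmax f (fun x i => ℓ x i ω) F C L)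
    (hcont : ∀ x ω, Continuous fun i => ℓ x i ω) (hm : ∀ x i, Measurable (ℓ x i)) {h : ℝ}
    (hh : 0 ≤ h) (k : ℕ) (x : Euc d) : Measurable (discreteValue f ℓ h k x) :=
  measurable_discreteValue hf hG hcont hh (fun _ => univ) (fun _ _ _ _ => mem_univ _)
    (fun _ x _ i => hm x i) k x (mem_univ x)

theorem measurable_valueField (hf : Continuous f)
    (hG : ∀ ω, IsGame minmax f (fun x i => ℓ x i ω) F C L)
    (hcont : ∀ x ω, Continuous fun i => ℓ x i ω) (hm : ∀ x i, Measurable (ℓ x i)) (k : ℕ)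
    (x : Euc d) : Measurable (valueField f ℓ k x) :=
  measurable_of_tendsto_metrizable
    (fun n => measurable_discreteValue' hf hG hcont hm (h := 1 / ((n : ℝ) + 1)) (by positivity) _ x)
    (tendsto_pi_nhds.2 fun ω => tendsto_valueField (hG ω) k x)

/-- With step 1 / (n + 1) and (n + 1) k steps the elapsed time is exactly `k`, so the discrete
moment bounds are uniform in `n` and pass to the limit by dominated convergence. -/
theorem exists_isConcentratedField (hf : Continuous f)
    (hG : ∀ ω, IsGame minmax f (fun x i => ℓ x i ω) F C L)
    (hcont : ∀ x ω, Continuous fun i => ℓ x i ω) (hm : ∀ x i, Measurable (ℓ x i))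
    (hind : LongRangeIndependent P fun i x ω => ℓ x i ω) {e : Euc d} {δ : ℝ} (he : ‖e‖ = 1)
    (hδ : 0 < δ) (hfe : ∀ i, δ ≤ inner ℝ (f i) e) {τ : Euc d → Ω → Ω}
    (hτ : ∀ x, MeasurePreserving (τ x) P P)
    (hst : ∀ x y i ω, ℓ x i (τ y ω) = ℓ (x + y) i ω) :
    ∃ K, IsConcentratedField P (valueField f ℓ) C L K := by
  obtain ⟨K, hK, hmgf⟩ := exists_mgf_bound hf hG hcont hm hind he hδ hfe
  obtain ⟨ω₀⟩ : Nonempty Ω := nonempty_of_isProbabilityMeasure P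
  have hmeas := measurable_valueField hf hG hcont hm
  have hbdd : ∀ k x ω, |valueField f ℓ k x ω| ≤ C * k := fun k x ω =>
    (hG ω).abs_gameValue_zero_le (Nat.cast_nonneg k) x
  have hC := (hG ω₀).C_nonneg
  refine ⟨K, hC, (hG ω₀).L_nonneg, hK, hmeas, hbdd,
    fun k x y ω => (hG ω).gameValue_zero_lip (Nat.cast_nonneg k) x y, fun k x θ => ?_⟩
  set Y : ℕ → Ω → ℝ := fun n => discreteValue f ℓ (1 / ((n : ℝ) + 1)) ((n + 1) * k) 0 with hY
  have hYm : ∀ n, Measurable (Y n) := fun n =>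
    measurable_discreteValue' hf hG hcont hm (by positivity) _ _
  have hYb : ∀ n ω, |Y n ω| ≤ C * k := fun n ω => abs_discreteValue_le (hG ω) n k 0
  have hYl : ∀ ω, Tendsto (fun n => Y n ω) atTop (𝓝 (valueField f ℓ k 0 ω)) := fun ω =>
    tendsto_valueField (hG ω) k 0
  have hmean : Tendsto (fun n => ∫ ω, Y n ω ∂P) atTop (𝓝 (∫ ω, valueField f ℓ k 0 ω ∂P)) :=
    tendsto_integral_of_dominated_convergence (fun _ => C * k)
      (fun n => (hYm n).aestronglyMeasurable) (integrable_const _)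
      (fun n => Eventually.of_forall fun ω => hYb n ω) (Eventually.of_forall hYl)
  have hmeanb : ∀ n, |∫ ω, Y n ω ∂P| ≤ C * k := fun n => by
    have := norm_integral_le_of_norm_le_const (μ := P) (f := Y n) (C := C * k)
      (Eventually.of_forall fun ω => hYb n ω)
    simpa using this
  have hexp : Tendsto (fun n => ∫ ω, Real.exp (θ * (Y n ω - ∫ ω, Y n ω ∂P)) ∂P) atTop
      (𝓝 (∫ ω, Real.exp (θ * (valueField f ℓ k 0 ω - ∫ ω, valueField f ℓ k 0 ω ∂P)) ∂P)) := by
    refine tendsto_integral_of_dominated_convergence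
      (fun _ => Real.exp (|θ| * (C * k + C * k))) (fun n => ?_) (integrable_const _)
      (fun n => Eventually.of_forall fun ω => ?_) (Eventually.of_forall fun ω => ?_)
    · exact (Real.measurable_exp.comp (((hYm n).sub_const _).const_mul θ)).aestronglyMeasurable
    · rw [Real.norm_eq_abs, Real.abs_exp, Real.exp_le_exp]
      refine (le_abs_self _).trans ?_
      rw [abs_mul]
      gcongr
      exact (abs_sub _ _).trans (add_le_add (hYb n ω) (hmeanb n))
    · exact (Real.continuous_exp.tendsto _).comp (((hYl ω).sub hmean).const_mul θ)
  have hzero := le_of_tendsto hexp (b := Real.exp (K * θ ^ 2 * (k + 1)))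
    (Eventually.of_forall fun n => by
      have hn : (0 : ℝ) < (n : ℝ) + 1 := by positivity
      have := hmgf (1 / ((n : ℝ) + 1)) (by positivity) (by
        rw [div_le_one hn]; linarith [Nat.cast_nonneg (α := ℝ) n]) ((n + 1) * k) θ
      rwa [show (((n + 1) * k : ℕ) : ℝ) * (1 / ((n : ℝ) + 1)) = k by push_cast; field_simp] at this)
  -- Stationarity moves the bound from the origin to `x`: the field at `x` is the field at 0
  -- composed with a measure-preserving map.
  have := integral_map (μ := P) (hτ x).measurable.aemeasurable (f := fun ω =>
    Real.exp (θ * (valueField f ℓ k 0 ω - ∫ ω, valueField f ℓ k 0 ω ∂P)))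
    (Real.measurable_exp.comp (((hmeas k 0).sub_const _).const_mul θ)).aestronglyMeasurable
  rw [(hτ x).map_eq] at this
  rw [this] at hzero
  simpa only [valueField_shift hG hst] using hzero

theorem exists_ae_tendsto_valueField (hf : Continuous f)
    (hG : ∀ ω, IsGame minmax f (fun x i => ℓ x i ω) F C L)
    (hcont : ∀ x ω, Continuous fun i => ℓ x i ω) (hm : ∀ x i, Measurable (ℓ x i))
    (hind : LongRangeIndependent P fun i x ω => ℓ x i ω) {e : Euc d} {δ : ℝ} (he : ‖e‖ = 1)
    (hδ : 0 < δ) (hfe : ∀ i, δ ≤ inner ℝ (f i) e) {τ : Euc d → Ω → Ω}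
    (hτ : ∀ x, MeasurePreserving (τ x) P P)
    (hst : ∀ x y i ω, ℓ x i (τ y ω) = ℓ (x + y) i ω) :
    ∃ c : ℝ, ∀ᵐ ω ∂P, ∀ R : ℕ, ∀ η > 0, ∀ᶠ N : ℕ in atTop, ∀ x : Euc d, ‖x‖ ≤ R * N →
      |valueField f ℓ N x ω - c * N| ≤ η * N := by
  obtain ⟨K, hX⟩ := exists_isConcentratedField hf hG hcont hm hind he hδ hfe hτ hst
  refine hX.exists_limit (F := F) fun i j ω c η h => ?_
  have := (hG ω).abs_gameValue_add_sub_le (Nat.cast_nonneg j) (Nat.cast_nonneg i) (x := 0)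
    (c := c) (η := η) (fun y hy => h y (by simpa using hy))
  rw [add_comm] at this
  simpa [valueField] using this

end

/-! ### Homogenization from the large-scale behaviour of the plane-wave solutions -/

section

variable {d : ℕ} {H : Euc d → Euc d → ℝ} {W : Euc d → ℝ × Euc d → ℝ} {Hbar : Euc d → ℝ} {β K : ℝ}

/-- Large-scale convergence, locally uniformly at the scale `N`, along integer times. -/
def HasLargeScaleLimit (w : ℝ × Euc d → ℝ) (c : ℝ) : Prop :=
  ∀ R : ℕ, ∀ η > 0, ∀ᶠ N : ℕ in atTop, ∀ x : Euc d, ‖x‖ ≤ R * N → |w (N, x) - c * N| ≤ η * N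

theorem HasLargeScaleLimit.exists_le {w : ℝ × Euc d → ℝ} {c : ℝ} (h : HasLargeScaleLimit w c)
    {η : ℝ} (hη : 0 < η) : ∃ N : ℕ, 0 < N ∧ |w (N, 0) - c * N| ≤ η * N := by
  obtain ⟨N, hN, hN0⟩ := ((h 0 η hη).and (eventually_gt_atTop 0)).exists
  exact ⟨N, hN0, hN 0 (by simp)⟩

theorem HasLargeScaleLimit.abs_limit_le {w : ℝ × Euc d → ℝ} {c b : ℝ} (h : HasLargeScaleLimit w c)
    (hb : ∀ N : ℕ, |w (N, 0)| ≤ b * N) : |c| ≤ b := by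
  refine le_of_forall_pos_le_add fun η hη => ?_
  obtain ⟨N, hN, hle⟩ := h.exists_le hη
  have hN' : (0 : ℝ) < N := by exact_mod_cast hN
  have h1 : |c * N| ≤ (b + η) * N := by
    have := abs_sub_abs_le_abs_sub (c * N) (w (N, 0))
    rw [abs_sub_comm] at this
    linarith [hb N]
  rw [abs_mul, abs_of_pos hN'] at h1
  exact le_of_mul_le_mul_right h1 hN'

theorem HasLargeScaleLimit.sub {w w' : ℝ × Euc d → ℝ} {c c' : ℝ} (h : HasLargeScaleLimit w c)
    (h' : HasLargeScaleLimit w' c') : HasLargeScaleLimit (fun z => w z - w' z) (c - c') := by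
  intro R η hη
  filter_upwards [h R (η / 2) (by positivity), h' R (η / 2) (by positivity)] with N h1 h2 x hx
  have h3 := abs_le.1 (h1 x hx)
  have h4 := abs_le.1 (h2 x hx)
  rw [abs_le]
  constructor <;> linarith

/-- Passage from integer to real times, in rescaled variables. -/
theorem HasLargeScaleLimit.eventually_abs_le {w : ℝ × Euc d → ℝ} {c C₀ : ℝ}
    (h : HasLargeScaleLimit w c)
    (hfloor : ∀ t, 0 ≤ t → ∀ x, |w (t, x) - w ((⌊t⌋₊ : ℝ), x)| ≤ C₀) {s R η : ℝ} (hs : 0 < s)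
    (hη : 0 < η) : ∀ᶠ ε in 𝓝[>] (0 : ℝ), ∀ x : Euc d, ‖x‖ ≤ R →
      |ε * w (ε⁻¹ * s, ε⁻¹ • x) - c * s| ≤ η := by
  have hN : Tendsto (fun ε : ℝ => ⌊ε⁻¹ * s⌋₊) (𝓝[>] 0) atTop :=
    tendsto_nat_floor_atTop.comp (tendsto_inv_nhdsGT_zero.atTop_mul_const hs)
  have hsmall : ∀ᶠ ε in 𝓝[>] (0 : ℝ), ε * (C₀ + |c|) < η / 2 := by
    have : Tendsto (fun ε : ℝ => ε * (C₀ + |c|)) (𝓝[>] 0) (𝓝 (0 * (C₀ + |c|))) :=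
      (tendsto_id.mul_const _).mono_left nhdsWithin_le_nhds
    rw [zero_mul] at this
    exact this.eventually (gt_mem_nhds (by positivity))
  have hs2 : ∀ᶠ ε in 𝓝[>] (0 : ℝ), ε < s / 2 :=
    nhdsWithin_le_nhds (gt_mem_nhds (by positivity))
  -- For ε < s / 2 the integer part N of s / ε satisfies ε N ≥ s / 2, so |x| ≤ R gives |x / ε| ≤ (2
  -- |R| / s) N.
  filter_upwards [hN.eventually (h ⌈2 * |R| / s⌉₊ (η / (2 * s)) (by positivity)), hsmall, hs2,
    self_mem_nhdsWithin] with ε h1 h2 h3 hε x hx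
  have hε : 0 < ε := hε
  set N := ⌊ε⁻¹ * s⌋₊ with hNdef
  have hNle : ε * N ≤ s := by
    have := Nat.floor_le (show 0 ≤ ε⁻¹ * s by positivity)
    calc ε * N ≤ ε * (ε⁻¹ * s) := by gcongr
      _ = s := by field_simp
  have hNgt : s - ε < ε * N := by
    have := Nat.lt_floor_add_one (ε⁻¹ * s)
    have h4 := mul_lt_mul_of_pos_left this hε
    rw [show ε * (ε⁻¹ * s) = s by field_simp] at h4
    linarith
  have hxN : ‖ε⁻¹ • x‖ ≤ (⌈2 * |R| / s⌉₊ : ℝ) * N := by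
    have h4 : 2 * |R| / s ≤ ⌈2 * |R| / s⌉₊ := Nat.le_ceil _
    rw [norm_smul, norm_inv, Real.norm_eq_abs, abs_of_pos hε, inv_mul_le_iff₀ hε]
    calc ‖x‖ ≤ 2 * |R| / s * (s / 2) := by
          rw [show 2 * |R| / s * (s / 2) = |R| by field_simp]
          exact hx.trans (le_abs_self R)
      _ ≤ ⌈2 * |R| / s⌉₊ * (ε * N) := by gcongr; linarith
      _ = ε * (⌈2 * |R| / s⌉₊ * N) := by ring
  have e1 := hfloor (ε⁻¹ * s) (by positivity) (ε⁻¹ • x)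
  have e2 := h1 _ hxN
  have e3 : |ε * w (ε⁻¹ * s, ε⁻¹ • x) - c * (ε * N)| ≤ ε * C₀ + η / 2 := by
    rw [show ε * w (ε⁻¹ * s, ε⁻¹ • x) - c * (ε * N) =
      ε * ((w (ε⁻¹ * s, ε⁻¹ • x) - w (N, ε⁻¹ • x)) + (w (N, ε⁻¹ • x) - c * N)) by ring,
      abs_mul, abs_of_pos hε]
    calc _ ≤ ε * (C₀ + η / (2 * s) * N) := by
          gcongr
          exact (abs_add_le _ _).trans (add_le_add e1 e2)
      _ = ε * C₀ + η / (2 * s) * (ε * N) := by ring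
      _ ≤ ε * C₀ + η / (2 * s) * s := by gcongr
      _ = ε * C₀ + η / 2 := by field_simp
  have e4 : |c * (ε * N) - c * s| ≤ |c| * ε := by
    rw [← mul_sub, abs_mul]
    gcongr
    rw [abs_le]
    constructor <;> linarith
  have e5 := abs_sub_le (ε * w (ε⁻¹ * s, ε⁻¹ • x)) (c * (ε * N)) (c * s)
  linarith

/-- The functions ±β (1 + |p|) t are barriers, by linear growth at the momentum `p`. -/
theorem abs_planeWave_le (hβ : 0 < β) (hp : ∀ x, MomentumLipschitz β (H x))
    (hx : ∀ x y p, |H x p - H y p| ≤ K * ‖x - y‖) (hgr : ∀ x, LinearGrowth β (H x)) {p : Euc d}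
    {w : ℝ × Euc d → ℝ} {T : ℝ}
    (hw : IsCauchySolution T (fun x q => H x (p + q)) (fun _ => 0) w) {t : ℝ} (ht : t ∈ Ico 0 T)
    (x : Euc d) : |w (t, x)| ≤ β * (1 + ‖p‖) * t := by
  have key : ∀ {H : Euc d → Euc d → ℝ} {w : ℝ × Euc d → ℝ} {p : Euc d},
      (∀ x, MomentumLipschitz β (H x)) → (∀ x y p, |H x p - H y p| ≤ K * ‖x - y‖) →
      (∀ x, LinearGrowth β (H x)) →
      IsCauchySolution T (fun x q => H x (p + q)) (fun _ => 0) w →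
      w (t, x) ≤ β * (1 + ‖p‖) * t := by
    intro H w p hp hx hgr hw
    set v : ℝ × Euc d → ℝ := fun z => β * (1 + ‖p‖) * z.1
    have hvc : Continuous v := by fun_prop
    have hv : IsViscositySupersolution (t + 1) (fun x q => H x (p + q)) v :=
      isViscositySupersolution_of_classical hvc fun s y =>
        ⟨β * (1 + ‖p‖), 0, ((hasDerivAt_id s).const_mul _).congr_deriv (mul_one _),
          hasGradientAt_const' (β * (1 + ‖p‖) * s) y, by
            rw [add_zero]
            linarith [(abs_le.1 (hgr y p)).1]⟩
    have := hw.le_of_le hβ (fun x q q' => by simpa using hp x (p + q) (p + q')) (K := K)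
      (fun x y q => hx x y (p + q)) hvc.continuousOn hv le_rfl ht.1 (by simpa using ht.2)
      (by linarith) (x := x) (R := β * t + 1) (by linarith) (fun y _ => by
        rw [hw.initial]; simp [v])
    simpa [v] using this
  have h1 := key hp hx hgr hw
  have h2 := key (H := fun x p => -H x (-p)) (w := fun z => -w z) (p := -p)
    (fun x => (hp x).neg) (fun x y p => by rw [neg_sub_neg, norm_sub_rev]; exact hx y x (-p))
    (fun x p => by rw [abs_neg, ← norm_neg p]; exact hgr x (-p))
    (by simpa [neg_add, add_comm] using hw.neg)
  rw [norm_neg] at h2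
  rw [abs_le]
  constructor <;> linarith

/-- Adding β |p - q| t to the wave of momentum `q` compensates for the change of momentum in `H` and
gives a supersolution for `p`. -/
theorem planeWave_sub_le (hβ : 0 < β) (hp : ∀ x, MomentumLipschitz β (H x))
    (hx : ∀ x y p, |H x p - H y p| ≤ K * ‖x - y‖) {p q : Euc d} {w w' : ℝ × Euc d → ℝ} {T : ℝ}
    (hw : IsCauchySolution T (fun x r => H x (p + r)) (fun _ => 0) w)
    (hw' : IsCauchySolution T (fun x r => H x (q + r)) (fun _ => 0) w') {t : ℝ}
    (ht : t ∈ Ico 0 T) (x : Euc d) : w (t, x) - w' (t, x) ≤ β * ‖p - q‖ * t := by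
  have hv := hw'.rescale one_pos (T' := T) (by simp) 0 (β * ‖p - q‖) 0
  have hsup : IsViscositySupersolution T (fun x r => H x (p + r))
      (rescale 1 0 0 (β * ‖p - q‖) 0 w') := by
    refine hv.supersolution.mono fun x r => ?_
    have := (abs_le.1 (hp x (p + r) (q + r))).1
    simp only [add_sub_add_right_eq_sub] at this
    simp only [inv_one, one_smul, sub_zero]
    linarith
  have := hw.le_of_le hβ (fun x q q' => by simpa using hp x (p + q) (p + q')) (K := K)
    (fun x y q => hx x y (p + q)) hv.continuousOn hsup le_rfl ht.1 (by simpa using ht.2) ht.2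
    (x := x) (R := β * t + 1) (by linarith) (fun y _ => by
      rw [hw.initial, hv.initial]; simp)
  simp [rescale] at this
  linarith

theorem abs_planeWave_sub_le (hβ : 0 < β) (hp : ∀ x, MomentumLipschitz β (H x))
    (hx : ∀ x y p, |H x p - H y p| ≤ K * ‖x - y‖) {p q : Euc d} {w w' : ℝ × Euc d → ℝ} {T : ℝ}
    (hw : IsCauchySolution T (fun x r => H x (p + r)) (fun _ => 0) w)
    (hw' : IsCauchySolution T (fun x r => H x (q + r)) (fun _ => 0) w') {t : ℝ}
    (ht : t ∈ Ico 0 T) (x : Euc d) : |w (t, x) - w' (t, x)| ≤ β * ‖p - q‖ * t := by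
  have h1 := planeWave_sub_le hβ hp hx hw hw' ht x
  have h2 := planeWave_sub_le hβ hp hx hw' hw ht x
  rw [norm_sub_rev] at h2
  rw [abs_le]
  constructor <;> linarith

/-- The solutions `W p` with zero initial datum for the Hamiltonian shifted by `p` have, in the
rescaled variables, the slope `-Hbar p` in time. -/
structure IsPlaneWaveFamily (H : Euc d → Euc d → ℝ) (W : Euc d → ℝ × Euc d → ℝ)
    (Hbar : Euc d → ℝ) : Prop where
  sol : ∀ p T, 0 < T → IsCauchySolution T (fun x q => H x (p + q)) (fun _ => 0) (W p)
  lim : ∀ p, ∀ s > 0, ∀ R, ∀ η > 0, ∀ᶠ ε in 𝓝[>] (0 : ℝ), ∀ x : Euc d, ‖x‖ ≤ R →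
    |ε * W p (ε⁻¹ * s, ε⁻¹ • x) - -Hbar p * s| ≤ η

theorem IsPlaneWaveFamily.dual (h : IsPlaneWaveFamily H W Hbar) :
    IsPlaneWaveFamily (fun x p => -H x (-p)) (fun p z => -W (-p) z) (fun p => -Hbar (-p)) where
  sol p T hT := by
    simpa [neg_add, add_comm] using (h.sol (-p) T hT).neg
  lim p s hs R η hη := by
    filter_upwards [h.lim (-p) s hs R η hη] with ε hε x hx
    rw [← abs_neg]
    convert hε x hx using 2
    ring

/-- This replaces correctors and perturbed test functions. The affine bound plus ε W p (s/ε, x/ε) is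
an exact solution of the oscillating equation that starts above u^ε on the ball; comparison holds at
its centre after time `s`, because β s < (β + 1) s, and the wave there is -s H̄(p) up to η s. -/
theorem IsPlaneWaveFamily.upperConsistent (h : IsPlaneWaveFamily H W Hbar) (hβ : 0 < β)
    (hp : ∀ x, MomentumLipschitz β (H x)) (hx : ∀ x y p, |H x p - H y p| ≤ K * ‖x - y‖)
    {T : ℝ} {g : Euc d → ℝ} {u : ℝ → ℝ × Euc d → ℝ}
    (hu : ∀ ε > 0, IsCauchySolution T (fun x p => H (ε⁻¹ • x) p) g (u ε)) :
    UpperConsistent T (fun _ p => Hbar p) (β + 1) (𝓝[>] 0) u := by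
  intro t ht x p η hη
  have hlt : ∀ᶠ s in 𝓝[>] (0 : ℝ), s < t := nhdsWithin_le_nhds (gt_mem_nhds ht.1)
  filter_upwards [hlt, self_mem_nhdsWithin] with s hst hs
  have hs : 0 < s := hs
  have hz : ∀ᶠ z : ℝ × Euc d in 𝓝 (t, x), (s < z.1 ∧ z.1 < T) ∧ ‖z.2‖ < ‖x‖ + 1 := by
    refine (((continuous_fst.tendsto (t, x)).eventually (Ioo_mem_nhds hst ht.2))).and ?_
    exact (continuous_snd.norm.tendsto (t, x)).eventually (gt_mem_nhds (by simp))
  filter_upwards [((h.lim p s hs (‖x‖ + 1) (η * s) (by positivity)).and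
    self_mem_nhdsWithin).prod_mk hz]
  rintro ⟨ε, r, z⟩ ⟨⟨hlim, hε⟩, ⟨hr, hrT⟩, hzx⟩ a ha
  have hε : 0 < ε := hε
  simp only at hr hrT hzx ha ⊢
  have hv := (h.sol p (ε⁻¹ * T) (by have := hs.trans (hr.trans hrT); positivity)).rescale hε
    (T' := T) le_rfl p 0 (a - inner ℝ p z)
  simp only [add_sub_cancel, sub_zero] at hv
  have key := (hu ε hε).le_of_le hβ (fun y => hp (ε⁻¹ • y)) (K := K * ε⁻¹) (fun y y' q => by
      refine (hx _ _ q).trans (le_of_eq ?_)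
      rw [← smul_sub, norm_smul, norm_inv, Real.norm_eq_abs, abs_of_pos hε, mul_assoc])
    hv.continuousOn hv.supersolution (a := r - s) (s := s) (by linarith) hs.le (by linarith)
    (by linarith) (x := z) (R := (β + 1) * s) (by nlinarith) (fun y hy => by
      refine (ha y hy).trans (le_of_eq ?_)
      rw [hv.initial, inner_sub_right]
      ring)
  rw [sub_add_cancel] at key
  refine key.trans ?_
  have h1 := (abs_le.1 (hlim z hzx.le)).2
  simp only [rescale, zero_add, zero_mul, add_zero]
  linarith

/-- Consistency from both sides comes from the plane waves, and the ε-uniform estimate of |u^ε - g|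
gives local boundedness and the initial values. The limit equation has no spatial dependence, so its
spatial Lipschitz constant is 0. -/
theorem IsPlaneWaveFamily.exists_homogenized (h : IsPlaneWaveFamily H W Hbar) (hβ : 0 < β)
    (hp : ∀ x, MomentumLipschitz β (H x)) (hx : ∀ x y p, |H x p - H y p| ≤ K * ‖x - y‖)
    (hgr : ∀ x, LinearGrowth β (H x)) (hbar : MomentumLipschitz β Hbar) {T : ℝ} (hT : 0 < T)
    {g : Euc d → ℝ} (hg : UniformContinuous g) {u : ℝ → ℝ × Euc d → ℝ}
    (hu : ∀ ε > 0, IsCauchySolution T (fun x p => H (ε⁻¹ • x) p) g (u ε)) :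
    ∃ v, IsCauchySolution T (fun _ p => Hbar p) g v ∧
      ∀ S : Set (ℝ × Euc d), IsCompact S → S ⊆ Ico 0 T ×ˢ univ →
        TendstoUniformlyOn u v (𝓝[>] 0) S := by
  have hest : ∀ {η D : ℝ}, 0 < η → 0 ≤ D → (∀ x y, |g x - g y| ≤ η + D * ‖x - y‖) → ∀ ε > 0,
      ∀ t ∈ Ico 0 T, ∀ x, |u ε (t, x) - g x| ≤ 2 * η + β * (1 + D) * t :=
    fun hη hD hmod ε hε t ht x => (hu ε hε).abs_sub_initial_le hβ (fun y => hp (ε⁻¹ • y))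
      (K := K * ε⁻¹) (fun y y' q => by
        refine (hx _ _ q).trans (le_of_eq ?_)
        rw [← smul_sub, norm_smul, norm_inv, Real.norm_eq_abs, abs_of_pos hε, mul_assoc])
      (fun y => hgr (ε⁻¹ • y)) hη hD hmod ht x
  have hpos : ∀ᶠ ε in 𝓝[>] (0 : ℝ), 0 < ε := self_mem_nhdsWithin
  have hmem : ∀ z : ℝ × Euc d, ∀ᶠ q in 𝓝[Ico 0 T ×ˢ univ] z, q ∈ Ico 0 T ×ˢ (univ : Set (Euc d)) :=
    fun z => self_mem_nhdsWithin
  have hgn : ∀ (z : ℝ × Euc d), ∀ η > 0, ∀ᶠ q : ℝ × Euc d in 𝓝[Ico 0 T ×ˢ univ] z,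
      |g q.2 - g z.2| < η := fun z η hη => by
    have := Metric.tendsto_nhds.1 ((hg.continuous.comp continuous_snd).tendsto z) η hη
    exact nhdsWithin_le_nhds this
  refine exists_isCauchySolution_tendstoUniformlyOn (R := β + 1) (K := 0) hβ (fun _ => hbar)
    (by simp) (by linarith) hT ?_ (h.upperConsistent hβ hp hx hu) ?_ ?_
  · intro z _
    obtain ⟨D, hD, hmod⟩ := hg.exists_affine_modulus one_pos
    refine ⟨|g z.2| + 3 + β * (1 + D) * T, ?_⟩
    filter_upwards [hpos.prod_mk ((hmem z).and (hgn z 1 one_pos))]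
    rintro ⟨ε, t, y⟩ ⟨hε, ⟨ht, -⟩, hy⟩
    have h1 := hest one_pos hD hmod ε hε t ht y
    simp only at hε ht hy h1 ⊢
    have h2 : β * (1 + D) * t ≤ β * (1 + D) * T := by gcongr; exact ht.2.le
    have h3 := abs_sub_abs_le_abs_sub (u ε (t, y)) (g y)
    have h4 := abs_sub_abs_le_abs_sub (g y) (g z.2)
    linarith
  · exact h.dual.upperConsistent hβ (fun x => (hp x).neg) (K := K)
      (fun x y p => by rw [neg_sub_neg, norm_sub_rev]; exact hx y x (-p))
      (g := fun x => -g x) (fun ε hε => (hu ε hε).neg)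
  · intro x
    rw [Metric.tendsto_nhds]
    intro η hη
    obtain ⟨D, hD, hmod⟩ := hg.exists_affine_modulus (show 0 < η / 8 by positivity)
    have hsmall : ∀ᶠ q : ℝ × Euc d in 𝓝[Ico 0 T ×ˢ univ] ((0 : ℝ), x),
        β * (1 + D) * q.1 < η / 8 := by
      have hc : Continuous fun q : ℝ × Euc d => β * (1 + D) * q.1 := by fun_prop
      exact nhdsWithin_le_nhds ((hc.tendsto ((0 : ℝ), x)).eventually
        (gt_mem_nhds (by simpa using hη)))
    filter_upwards [hpos.prod_mk ((hmem (0, x)).and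
      ((hgn (0, x) (η / 8) (by positivity)).and hsmall))]
    rintro ⟨ε, t, y⟩ ⟨hε, ⟨ht, -⟩, hy, hty⟩
    have h1 := hest (by positivity) hD hmod ε hε t ht y
    simp only at hε ht hy h1 hty ⊢
    rw [Real.dist_eq]
    have := abs_sub_le (u ε (t, y)) (g y) (g x)
    linarith

end

/-! ### The random game -/

section

variable {d m : ℕ} {Ω : Type*} {A B : Set (Euc m)} {f : A → B → Euc d}
  {ℓ : Euc d → A → B → Ω → ℝ}

/-- No boundedness is needed: for an unbounded family both sides take the default value 0. -/
theorem Real.neg_iInf {ι : Sort*} (φ : ι → ℝ) : -⨅ i, φ i = ⨆ i, -φ i := by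
  have h : range (fun i => -φ i) = -range φ := by
    ext y
    simp [neg_eq_iff_eq_neg]
  rw [iSup, h, Real.sSup_neg, iInf]

theorem Real.neg_iSup {ι : Sort*} (φ : ι → ℝ) : -⨆ i, φ i = ⨅ i, -φ i := by
  have := Real.neg_iInf fun i => -φ i
  simp only [neg_neg] at this
  rw [← this, neg_neg]

/-- Minus min-max of the payoff is max-min of its opposite, and the tilt by `p` is absorbed in the
cost. The separate point `y` allows for the rescaled position x / ε. -/
theorem gameHam_minmax_eq {ℓ' : Euc d → A × B → ℝ} {ω : Ω} {p : Euc d} (y : Euc d) {x : Euc d}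
    (h : ∀ i, ℓ' x i = ℓ y i.1 i.2 ω + inner ℝ (f i.1 i.2) p) (q : Euc d) :
    gameHam minmax (fun i : A × B => f i.1 i.2) ℓ' x q = gameHamiltonian f ℓ y (p + q) ω := by
  simp only [gameHam, minmax, gameHamiltonian, Real.neg_iInf, Real.neg_iSup, h, inner_add_right]
  refine iSup_congr fun b => iInf_congr fun a => ?_
  ring

/-- The running cost, truncated at the level `c` and with the linear payoff `p` added. -/
noncomputable def clampedCost (f : A → B → Euc d) (ℓ : Euc d → A → B → Ω → ℝ) (c : ℝ) (p x : Euc d)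
    (i : A × B) (ω : Ω) : ℝ :=
  max (-c) (min c (ℓ x i.1 i.2 ω)) + inner ℝ (f i.1 i.2) p

theorem clampedCost_eq {c : ℝ} {ω : Ω} (h : ∀ x a b, |ℓ x a b ω| ≤ c) (p x : Euc d) (i : A × B) :
    clampedCost f ℓ c p x i ω = ℓ x i.1 i.2 ω + inner ℝ (f i.1 i.2) p := by
  obtain ⟨h1, h2⟩ := abs_le.1 (h x i.1 i.2)
  rw [clampedCost, min_eq_right h2, max_eq_right h1]

theorem isGame_minmax [Nonempty A] [Nonempty B] {F C L : ℝ} {ℓ' : Euc d → A × B → ℝ}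
    (hF : 0 < F) (hL : 0 ≤ L) (hfF : ∀ a b, ‖f a b‖ ≤ F) (hb : ∀ x i, |ℓ' x i| ≤ C)
    (hl : ∀ x y i, |ℓ' x i - ℓ' y i| ≤ L * ‖x - y‖) :
    IsGame minmax (fun i : A × B => f i.1 i.2) ℓ' F C L where
  mono := minmax_mono
  smul φ c hc _ := minmax_smul φ c hc
  F_pos := hF
  C_nonneg := (abs_nonneg _).trans (hb 0 (Classical.arbitrary _))
  L_nonneg := hL
  speed i := hfF i.1 i.2
  bdd := hb
  lip := hl

/-- The cost is bounded by one constant only almost surely, whereas the probabilistic estimates use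
the game structure for every ω. Truncation provides it, keeps the Lipschitz constant, and alters
nothing almost surely. -/
theorem isGame_clampedCost [Nonempty A] [Nonempty B] {F c L : ℝ} (hF : 0 < F) (hc : 0 ≤ c)
    (hL : 0 ≤ L) (hfF : ∀ a b, ‖f a b‖ ≤ F)
    (hl : ∀ x y a b ω, |ℓ x a b ω - ℓ y a b ω| ≤ L * ‖x - y‖) (p : Euc d) (ω : Ω) :
    IsGame minmax (fun i : A × B => f i.1 i.2) (fun x i => clampedCost f ℓ c p x i ω) F
      (c + F * ‖p‖) L := by
  refine isGame_minmax hF hL hfF (fun x i => ?_) (fun x y i => ?_)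
  · refine (abs_add_le _ _).trans (add_le_add ?_ ?_)
    · exact abs_le.2 ⟨le_max_left _ _, max_le (by linarith) (min_le_left _ _)⟩
    · refine (abs_real_inner_le_norm _ _).trans ?_
      gcongr
      exact hfF _ _
  · rw [clampedCost, clampedCost, add_sub_add_right_eq_sub]
    refine le_trans ?_ (hl x y i.1 i.2 ω)
    refine (abs_max_sub_max_le_max _ _ _ _).trans (max_le (by simp) ?_)
    exact (abs_min_sub_min_le_max _ _ _ _).trans (max_le (by simp) le_rfl)

theorem LongRangeIndependent.mono {ι ι' : Type*} [MeasurableSpace Ω] {P : Measure Ω}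
    {X : ι → Euc d → Ω → ℝ} {Y : ι' → Euc d → Ω → ℝ} (h : LongRangeIndependent P X)
    (hXY : ∀ i x, ∃ j, MeasurableSpace.comap (Y i x) inferInstance ≤
      MeasurableSpace.comap (X j x) inferInstance) : LongRangeIndependent P Y := by
  obtain ⟨ρ, hρ, hind⟩ := h
  have hle : ∀ S, generatedSigma Y S ≤ generatedSigma X S := fun S =>
    iSup_le fun i => iSup_le fun x => iSup_le fun hx => by
      obtain ⟨j, hj⟩ := hXY i x
      exact hj.trans (le_iSup_of_le j (le_iSup_of_le x (le_iSup_of_le hx le_rfl)))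
  exact ⟨ρ, hρ, fun S S' hS =>
    indep_of_indep_of_le_left (indep_of_indep_of_le_right (hind S S' hS) (hle S')) (hle S)⟩

theorem longRangeIndependent_clampedCost [MeasurableSpace Ω] {P : Measure Ω}
    (h : LongRangeIndependent P fun (i : A × B) x ω => ℓ x i.1 i.2 ω) (c : ℝ) (p : Euc d) :
    LongRangeIndependent P fun i x ω => clampedCost f ℓ c p x i ω := by
  refine h.mono fun i x => ⟨i, ?_⟩
  have hm : Measurable fun s : ℝ => max (-c) (min c s) + inner ℝ (f i.1 i.2) p := by fun_prop
  have e : (fun ω => clampedCost f ℓ c p x i ω) =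
      (fun s : ℝ => max (-c) (min c s) + inner ℝ (f i.1 i.2) p) ∘ fun ω => ℓ x i.1 i.2 ω := rfl
  rw [e, ← MeasurableSpace.comap_comp]
  exact MeasurableSpace.comap_mono hm.comap_le

variable [MeasurableSpace Ω] {τ : Euc d → Ω → Ω}

theorem IsRunningCost.measurable_apply (hℓ : IsRunningCost τ ℓ) (x : Euc d) (a : A) (b : B) :
    Measurable (ℓ x a b) :=
  hℓ.measurable.comp (f := fun ω : Ω => (x, a, b, ω)) (by fun_prop)

theorem IsRunningCost.continuous_control (hℓ : IsRunningCost τ ℓ) (x : Euc d) (ω : Ω) :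
    Continuous fun i : A × B => ℓ x i.1 i.2 ω :=
  (hℓ.uniformContinuous ω).continuous.comp (f := fun i : A × B => (x, i.1, i.2)) (by fun_prop)

theorem IsRunningCost.shift {P : Measure Ω} (hℓ : IsRunningCost τ ℓ) (hτ : IsErgodicAction P τ)
    (x y : Euc d) (a : A) (b : B) (ω : Ω) : ℓ x a b (τ y ω) = ℓ (x + y) a b ω := by
  rw [hℓ.stationary x, hℓ.stationary (x + y), hτ.add]

/-- By ergodicity, the running cost is bounded uniformly in the environment. -/
theorem IsRunningCost.exists_ae_bound [Nonempty A] [Nonempty B] {P : Measure Ω}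
    (hℓ : IsRunningCost τ ℓ) (hτ : IsErgodicAction P τ) :
    ∃ c, 0 ≤ c ∧ ∀ᵐ ω ∂P, ∀ x a b, |ℓ x a b ω| ≤ c := by
  set φ : Ω → ℝ := fun ω => ⨆ q : Euc d × A × B, |ℓ q.1 q.2.1 q.2.2 ω| with hφ
  have hb : ∀ ω, BddAbove (range fun q : Euc d × A × B => |ℓ q.1 q.2.1 q.2.2 ω|) := fun ω => by
    obtain ⟨C, hC⟩ := hℓ.bounded ω
    exact ⟨C, by rintro _ ⟨q, rfl⟩; exact hC _ _ _⟩
  have hm : Measurable φ := by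
    have e : φ = fun ω => ⨆ n, |ℓ (TopologicalSpace.denseSeq (Euc d × A × B) n).1
        (TopologicalSpace.denseSeq (Euc d × A × B) n).2.1
        (TopologicalSpace.denseSeq (Euc d × A × B) n).2.2 ω| := by
      ext ω
      exact ciSup_denseSeq (hℓ.uniformContinuous ω).continuous.abs (hb ω)
    rw [e]
    exact Measurable.iSup fun n => (hℓ.measurable_apply _ _ _).abs
  -- The supremum over all space is invariant under every shift, hence almost surely constant.
  have hinv : ∀ x ω, φ (τ x ω) = φ ω := fun x ω => by
    simp only [hφ, hℓ.shift hτ]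
    exact ((Equiv.addRight x).prodCongr (Equiv.refl (A × B))).iSup_congr fun q => rfl
  obtain ⟨c, hc⟩ := hτ.ergodic φ hm fun x => Eventually.of_forall (hinv x)
  refine ⟨|c|, abs_nonneg c, hc.mono fun ω hω x a b => ?_⟩
  rw [← hω]
  exact (le_ciSup (hb ω) (x, a, b)).trans (le_abs_self _)

theorem IsOrientedDynamics.exists_speed_bound [CompactSpace A] [CompactSpace B]
    (hf : IsOrientedDynamics f) : ∃ F, 0 < F ∧ ∀ a b, ‖f a b‖ ≤ F := by
  obtain ⟨D, hD⟩ := isCompact_univ.exists_bound_of_continuousOn hf.continuous.continuousOn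
  exact ⟨max D 1, lt_max_of_lt_right one_pos, fun a b =>
    (hD (a, b) trivial).trans (le_max_left _ _)⟩

/-- The exceptional null set of the law of large numbers depends on the momentum. Countably many
momenta suffice because W p (N, x) / N and the limit are Lipschitz in `p`, uniformly in N and x. -/
theorem hasLargeScaleLimit_of_dense {W : Euc d → ℝ × Euc d → ℝ} {c : Euc d → ℝ} {β : ℝ}
    (hβ : 0 < β) {S : Set (Euc d)} (hS : Dense S) (h : ∀ q ∈ S, HasLargeScaleLimit (W q) (c q))
    (hW : ∀ p q (N : ℕ) x, |W p (N, x) - W q (N, x)| ≤ β * ‖p - q‖ * N)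
    (hc : ∀ p q, |c p - c q| ≤ β * ‖p - q‖) (p : Euc d) : HasLargeScaleLimit (W p) (c p) := by
  intro R η hη
  obtain ⟨q, hqS, hq⟩ := hS.exists_dist_lt p (show 0 < η / (4 * β) by positivity)
  have hpq : β * ‖p - q‖ ≤ η / 4 := by
    rw [dist_eq_norm, lt_div_iff₀ (by positivity)] at hq
    linarith
  filter_upwards [h q hqS R (η / 2) (by positivity)] with N hN x hx
  have h1 := hN x hx
  have h2 := hW p q N x
  have h3 : |c q * N - c p * N| ≤ β * ‖p - q‖ * N := by
    rw [← sub_mul, abs_mul, Nat.abs_cast, abs_sub_comm]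
    gcongr
    exact hc p q
  have h4 : β * ‖p - q‖ * N ≤ η / 4 * N := by gcongr
  have h5 := abs_sub_le (W p (N, x)) (W q (N, x)) (c p * N)
  have h6 := abs_sub_le (W q (N, x)) (c q * N) (c p * N)
  linarith

end

/-! ### The homogenization theorem -/

theorem mainTheorem1 {d m : ℕ} {Ω : Type*} [MeasurableSpace Ω] (P : Measure Ω)
    [IsProbabilityMeasure P] (τ : Euc d → Ω → Ω) (hτ : IsErgodicAction P τ)
    (A B : Set (Euc m)) (hA : IsCompact A) (hB : IsCompact B)
    (hA₀ : A.Nonempty) (hB₀ : B.Nonempty)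
    (f : A → B → Euc d) (hf : IsOrientedDynamics f)
    (ℓ : Euc d → A → B → Ω → ℝ) (hℓ : IsRunningCost τ ℓ)
    (hℓ_indep : LongRangeIndependent P fun (i : A × B) x ω => ℓ x i.1 i.2 ω)
    (β : ℝ) (hH : IsHamiltonian β (gameHamiltonian f ℓ)) :
    ∃ Hbar : Euc d → ℝ,
      Continuous Hbar ∧ LinearGrowth β Hbar ∧ MomentumLipschitz β Hbar ∧
      ∃ Ω₀ : Set Ω, MeasurableSet Ω₀ ∧ P Ω₀ = 1 ∧
        ∀ ω ∈ Ω₀, ∀ T : ℝ, 0 < T → ∀ g : Euc d → ℝ, UniformContinuous g →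
          (∀ ε : ℝ, 0 < ε →
            CauchyWellPosed T (fun x p => gameHamiltonian f ℓ (ε⁻¹ • x) p ω) g) ∧
          CauchyWellPosed T (fun _ p => Hbar p) g ∧
          ∀ (u : ℝ → ℝ × Euc d → ℝ) (ubar : ℝ × Euc d → ℝ),
            (∀ ε : ℝ, 0 < ε →
              IsCauchySolution T (fun x p => gameHamiltonian f ℓ (ε⁻¹ • x) p ω) g (u ε)) →
            IsCauchySolution T (fun _ p => Hbar p) g ubar →
            ∀ K : Set (ℝ × Euc d), IsCompact K → K ⊆ Ico 0 T ×ˢ univ →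
              TendstoUniformlyOn u ubar (𝓝[>] 0) K := by
  have : CompactSpace A := isCompact_iff_compactSpace.1 hA
  have : CompactSpace B := isCompact_iff_compactSpace.1 hB
  have : Nonempty A := hA₀.to_subtype
  have : Nonempty B := hB₀.to_subtype
  have hβ := hH.pos
  obtain ⟨F, hF, hfF⟩ := hf.exists_speed_bound
  obtain ⟨L, hL, hlip⟩ := hℓ.lipschitz
  obtain ⟨δ, hδ, e, he, hfe⟩ := hf.oriented
  obtain ⟨C, hC, hbdd⟩ := hℓ.exists_ae_bound hτ
  set W : Ω → Euc d → ℝ × Euc d → ℝ := fun ω p => gameValue minmax (fun i : A × B => f i.1 i.2)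
    (fun x i => clampedCost f ℓ C p x i ω) (fun _ => 0) with hW
  have hG := isGame_clampedCost hF hC hL.le hfF hlip
  have hlimit : ∀ p, ∃ c, ∀ᵐ ω ∂P, HasLargeScaleLimit (W ω p) c := fun p =>
    exists_ae_tendsto_valueField hf.continuous (hG p)
      (fun x ω => (continuous_const.max (continuous_const.min (hℓ.continuous_control x ω))).add
        (hf.continuous.inner continuous_const))
      (fun x i => (measurable_const.max (measurable_const.min
        (hℓ.measurable_apply x i.1 i.2))).add_const _)
      (longRangeIndependent_clampedCost hℓ_indep C p) he hδ (fun i => hfe i.1 i.2) hτ.preserving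
      (fun x y i ω => by simp only [clampedCost, hℓ.shift hτ])
  choose c hc using hlimit
  have hsol : ∀ ω, (∀ x a b, |ℓ x a b ω| ≤ C) → ∀ p T, 0 < T →
      IsCauchySolution T (fun x q => gameHamiltonian f ℓ x (p + q) ω) (fun _ => 0) (W ω p) := by
    intro ω hω p T hT
    have h := (hG p ω).isCauchySolution linBdd_zero continuous_const hT
    have e : gameHam minmax (fun i : A × B => f i.1 i.2) (fun x i => clampedCost f ℓ C p x i ω) =
        fun x q => gameHamiltonian f ℓ x (p + q) ω := by
      ext x q
      exact gameHam_minmax_eq x (fun i => clampedCost_eq hω p x i) q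
    rwa [e] at h
  have hWlip : ∀ ω, (∀ x a b, |ℓ x a b ω| ≤ C) → ∀ p q (N : ℕ) x,
      |W ω p (N, x) - W ω q (N, x)| ≤ β * ‖p - q‖ * N := fun ω hω p q N x =>
    abs_planeWave_sub_le hβ (fun x => hH.lip_momentum x ω) (fun x y p => hH.lip_space x y p ω)
      (hsol ω hω p (N + 1) (by positivity)) (hsol ω hω q (N + 1) (by positivity))
      ⟨Nat.cast_nonneg N, by simp⟩ x
  -- The constants are deterministic, so a single environment that is good for both momenta is
  -- enough to compare them.
  have hclip : ∀ p q, |c p - c q| ≤ β * ‖p - q‖ := fun p q => by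
    obtain ⟨ω, hω, h1, h2⟩ := (hbdd.and ((hc p).and (hc q))).exists
    exact (h1.sub h2).abs_limit_le fun N => hWlip ω hω p q N 0
  have hcgr : ∀ p, |c p| ≤ β * (1 + ‖p‖) := fun p => by
    obtain ⟨ω, hω, h1⟩ := (hbdd.and (hc p)).exists
    exact h1.abs_limit_le fun N => abs_planeWave_le hβ (fun x => hH.lip_momentum x ω)
      (fun x y p => hH.lip_space x y p ω) (fun x => hH.growth x ω)
      (hsol ω hω p (N + 1) (by positivity)) ⟨Nat.cast_nonneg N, by simp⟩ 0
  have hbar : MomentumLipschitz β fun p => -c p := fun p q => by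
    rw [neg_sub_neg, abs_sub_comm]
    exact hclip p q
  have hgood : ∀ᵐ ω ∂P, (∀ x a b, |ℓ x a b ω| ≤ C) ∧ ∀ n : ℕ,
      HasLargeScaleLimit (W ω (TopologicalSpace.denseSeq (Euc d) n))
        (c (TopologicalSpace.denseSeq (Euc d) n)) :=
    hbdd.and (ae_all_iff.2 fun n => hc _)
  -- The set of good environments need not be measurable; the complement of a measurable null set
  -- containing the bad ones is used instead.
  obtain ⟨E, hgoodE, hEmeas, hEnull⟩ := exists_measurable_superset_of_null (ae_iff.1 hgood)
  refine ⟨fun p => -c p, ?_, fun p => by rw [abs_neg]; exact hcgr p, hbar, Eᶜ, hEmeas.compl,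
    (prob_compl_eq_one_iff hEmeas).2 hEnull, fun ω hωE T hT g hg => ?_⟩
  · exact (LipschitzWith.of_dist_le_mul (K := ⟨β, hβ.le⟩) fun p q => by
      rw [Real.dist_eq, dist_eq_norm]; exact hbar p q).continuous
  obtain ⟨hω, hdense⟩ := not_not.1 fun h => hωE (hgoodE h)
  have hlim : ∀ p, HasLargeScaleLimit (W ω p) (c p) :=
    hasLargeScaleLimit_of_dense hβ (TopologicalSpace.denseRange_denseSeq (Euc d))
      (by rintro _ ⟨n, rfl⟩; exact hdense n) (hWlip ω hω) hclip
  have hplane : IsPlaneWaveFamily (fun x p => gameHamiltonian f ℓ x p ω) (W ω) fun p => -c p :=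
    ⟨hsol ω hω, fun p s hs R η hη => by
      rw [neg_neg]
      exact (hlim p).eventually_abs_le
        (fun t ht x => (hG p ω).abs_gameValue_sub_floor_le ht x) hs hη⟩
  have hlipε : ∀ ε : ℝ, 0 < ε → ∀ x y p, |gameHamiltonian f ℓ (ε⁻¹ • x) p ω -
      gameHamiltonian f ℓ (ε⁻¹ • y) p ω| ≤ β * ε⁻¹ * ‖x - y‖ := fun ε hε x y p => by
    refine (hH.lip_space _ _ p ω).trans (le_of_eq ?_)
    rw [← smul_sub, norm_smul, norm_inv, Real.norm_eq_abs, abs_of_pos hε, mul_assoc]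
  have hex : ∀ ε : ℝ, 0 < ε → ∃ u,
      IsCauchySolution T (fun x p => gameHamiltonian f ℓ (ε⁻¹ • x) p ω) g u := fun ε hε => by
    have G : IsGame minmax (fun i : A × B => f i.1 i.2) (fun x i => ℓ (ε⁻¹ • x) i.1 i.2 ω) F C
        (L * ε⁻¹) := by
      refine isGame_minmax hF (by positivity) hfF (fun x i => hω _ _ _) fun x y i => ?_
      refine (hlip _ _ i.1 i.2 ω).trans (le_of_eq ?_)
      rw [← smul_sub, norm_smul, norm_inv, Real.norm_eq_abs, abs_of_pos hε, mul_assoc]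
    have h := G.isCauchySolution hg.linBdd hg.continuous hT
    have e : gameHam minmax (fun i : A × B => f i.1 i.2) (fun x i => ℓ (ε⁻¹ • x) i.1 i.2 ω) =
        fun x p => gameHamiltonian f ℓ (ε⁻¹ • x) p ω := by
      ext x q
      rw [gameHam_minmax_eq (ℓ := ℓ) (ω := ω) (p := 0) (ε⁻¹ • x) (by simp) q, zero_add]
    rw [e] at h
    exact ⟨_, h⟩
  have hhom : ∀ u : ℝ → ℝ × Euc d → ℝ, (∀ ε > 0,
      IsCauchySolution T (fun x p => gameHamiltonian f ℓ (ε⁻¹ • x) p ω) g (u ε)) →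
      ∃ v, IsCauchySolution T (fun _ p => -c p) g v ∧
        ∀ S : Set (ℝ × Euc d), IsCompact S → S ⊆ Ico 0 T ×ˢ univ →
          TendstoUniformlyOn u v (𝓝[>] 0) S := fun u hu =>
    hplane.exists_homogenized hβ (fun x => hH.lip_momentum x ω)
      (fun x y p => hH.lip_space x y p ω) (fun x => hH.growth x ω) hbar hT hg hu
  have huniq : ∀ u v, IsCauchySolution T (fun _ p => -c p) g u →
      IsCauchySolution T (fun _ p => -c p) g v → EqOn u v (Ico 0 T ×ˢ univ) := fun u v hu hv =>
    hu.eqOn hβ (fun _ => hbar) (K := 0) (by simp) hv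
  refine ⟨fun ε hε => ⟨hex ε hε, fun u v hu hv =>
    hu.eqOn hβ (fun x => hH.lip_momentum (ε⁻¹ • x) ω) (hlipε ε hε) hv⟩, ⟨?_, huniq⟩, ?_⟩
  -- The solution of the effective problem is obtained as the limit of the oscillating ones; for ε ≤
  -- 0 the family is filled with 0, which the limit ε → 0⁺ does not see.
  · have hex' : ∀ ε : ℝ, ∃ u, 0 < ε →
        IsCauchySolution T (fun x p => gameHamiltonian f ℓ (ε⁻¹ • x) p ω) g u := fun ε => by
      by_cases hε : 0 < ε
      · obtain ⟨u, hu⟩ := hex ε hε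
        exact ⟨u, fun _ => hu⟩
      · exact ⟨0, fun h => absurd h hε⟩
    choose u hu using hex'
    obtain ⟨v, hv, -⟩ := hhom u hu
    exact ⟨v, hv⟩
  · intro u ubar hu hubar K hK hKT
    obtain ⟨v, hv, hlimv⟩ := hhom u hu
    exact (hlimv K hK hKT).congr_right ((huniq v ubar hv hubar).mono hKT)
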